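/- **Notation.** Let $p\in\mathbb C$, $|p|<1$, and let $q,v_1,v_2\in\mathbb C^*$ with fixed square roots $\sqrt q,\sqrt{v_1},\sqrt{v_2}$; half-integer powers of $q$ are powers of $\sqrt q$, and $\sqrt{v_1v_2}=\sqrt{v_1}\sqrt{v_2}$, $\sqrt{v_1/v_2}=\sqrt{v_1}/\sqrt{v_2}$, $\sqrt{v_2/v_1}=\sqrt{v_2}/\sqrt{v_1}$. Put $\theta_p(x)=\prod_{k\ge0}(1-p^kx)(1-p^{k+1}/x)$, $\theta_p(a;q)_m=\prod_{0\le i<m}\theta_p(q^ia)$; several arguments before the semicolon (or inside $\theta_p$) mean a product. Let $N,T\ge 0$ and $0\le S,t\le T$ be integers. Let $\mathcal X^{S,t}$ be the set of all $X=(x_1<\dots<x_N)\in\mathbb Z^N$ with $\max(0,t+S-T)\le x_k\le\min(t+N-1,S+N-1)$. Put $$A=q^{\frac t2+\frac S2-T+\frac12}\sqrt{v_1v_2},\quad B=q^{\frac t2+\frac S2+T+\frac12}\sqrt{v_2/v_1},\quad C=\frac{q^{\frac t2-\frac S2-N+\frac12}}{\sqrt{v_1v_2}},$$ $$D=\frac{q^{-\frac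 t2+\frac S2-N+\frac12}}{\sqrt{v_1v_2}},\quad E=q^{-\frac t2-\frac S2+\frac12}\sqrt{v_1/v_2},\quad F=q^{-\frac t2-\frac S2+\frac12}\sqrt{v_1v_2},\qquad z_k=Fq^{x_k},$$ $$\varphi_{t,S}(x,y)=q^{-x}\theta_p(q^{x-y},q^{x+y+1-t-S}v_1v_2).$$ **The measure.** $\rho_{S,t}=\rho_{S,t}^{v_1,v_2}$ is the complex measure on $\mathcal X^{S,t}$ of total mass $1$ with $\rho_{S,t}(X)$ proportional to $$\prod_{k<l}\varphi_{t,S}(x_k,x_l)^2\prod_k q^{(2N-1)x_k}\theta_p(q^{2x_k+1-t-S}v_1v_2)\,\frac{\theta_p(q^{1-N-t},q^{1-N-S},q^{1-t-S}v_1,q^{1+T}v_2,q^{1-T}v_1v_2,q^{1-t-S}v_1v_2;q)_{x_k}}{\theta_p(q,q^{1-S-t+T},q^{1-t-T-S}v_1,qv_2,q^{1+N-S}v_1v_2,q^{1+N-t}v_1v_2;q)_{x_k}},$$ where, if $t+S>T$, the factor $\theta_p(q^0)=0$ that $\theta_p(q^{1-S-t+T};q)_{x_k}$ then contains for every admissible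 $x_k$ is omitted. **The matrices.** For $a,b,c\in\mathbb C^*$ put $$f^+_{abc}(x_k)=-\frac{q^{-x_k}\theta_p(az_k,bz_k,cz_k,q^{1-N}z_k/abc)}{\theta_p(z_k^2)},\qquad f^-_{abc}(x_k)=\frac{q^{-x_k-N+1}\theta_p(z_k/a,z_k/b,z_k/c,q^{N-1}z_kabc)}{\theta_p(z_k^2)},$$ $$n_{abc}=\Big(\frac{q^{1-N}F}{abc}\Big)^N\prod_{0\le k<N}\theta_p(q^kab,q^kac,q^kbc).$$ For $X\in\mathcal X^{S,t}$ and $Y\in\mathcal X^{S',t'}$ set $$U^{S',t'}_{abc}(X,Y)=\frac{q^{N(N-1)/2}}{n_{abc}}\prod_{k<l}\frac{\varphi_{t',S'}(y_k,y_l)}{\varphi_{t,S}(x_k,x_l)}\prod_{k:\,y_k=x_k+1}f^+_{abc}(x_k)\prod_{k:\,y_k=x_k}f^-_{abc}(x_k)$$ if $y_k-x_k\in\{0,1\}$ for all $k$, and $U^{S',t'}_{abc}(X,Y)=0$ otherwise; $$V^{S',t'}_{abc}(X,Y)=\frac{1}{n_{abc}}\prod_{k<l}\frac{\varphi_{t',S'}(y_k,y_l)}{\varphi_{t,S}(x_k,x_l)}\prod_{k:\,y_k=x_k}f^+_{abc}(x_k)\prod_{k:\,y_k=x_k-1}f^-_{abc}(x_k)$$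 if $y_k-x_k\in\{0,-1\}$ for all $k$, and $V^{S',t'}_{abc}(X,Y)=0$ otherwise. Define $$P^{S,t}_{t+}=U^{S,t+1}_{ABC},\quad P^{S,t}_{t-}=V^{S,t-1}_{DEF},\quad {}_{t+}P^{S,t}_{S+}=U^{S+1,t}_{ABD},\quad {}_{t-}P^{S,t}_{S+}=U^{S+1,t}_{DEA},\quad {}_{t+}P^{S,t}_{S-}=V^{S-1,t}_{BCF},\quad {}_{t-}P^{S,t}_{S-}=V^{S-1,t}_{EFC}.$$ **Theorem.** Consider any one of the six matrices $P$, with target line $(S',t')$ satisfying $0\le S',t'\le T$. Assume that no denominator in the definition of $P$ vanishes, that is, $n_{abc}\ne0$, and $\varphi_{t,S}(x_k,x_l)\neq0$ for $k<l$ and $\theta_p(z_k^2)\ne0$ for all $X\in\mathcal X^{S,t}$. Then all row sums of $P$ are one: for all $X\in\mathcal X^{S,t}$, $$\sum_{Y\in\mathcal X^{S,t\pm1}}P^{S,t}_{t\pm}(X,Y)=1,\qquad \sum_{Y\in\mathcal X^{S+1,t}}{}_{t\pm}P^{S,t}_{S+}(X,Y)=1,\qquad \sum_{Y\in\mathcal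 X^{S-1,t}}{}_{t\pm}P^{S,t}_{S-}(X,Y)=1 .$$ If moreover the source measure and the target measure below are well defined (the denominators in their definition and the total masses before normalization do not vanish), then, for all $Y$ in the target set, $$\rho_{S,t\pm1}(Y)=\sum_{X\in\mathcal X^{S,t}}P^{S,t}_{t\pm}(X,Y)\,\rho_{S,t}(X),$$ $$\rho_{S+1,t}(Y)=\sum_{X\in\mathcal X^{S,t}}{}_{t+}P^{S,t}_{S+}(X,Y)\,\rho_{S,t}(X),\qquad \rho_{S-1,t}(Y)=\sum_{X\in\mathcal X^{S,t}}{}_{t-}P^{S,t}_{S-}(X,Y)\,\rho_{S,t}(X),$$ $$\rho^{\,qv_1,\,v_2/q}_{S+1,t}(Y)=\sum_{X\in\mathcal X^{S,t}}{}_{t-}P^{S,t}_{S+}(X,Y)\,\rho_{S,t}(X),\qquad \rho^{\,v_1/q,\,qv_2}_{S-1,t}(Y)=\sum_{X\in\mathcal X^{S,t}}{}_{t+}P^{S,t}_{S-}(X,Y)\,\rho_{S,t}(X).$$ -/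

import Mathlib

open scoped BigOperators

noncomputable section

/-- The theta function `θ_p(x) = ∏_{k ≥ 0} (1 - p^k x) (1 - p^(k+1) / x)`
(convergent for `|p| < 1` and `x ≠ 0`). -/
def theta (p x : ℂ) : ℂ := ∏' k : ℕ, (1 - p ^ k * x) * (1 - p ^ (k + 1) / x)

/-- The theta-Pochhammer symbol `θ_p(a; q)_n = ∏_{0 ≤ i < n} θ_p(q^i a)`. -/
def thetaPoch (p q a : ℂ) (n : ℕ) : ℂ := ∏ i ∈ Finset.range n, theta p (q ^ i * a)

/-- The data of the model: the nome `p`, the complex parameters `q, v₁, v₂`, given through chosen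
square roots `sq, sv₁, sv₂` (so `q = sq²`, `v₁ = sv₁²`, `v₂ = sv₂²`), the number `N` of
particles, and the width `T` of the hexagon. -/
structure EllipticModel where
  p : ℂ
  sq : ℂ
  sv₁ : ℂ
  sv₂ : ℂ
  N : ℕ
  T : ℕ
  norm_p_lt_one : ‖p‖ < 1
  sq_ne_zero : sq ≠ 0
  sv₁_ne_zero : sv₁ ≠ 0
  sv₂_ne_zero : sv₂ ≠ 0

namespace EllipticModel

variable (M : EllipticModel)

def q : ℂ := M.sq ^ 2

def v₁ : ℂ := M.sv₁ ^ 2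

def v₂ : ℂ := M.sv₂ ^ 2

/-- `M.θ x` is `θ_p(x)`. -/
def θ (x : ℂ) : ℂ := theta M.p x

/-- `M.poch a x` is `θ_p(a; q)_x` for an integer `x ≥ 0`. -/
def poch (a : ℂ) (x : ℤ) : ℂ := thetaPoch M.p M.q a x.toNat

/-- The model with `(v₁, v₂)` replaced by `(q^n v₁, q^(-n) v₂)`; everything else, in particular
the product `v₁ v₂`, is unchanged. -/
def shift (n : ℤ) : EllipticModel where
  p := M.p
  sq := M.sq
  sv₁ := M.sq ^ n * M.sv₁
  sv₂ := M.sq ^ (-n) * M.sv₂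
  N := M.N
  T := M.T
  norm_p_lt_one := M.norm_p_lt_one
  sq_ne_zero := M.sq_ne_zero
  sv₁_ne_zero := mul_ne_zero (zpow_ne_zero _ M.sq_ne_zero) M.sv₁_ne_zero
  sv₂_ne_zero := mul_ne_zero (zpow_ne_zero _ M.sq_ne_zero) M.sv₂_ne_zero

/-! ### Positions and configurations of particles -/

/-- All possible positions of a particle on the vertical line at `t`: the integers `x` with
`max (0, t + S - T) ≤ x ≤ min (t + N - 1, S + N - 1)`. -/
def positions (S t : ℤ) : Finset ℤ :=
  Finset.Icc (max 0 (t + S - M.T)) (min (t + M.N - 1) (S + M.N - 1))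

open Classical in
/-- All `N`-tuples `x_1 < ... < x_N` of positions on the vertical line at `t`. -/
def config (S t : ℤ) : Finset (Fin M.N → ℤ) :=
  (Fintype.piFinset fun _ : Fin M.N => M.positions S t).filter StrictMono

/-! ### The six parameters (half-integer powers of `q` are integer powers of `sq`) -/

/-- `A = q^(t/2 + S/2 - T + 1/2) √(v₁ v₂)`. -/
def A (S t : ℤ) : ℂ := M.sq ^ (t + S - 2 * M.T + 1) * (M.sv₁ * M.sv₂)

/-- `B = q^(t/2 + S/2 + T + 1/2) √(v₂ / v₁)`. -/
def B (S t : ℤ) : ℂ := M.sq ^ (t + S + 2 * M.T + 1) * (M.sv₂ / M.sv₁)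

/-- `C = q^(t/2 - S/2 - N + 1/2) / √(v₁ v₂)`. -/
def C (S t : ℤ) : ℂ := M.sq ^ (t - S - 2 * M.N + 1) / (M.sv₁ * M.sv₂)

/-- `D = q^(-t/2 + S/2 - N + 1/2) / √(v₁ v₂)`. -/
def D (S t : ℤ) : ℂ := M.sq ^ (-t + S - 2 * M.N + 1) / (M.sv₁ * M.sv₂)

/-- `E = q^(-t/2 - S/2 + 1/2) √(v₁ / v₂)`. -/
def E (S t : ℤ) : ℂ := M.sq ^ (-t - S + 1) * (M.sv₁ / M.sv₂)

/-- `F = q^(-t/2 - S/2 + 1/2) √(v₁ v₂)`. -/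
def F (S t : ℤ) : ℂ := M.sq ^ (-t - S + 1) * (M.sv₁ * M.sv₂)

/-- `z = F q^x`. -/
def z (S t x : ℤ) : ℂ := M.F S t * M.q ^ x

/-! ### The discrete elliptic Selberg measure -/

/-- The elliptic Vandermonde factor
`φ_{t,S}(x, y) = q^(-x) θ_p(q^(x-y), q^(x+y+1-t-S) v₁ v₂)`. -/
def phi (S t x y : ℤ) : ℂ :=
  M.q ^ (-x) * M.θ (M.q ^ (x - y)) * M.θ (M.q ^ (x + y + 1 - t - S) * M.v₁ * M.v₂)

/-- Numerator of the univariate factor of the Selberg density. -/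
def uniNum (S t x : ℤ) : ℂ :=
  M.q ^ ((2 * (M.N : ℤ) - 1) * x) * M.θ (M.q ^ (2 * x + 1 - t - S) * M.v₁ * M.v₂) *
    (M.poch (M.q ^ (1 - (M.N : ℤ) - t)) x * M.poch (M.q ^ (1 - (M.N : ℤ) - S)) x *
      M.poch (M.q ^ (1 - t - S) * M.v₁) x * M.poch (M.q ^ (1 + (M.T : ℤ)) * M.v₂) x *
      M.poch (M.q ^ (1 - (M.T : ℤ)) * M.v₁ * M.v₂) x *
      M.poch (M.q ^ (1 - t - S) * M.v₁ * M.v₂) x)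

/-- The factor `θ_p(q^(1-S-t+T); q)_x` of the denominator of the Selberg density. If `t + S > T`
then, for every position `x` on the line, this product contains the factor `θ_p(1) = 0` with index
`i = t + S - T - 1`; that factor, which is the same for all configurations, is left out (it is
absorbed in the normalizing constant). If `t + S ≤ T` then nothing is left out. -/
def pochReg (S t x : ℤ) : ℂ :=
  ∏ i ∈ (Finset.range x.toNat).filter (fun i : ℕ => (i : ℤ) ≠ t + S - M.T - 1),
    M.θ (M.q ^ i * M.q ^ (1 - S - t + (M.T : ℤ)))

/-- Denominator of the univariate factor of the Selberg density. -/
def uniDen (S t x : ℤ) : ℂ :=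
  M.poch M.q x * M.pochReg S t x *
    M.poch (M.q ^ (1 - t - (M.T : ℤ) - S) * M.v₁) x * M.poch (M.q * M.v₂) x *
    M.poch (M.q ^ (1 + (M.N : ℤ) - S) * M.v₁ * M.v₂) x *
    M.poch (M.q ^ (1 + (M.N : ℤ) - t) * M.v₁ * M.v₂) x

/-- The unnormalized discrete elliptic Selberg density
`∏_{k<l} φ_{t,S}(x_k, x_l)² · ∏_k uniNum(x_k) / uniDen(x_k)`. -/
def selbergWeight (S t : ℤ) (X : Fin M.N → ℤ) : ℂ :=
  (∏ k, ∏ l ∈ Finset.Ioi k, M.phi S t (X k) (X l) ^ 2) *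
    ∏ k, M.uniNum S t (X k) / M.uniDen S t (X k)

/-- The total mass of the unnormalized Selberg density. -/
def selbergMass (S t : ℤ) : ℂ := ∑ X ∈ M.config S t, M.selbergWeight S t X

/-- The measure `ρ_{S,t}`: the discrete elliptic Selberg density, normalized to total mass one. -/
def rho (S t : ℤ) (X : Fin M.N → ℤ) : ℂ := M.selbergWeight S t X / M.selbergMass S t

/-! ### The six matrices -/

/-- `-q^(-x) θ_p(a z, b z, c z, q^(1-N) z / (a b c)) / θ_p(z²)` with `z = F q^x`. -/
def plusFactor (S t : ℤ) (a b c : ℂ) (x : ℤ) : ℂ :=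
  -(M.q ^ (-x) * (M.θ (a * M.z S t x) * M.θ (b * M.z S t x) * M.θ (c * M.z S t x) *
    M.θ (M.q ^ (1 - (M.N : ℤ)) * M.z S t x / (a * b * c))) / M.θ (M.z S t x ^ 2))

/-- `q^(-x-N+1) θ_p(z / a, z / b, z / c, q^(N-1) z a b c) / θ_p(z²)` with `z = F q^x`. -/
def minusFactor (S t : ℤ) (a b c : ℂ) (x : ℤ) : ℂ :=
  M.q ^ (-x - (M.N : ℤ) + 1) * (M.θ (M.z S t x / a) * M.θ (M.z S t x / b) *
    M.θ (M.z S t x / c) * M.θ (M.q ^ ((M.N : ℤ) - 1) * M.z S t x * (a * b * c))) /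
    M.θ (M.z S t x ^ 2)

/-- `∏_{k<l} φ_{t',S'}(y_k, y_l) / φ_{t,S}(x_k, x_l)`. -/
def phiRatio (S t S' t' : ℤ) (X Y : Fin M.N → ℤ) : ℂ :=
  ∏ k, ∏ l ∈ Finset.Ioi k, M.phi S' t' (Y k) (Y l) / M.phi S t (X k) (X l)

/-- The reciprocal of the normalizing constant of the matrices whose particles stay or jump
down (by one). It does not depend on the configurations. -/
def normDown (S t : ℤ) (a b c : ℂ) : ℂ :=
  (M.q ^ (1 - (M.N : ℤ)) * M.F S t / (a * b * c)) ^ M.N *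
    ∏ k ∈ Finset.range M.N,
      (M.θ (M.q ^ k * (a * b)) * M.θ (M.q ^ k * (a * c)) * M.θ (M.q ^ k * (b * c)))

/-- The reciprocal of the normalizing constant of the matrices whose particles stay or jump
up (by one). It does not depend on the configurations. -/
def normUp (S t : ℤ) (a b c : ℂ) : ℂ := M.normDown S t a b c / M.q ^ (M.N.choose 2)

open Classical in
/-- The matrix from configurations of `(S, t)` to configurations of `(S', t')` attached to the
parameters `a, b, c`, in which every particle stays or jumps up by one. -/
def matrixUp (S t S' t' : ℤ) (a b c : ℂ) (X Y : Fin M.N → ℤ) : ℂ :=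
  if ∀ k, Y k - X k = 0 ∨ Y k - X k = 1 then
    (M.normUp S t a b c)⁻¹ * M.phiRatio S t S' t' X Y *
      (∏ k with Y k = X k + 1, M.plusFactor S t a b c (X k)) *
      ∏ k with Y k = X k, M.minusFactor S t a b c (X k)
  else 0

open Classical in
/-- The matrix from configurations of `(S, t)` to configurations of `(S', t')` attached to the
parameters `a, b, c`, in which every particle stays or jumps down by one. -/
def matrixDown (S t S' t' : ℤ) (a b c : ℂ) (X Y : Fin M.N → ℤ) : ℂ :=
  if ∀ k, Y k - X k = 0 ∨ Y k - X k = -1 then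
    (M.normDown S t a b c)⁻¹ * M.phiRatio S t S' t' X Y *
      (∏ k with Y k = X k - 1, M.minusFactor S t a b c (X k)) *
      ∏ k with Y k = X k, M.plusFactor S t a b c (X k)
  else 0

/-- `P^{S,t}_{t+}`. -/
def Ptp (S t : ℤ) : (Fin M.N → ℤ) → (Fin M.N → ℤ) → ℂ :=
  M.matrixUp S t S (t + 1) (M.A S t) (M.B S t) (M.C S t)

/-- `P^{S,t}_{t-}`. -/
def Ptm (S t : ℤ) : (Fin M.N → ℤ) → (Fin M.N → ℤ) → ℂ :=
  M.matrixDown S t S (t - 1) (M.D S t) (M.E S t) (M.F S t)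

/-- `_{t+}P^{S,t}_{S+}`. -/
def PtpSp (S t : ℤ) : (Fin M.N → ℤ) → (Fin M.N → ℤ) → ℂ :=
  M.matrixUp S t (S + 1) t (M.A S t) (M.B S t) (M.D S t)

/-- `_{t+}P^{S,t}_{S-}`. -/
def PtpSm (S t : ℤ) : (Fin M.N → ℤ) → (Fin M.N → ℤ) → ℂ :=
  M.matrixDown S t (S - 1) t (M.B S t) (M.C S t) (M.F S t)

/-- `_{t-}P^{S,t}_{S+}`. -/
def PtmSp (S t : ℤ) : (Fin M.N → ℤ) → (Fin M.N → ℤ) → ℂ :=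
  M.matrixUp S t (S + 1) t (M.D S t) (M.E S t) (M.A S t)

/-- `_{t-}P^{S,t}_{S-}`. -/
def PtmSm (S t : ℤ) : (Fin M.N → ℤ) → (Fin M.N → ℤ) → ℂ :=
  M.matrixDown S t (S - 1) t (M.E S t) (M.F S t) (M.C S t)

/-! ### Well-definedness: no denominator vanishes -/

/-- The denominators `φ_{t,S}(x_k, x_l)` and `θ_p(z_k²)` of the matrices starting from `(S, t)`
do not vanish. -/
def LineRegular (S t : ℤ) : Prop :=
  ∀ X ∈ M.config S t, (∀ k l, k < l → M.phi S t (X k) (X l) ≠ 0) ∧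
    ∀ k, M.θ (M.z S t (X k) ^ 2) ≠ 0

/-- The normalizing constant attached to `a, b, c` is finite. -/
def NormRegular (a b c : ℂ) : Prop :=
  ∀ k < M.N, M.θ (M.q ^ k * (a * b)) ≠ 0 ∧ M.θ (M.q ^ k * (a * c)) ≠ 0 ∧
    M.θ (M.q ^ k * (b * c)) ≠ 0

/-- The measure `ρ_{S,t}` is well defined: the denominators of the Selberg density do not vanish
and its total mass is not zero. -/
def RhoRegular (S t : ℤ) : Prop :=
  (∀ X ∈ M.config S t, ∀ k, M.uniDen S t (X k) ≠ 0) ∧ M.selbergMass S t ≠ 0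

/-! ### Stochasticity and transport of measures -/

/-- The row sums of the matrix `P`, with rows indexed by `rows` and columns by `cols`, are one. -/
def RowSumsOne {ι : Type*} (rows cols : Finset ι) (P : ι → ι → ℂ) : Prop :=
  ∀ X ∈ rows, ∑ Y ∈ cols, P X Y = 1

/-- The matrix `P` carries the measure `μ` on `rows` to the measure `ν` on `cols`. -/
def Carries {ι : Type*} (rows cols : Finset ι) (P : ι → ι → ℂ) (μ ν : ι → ℂ) : Prop :=
  ∀ Y ∈ cols, ν Y = ∑ X ∈ rows, P X Y * μ X

end EllipticModel

end

/-! Row sums. Put h = √q. A step of a particle multiplies its z by h or by 1/h, φ_{t,S} is F times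
the antisymmetric kernel S(x, y) = θ(xy)θ(x/y)/x evaluated at the z's, and the numerators of f⁺ and
f⁻ are, up to the factor -F, the coefficients z⁻¹∏θ(t_r z) and -z³∏θ(t_r/z) with (t₀, t₁, t₂, t₃) =
(a, b, c, q^(1-N)/abc). Hence the sum over all 2^N choices of moves is a difference operator applied
to the elliptic Vandermonde product, and `sum_amplitude_vandermonde` says that this product is
reproduced up to an explicit factor. Choices of moves that do not lead to a configuration contribute
zero: a particle leaving the allowed interval meets a zero of a theta factor, and two colliding
particles meet a zero of the Vandermonde product.

The multivariable identity comes from a determinant. The one-variable operator sends a product of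
kernels with zeros along progressions starting at t₀h, t₁h to θ(z²) times a multiple of the product
starting at t₀, t₁ (`sum_amplitude_mul_kernelProd`). The determinants of both families are constants
times the Vandermonde product (`det_kernelProd`), so a multilinear expansion of the rows gives the
identity. Constants must be divided out, which is legitimate for generic t₀, t₂; the remaining cases
follow by continuity. All of this rests on the Weierstrass addition formula `kernel_plucker`: by the
triple product, θ(xy)θ(x/y) is a sum of two products of a function of x and a function of y, and an
antisymmetric kernel of rank two has vanishing 4×4 Pfaffians.

Transport of measures. This is detailed balance. Multiplying P(X, Y) by φ(X)² leaves φ'(Y)φ(X), the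
Vandermonde factor of a reversed step times φ'(Y)². The univariate factors match one particle at a
time (`weight_plus`, `weight_minus`): the matrix with three of the six parameters A, ..., F is
reversed by the matrix with the other three, divided by √q. This works because ABCDEF = q^(3-2N).
The sum over X is then the row sum identity of the reversed step, so the image of the source density
is proportional to the target density, and equality of total masses fixes the factor
(`intertwines_of_exists`).

Detailed balance holds only up to constants that may vanish at special parameters. The transport,
written without dividing by total masses, is therefore proved off a countable set of points on a
path of parameters and extended by continuity (`carries_of_generic`). -/

noncomputable section

namespace EllipticTheta

open Filter Topology

/-! ### The theta function as an infinite product -/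

/-- The `p`-Pochhammer symbol `(x; p)_∞ = ∏_{k ≥ 0} (1 - p^k x)`. -/
def infPoch (p x : ℂ) : ℂ := ∏' k : ℕ, (1 - p ^ k * x)

section Product

variable {p : ℂ}

lemma summable_norm_pow_mul (hp : ‖p‖ < 1) (x : ℂ) : Summable fun k : ℕ => ‖-(p ^ k * x)‖ := by
  simp only [norm_neg, norm_mul, norm_pow]
  exact (summable_geometric_of_lt_one (norm_nonneg _) hp).mul_right _

lemma multipliable_infPoch (hp : ‖p‖ < 1) (x : ℂ) :
    Multipliable fun k : ℕ => (1 - p ^ k * x) := by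
  simpa only [sub_eq_add_neg] using multipliable_one_add_of_summable (summable_norm_pow_mul hp x)

lemma infPoch_eq_mul (hp : ‖p‖ < 1) (x : ℂ) : infPoch p x = (1 - x) * infPoch p (p * x) := by
  have h := (multipliable_infPoch hp (p * x)).congr
    (g := fun k : ℕ => (1 - p ^ (k + 1) * x)) (fun k => by ring)
  unfold infPoch
  rw [tprod_eq_zero_mul' (f := fun k : ℕ => (1 - p ^ k * x)) h]
  simp only [pow_zero, one_mul, pow_succ, mul_assoc]

lemma exists_of_infPoch_eq_zero (hp : ‖p‖ < 1) {x : ℂ} (h : infPoch p x = 0) :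
    ∃ k : ℕ, p ^ k * x = 1 := by
  by_contra! hne
  refine tprod_one_add_ne_zero_of_summable (f := fun k : ℕ => -(p ^ k * x)) (fun k hk => ?_)
    (summable_norm_pow_mul hp x) (by simpa only [infPoch, sub_eq_add_neg] using h)
  exact hne k (by linear_combination -hk)

/-- On a ball the product converges locally uniformly, with the geometric majorant |p|^k(|x| + 1).
Continuity is all that the later limiting arguments need; analyticity plays no role. -/
lemma continuous_infPoch (hp : ‖p‖ < 1) : Continuous (infPoch p) := by
  rw [continuous_iff_continuousAt]
  intro x
  have key : HasProdLocallyUniformlyOn (fun (k : ℕ) (y : ℂ) => 1 + -(p ^ k * y))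
      (fun y => ∏' k : ℕ, (1 + -(p ^ k * y))) (Metric.ball 0 (‖x‖ + 1)) := by
    refine Summable.hasProdLocallyUniformlyOn_one_add Metric.isOpen_ball
      (u := fun k => ‖p‖ ^ k * (‖x‖ + 1))
      ((summable_geometric_of_lt_one (norm_nonneg _) hp).mul_right _)
      (Eventually.of_forall fun k y hy => ?_) (fun k => by fun_prop)
    rw [norm_neg, norm_mul, norm_pow]
    have : ‖y‖ ≤ ‖x‖ + 1 := by simpa using (Metric.mem_ball.1 hy).le
    gcongr
  have hc : ContinuousOn (fun y => ∏' k : ℕ, (1 + -(p ^ k * y))) (Metric.ball 0 (‖x‖ + 1)) :=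
    (hasProdLocallyUniformlyOn_iff_tendstoLocallyUniformlyOn.1 key).continuousOn
      (Frequently.of_forall fun s => by fun_prop)
  have := hc.continuousAt (Metric.isOpen_ball.mem_nhds (x := x) (by simp))
  simp only [← sub_eq_add_neg] at this
  exact this

lemma theta_eq_infPoch (hp : ‖p‖ < 1) (x : ℂ) :
    theta p x = infPoch p x * infPoch p (p / x) := by
  unfold theta infPoch
  rw [← (multipliable_infPoch hp x).tprod_mul (multipliable_infPoch hp (p / x))]
  refine tprod_congr fun k => ?_
  rw [pow_succ, mul_div_assoc]

lemma theta_inv (hp : ‖p‖ < 1) {x : ℂ} (hx : x ≠ 0) : theta p x⁻¹ = -theta p x / x := by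
  rw [theta_eq_infPoch hp, theta_eq_infPoch hp, infPoch_eq_mul hp x, infPoch_eq_mul hp x⁻¹,
    div_inv_eq_mul, ← div_eq_mul_inv]
  field_simp
  ring

lemma theta_one (hp : ‖p‖ < 1) : theta p 1 = 0 := by
  rw [theta_eq_infPoch hp, infPoch_eq_mul hp]
  simp

lemma continuousAt_theta (hp : ‖p‖ < 1) {x : ℂ} (hx : x ≠ 0) : ContinuousAt (theta p) x := by
  have : theta p = fun x => infPoch p x * infPoch p (p / x) := funext (theta_eq_infPoch hp)
  rw [this]
  have h := continuous_infPoch hp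
  exact h.continuousAt.mul
    (h.continuousAt.comp (f := fun x => p / x) (continuousAt_const.div continuousAt_id hx))

/-- Countability is the only notion of genericity used below: finitely or countably many theta
functions can be kept nonzero simultaneously by avoiding a countable set. -/
lemma countable_theta_zeros (hp : ‖p‖ < 1) : {x : ℂ | x ≠ 0 ∧ theta p x = 0}.Countable := by
  refine ((Set.countable_range fun k : ℕ => (p ^ k)⁻¹).union
    (Set.countable_range fun k : ℕ => p ^ (k + 1))).mono ?_
  rintro x ⟨hx, h⟩
  rw [theta_eq_infPoch hp, mul_eq_zero] at h
  rcases h with h | h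
  · obtain ⟨k, hk⟩ := exists_of_infPoch_eq_zero hp h
    exact Or.inl ⟨k, (eq_inv_of_mul_eq_one_right hk).symm⟩
  · obtain ⟨k, hk⟩ := exists_of_infPoch_eq_zero hp h
    refine Or.inr ⟨k, ?_⟩
    field_simp at hk
    simp only [pow_succ, hk]

end Product

/-! ### The Jacobi triple product, up to a constant factor -/

section TripleProduct

/-- The coefficients `(-1)^j P^(j² - j)` of the Jacobi theta series with nome `p = P²`. -/
def jacobiCoeff (P : ℂ) (j : ℤ) : ℂ := (-1) ^ j * P ^ (j * j - j)

lemma jacobiCoeff_succ {P : ℂ} (hP : P ≠ 0) (j : ℤ) :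
    jacobiCoeff P (j + 1) = -((P ^ 2) ^ j * jacobiCoeff P j) := by
  unfold jacobiCoeff
  rw [zpow_add₀ (by norm_num), ← zpow_natCast, ← zpow_mul,
    show (j + 1) * (j + 1) - (j + 1) = (2 : ℕ) * j + (j * j - j) by push_cast; ring, zpow_add₀ hP]
  ring

/-- The ratio of consecutive terms is r^(2n+1+ε) c, which tends to 0. -/
lemma summable_gaussian_nat {r : ℝ} (hr0 : 0 < r) (hr : r < 1) {c : ℝ} (hc : 0 < c) (ε : ℤ) :
    Summable fun n : ℕ => r ^ ((n : ℤ) * n + ε * n) * c ^ n := by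
  refine summable_of_ratio_test_tendsto_lt_one (l := 0) one_pos
    (Eventually.of_forall fun n => by positivity) ?_
  have h : Tendsto (fun n : ℕ => r ^ n * (r ^ n * (r ^ (1 + ε) * c))) atTop (𝓝 0) := by
    have h0 := tendsto_pow_atTop_nhds_zero_of_lt_one hr0.le hr
    simpa using h0.mul (h0.mul_const (r ^ (1 + ε) * c))
  refine h.congr fun n => ?_
  rw [Real.norm_of_nonneg (by positivity), Real.norm_of_nonneg (by positivity),
    eq_div_iff (by positivity)]
  push_cast
  rw [show ((n : ℤ) + 1) * (n + 1) + ε * (n + 1) = n + n + (1 + ε) + (n * n + ε * n) by ring,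
    zpow_add₀ hr0.ne' _ ((n : ℤ) * n + ε * n), zpow_add₀ hr0.ne' _ (1 + ε), zpow_add₀ hr0.ne' (n : ℤ) n,
    zpow_natCast]
  ring

lemma summable_gaussian {r : ℝ} (hr0 : 0 < r) (hr : r < 1) {c : ℝ} (hc : 0 < c) (ε : ℤ) :
    Summable fun j : ℤ => r ^ (j * j + ε * j) * c ^ j := by
  refine Summable.of_nat_of_neg ?_ ?_
  · simpa using summable_gaussian_nat hr0 hr hc ε
  · refine (summable_gaussian_nat hr0 hr (inv_pos.2 hc) (-ε)).congr fun n => ?_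
    simp

/-- The Jacobi theta series `∑ (-1)^j P^(j² - j) x^j` with nome `P²`. -/
def jacobiSeries (P x : ℂ) : ℂ := ∑' j : ℤ, jacobiCoeff P j * x ^ j

lemma norm_jacobiCoeff_mul (P x : ℂ) (j : ℤ) :
    ‖jacobiCoeff P j * x ^ j‖ = ‖P‖ ^ (j * j + (-1) * j) * ‖x‖ ^ j := by
  rw [jacobiCoeff, norm_mul, norm_mul, norm_zpow, norm_zpow, norm_zpow, norm_neg, norm_one, one_zpow,
    one_mul, neg_one_mul, ← sub_eq_add_neg]

lemma summable_norm_jacobi {P x : ℂ} (hP : P ≠ 0) (hP1 : ‖P‖ < 1) (hx : x ≠ 0) :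
    Summable fun j : ℤ => ‖jacobiCoeff P j * x ^ j‖ := by
  simp only [norm_jacobiCoeff_mul]
  exact summable_gaussian (norm_pos_iff.2 hP) hP1 (norm_pos_iff.2 hx) (-1)

/-- `(p; p)_n = ∏_{i < n} (1 - p^(i+1))`. -/
def selfPoch (p : ℂ) (n : ℕ) : ℂ := ∏ i ∈ Finset.range n, (1 - p ^ (i + 1))

/-- `1 / (p; p)_m`, extended by zero to negative `m`. -/
def invSelfPoch (p : ℂ) (m : ℤ) : ℂ := if 0 ≤ m then (selfPoch p m.toNat)⁻¹ else 0

lemma one_sub_pow_succ_ne_zero {p : ℂ} (hp : ‖p‖ < 1) (i : ℕ) : 1 - p ^ (i + 1) ≠ 0 := by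
  intro h
  have h1 : ‖p ^ (i + 1)‖ = 1 := by rw [← sub_eq_zero.1 h, norm_one]
  rw [norm_pow] at h1
  exact (pow_lt_one₀ (norm_nonneg _) hp (Nat.succ_ne_zero i)).ne h1

/-- The extension by zero is compatible with the recursion because the factor 1 - p^0 vanishes at m
= -1. The finite triple product can thus be summed over all of ℤ without boundary terms. -/
lemma invSelfPoch_eq {p : ℂ} (hp : ‖p‖ < 1) (m : ℤ) :
    invSelfPoch p m = (1 - p ^ (m + 1)) * invSelfPoch p (m + 1) := by
  unfold invSelfPoch
  rcases lt_trichotomy (m + 1) 0 with h | h | h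
  · rw [if_neg (by omega), if_neg (by omega), mul_zero]
  · rw [if_neg (by omega), h]
    simp
  · obtain ⟨n, rfl⟩ := Int.eq_ofNat_of_zero_le (show 0 ≤ m by omega)
    rw [if_pos (by omega), if_pos (by omega), show ((n : ℤ) + 1).toNat = n + 1 by omega,
      Int.toNat_natCast, selfPoch, selfPoch, Finset.prod_range_succ, mul_inv]
    have := one_sub_pow_succ_ne_zero hp n
    rw [show (p ^ ((n : ℤ) + 1)) = p ^ (n + 1) by exact_mod_cast zpow_natCast p (n + 1)]
    field_simp

/-- The induction step for the coefficient of x^j, with u = p^n, w = p^j, R and R' the reciprocals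
of (p;p)_{n+1+j} and (p;p)_{n+1-j}, s = (p;p)_{2n}, G the theta coefficient at j - 1 and X = x^j.
The three terms on the right come from expanding the new factor (1 - ux)(1 - up/x). -/
lemma finite_jacobi_step {x u w R R' G s X : ℂ} {p : ℂ} (hx : x ≠ 0) (hw : w ≠ 0)
    (hp : p ≠ 0) :
    s * (1 - u ^ 2 * p) * (1 - u ^ 2 * p ^ 2) * R * R' * (-(w / p * G) * X) =
      (1 + u ^ 2 * p) * (s * ((1 - u * w * p) * R) * ((1 - u / w * p) * R') * (-(w / p * G) * X)) -
      u * x * (s * ((1 - u * w) * ((1 - u * w * p) * R)) * R' * (G * (X * x⁻¹))) -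
      u * p / x * (s * R * ((1 - u / w) * ((1 - u / w * p) * R')) *
        (-(w * -(w / p * G)) * (X * x))) := by
  field_simp
  ring

/-- The finite form of the Jacobi triple product. -/
lemma hasSum_finite_jacobi {P x : ℂ} (hP : P ≠ 0) (hP1 : ‖P ^ 2‖ < 1) (hx : x ≠ 0) (n : ℕ) :
    HasSum (fun j : ℤ => selfPoch (P ^ 2) (2 * n) * invSelfPoch (P ^ 2) (n + j) *
        invSelfPoch (P ^ 2) (n - j) * (jacobiCoeff P j * x ^ j))
      (∏ k ∈ Finset.range n, (1 - (P ^ 2) ^ k * x) * (1 - (P ^ 2) ^ (k + 1) / x)) := by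
  have hp0 : P ^ 2 ≠ 0 := pow_ne_zero _ hP
  induction n with
  | zero =>
    have h := hasSum_single (f := fun j : ℤ => selfPoch (P ^ 2) (2 * 0) *
        invSelfPoch (P ^ 2) ((0 : ℕ) + j) *
        invSelfPoch (P ^ 2) ((0 : ℕ) - j) * (jacobiCoeff P j * x ^ j)) 0 (fun j hj => by
      rcases lt_or_gt_of_ne hj with h | h
      · simp [invSelfPoch, h.not_ge]
      · simp [invSelfPoch, h.not_ge])
    simpa [selfPoch, invSelfPoch, jacobiCoeff] using h
  | succ n ih =>
    rw [Finset.prod_range_succ]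
    set c : ℤ → ℂ := fun j => selfPoch (P ^ 2) (2 * n) * invSelfPoch (P ^ 2) (n + j) *
        invSelfPoch (P ^ 2) (n - j) * (jacobiCoeff P j * x ^ j) with hc
    set Q := ∏ k ∈ Finset.range n, (1 - (P ^ 2) ^ k * x) * (1 - (P ^ 2) ^ (k + 1) / x)
    have h1 : HasSum (fun j => c (j - 1)) Q := 
      (Equiv.hasSum_iff (f := c) (Equiv.subRight (1 : ℤ))).2 ih
    have h2 : HasSum (fun j => c (j + 1)) Q := 
      (Equiv.hasSum_iff (f := c) (Equiv.addRight (1 : ℤ))).2 ih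
    have h3 := ((ih.mul_left (1 + ((P ^ 2) ^ n) ^ 2 * P ^ 2)).sub
      (h1.mul_left ((P ^ 2) ^ n * x))).sub (h2.mul_left ((P ^ 2) ^ n * P ^ 2 / x))
    have hval : Q * ((1 - (P ^ 2) ^ n * x) * (1 - (P ^ 2) ^ (n + 1) / x)) =
        (1 + ((P ^ 2) ^ n) ^ 2 * P ^ 2) * Q - (P ^ 2) ^ n * x * Q -
          (P ^ 2) ^ n * P ^ 2 / x * Q := by
      rw [pow_succ (P ^ 2) n]
      generalize (P ^ 2) ^ n = u
      field_simp
      ring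
    rw [hval]
    refine h3.congr_fun fun j => ?_
    simp only [hc]
    have e1 : selfPoch (P ^ 2) (2 * (n + 1)) = selfPoch (P ^ 2) (2 * n) *
        (1 - ((P ^ 2) ^ n) ^ 2 * P ^ 2) * (1 - ((P ^ 2) ^ n) ^ 2 * (P ^ 2) ^ 2) := by
      rw [selfPoch, selfPoch, show 2 * (n + 1) = 2 * n + 1 + 1 by ring, Finset.prod_range_succ,
        Finset.prod_range_succ, show (P ^ 2) ^ (2 * n + 1) = ((P ^ 2) ^ n) ^ 2 * P ^ 2 by ring,
        show (P ^ 2) ^ (2 * n + 1 + 1) = ((P ^ 2) ^ n) ^ 2 * (P ^ 2) ^ 2 by ring]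
    have a1 := invSelfPoch_eq hP1 (n + j)
    have a2 := invSelfPoch_eq hP1 (n + j - 1)
    have b1 := invSelfPoch_eq hP1 (n - j)
    have b2 := invSelfPoch_eq hP1 (n - j - 1)
    have g1 := jacobiCoeff_succ hP j
    have g2 := jacobiCoeff_succ hP (j - 1)
    rw [sub_add_cancel] at a2 b2 g2
    push_cast
    rw [show (n : ℤ) + (j - 1) = n + j - 1 by ring, show (n : ℤ) - (j - 1) = n - j + 1 by ring,
      show (n : ℤ) + (j + 1) = n + j + 1 by ring, show (n : ℤ) - (j + 1) = n - j - 1 by ring,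
      show (n : ℤ) + 1 + j = n + j + 1 by ring, show (n : ℤ) + 1 - j = n - j + 1 by ring,
      e1, a2, b2, a1, b1, g1, g2, zpow_sub_one₀ hx, zpow_add_one₀ hx, zpow_add_one₀ hp0,
      zpow_add_one₀ hp0, zpow_add₀ hp0, zpow_sub₀ hp0 n j, zpow_sub₀ hp0 j 1, zpow_one,
      zpow_natCast]
    exact finite_jacobi_step hx (zpow_ne_zero _ hp0) hp0

lemma tendsto_selfPoch {p : ℂ} (hp : ‖p‖ < 1) :
    Tendsto (selfPoch p) atTop (𝓝 (infPoch p p)) := by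
  have h := (multipliable_infPoch hp p).hasProd.tendsto_prod_nat
  simp only [← pow_succ] at h
  exact h

lemma infPoch_self_ne_zero {p : ℂ} (hp : ‖p‖ < 1) : infPoch p p ≠ 0 := by
  intro h
  obtain ⟨k, hk⟩ := exists_of_infPoch_eq_zero hp h
  exact one_sub_pow_succ_ne_zero hp k (by rw [pow_succ, hk, sub_self])

lemma tendsto_invSelfPoch {p : ℂ} (hp : ‖p‖ < 1) :
    Tendsto (invSelfPoch p) atTop (𝓝 (infPoch p p)⁻¹) := by
  have h := ((tendsto_selfPoch hp).inv₀ (infPoch_self_ne_zero hp)).comp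
    (tendsto_atTop_mono Int.self_le_toNat tendsto_id |> tendsto_natCast_atTop_iff.1)
  refine h.congr' ?_
  filter_upwards [eventually_ge_atTop 0] with m hm
  simp [invSelfPoch, hm]

lemma exists_bound_selfPoch {p : ℂ} (hp : ‖p‖ < 1) :
    ∃ K : ℝ, 0 ≤ K ∧ (∀ n, ‖selfPoch p n‖ ≤ K) ∧ ∀ m, ‖invSelfPoch p m‖ ≤ K := by
  obtain ⟨K₁, hK₁⟩ := (tendsto_selfPoch hp).norm.bddAbove_range
  obtain ⟨K₂, hK₂⟩ :=
    ((tendsto_selfPoch hp).inv₀ (infPoch_self_ne_zero hp)).norm.bddAbove_range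
  have h₁ : ∀ n, ‖selfPoch p n‖ ≤ K₁ := fun n => hK₁ ⟨n, rfl⟩
  have h₂ : ∀ n, ‖(selfPoch p n)⁻¹‖ ≤ K₂ := fun n => hK₂ ⟨n, rfl⟩
  refine ⟨max K₁ K₂, le_max_of_le_left ((norm_nonneg _).trans (h₁ 0)),
    fun n => le_max_of_le_left (h₁ n), fun m => ?_⟩
  unfold invSelfPoch
  split_ifs
  · exact le_max_of_le_right (h₂ _)
  · rw [norm_zero]
    exact le_max_of_le_left ((norm_nonneg _).trans (h₁ 0))

/-- The Jacobi triple product: `θ` is proportional to the Jacobi theta series. -/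
lemma exists_theta_eq_jacobiSeries {P : ℂ} (hP : P ≠ 0) (hP1 : ‖P‖ < 1) :
    ∃ C : ℂ, ∀ x ≠ 0, theta (P ^ 2) x = C * jacobiSeries P x := by
  have hp : ‖P ^ 2‖ < 1 := by
    rw [norm_pow]
    exact pow_lt_one₀ (norm_nonneg _) hP1 two_ne_zero
  set L := infPoch (P ^ 2) (P ^ 2)
  obtain ⟨K, hK0, hK1, hK2⟩ := exists_bound_selfPoch hp
  -- The limit of (p;p)_{2n} / ((p;p)_{n+j} (p;p)_{n-j}) for fixed j; dominated convergence lets n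
  -- tend to infinity in the finite form.
  refine ⟨L * L⁻¹ * L⁻¹, fun x hx => ?_⟩
  have hθ : Tendsto (fun n => ∏ k ∈ Finset.range n, (1 - (P ^ 2) ^ k * x) *
      (1 - (P ^ 2) ^ (k + 1) / x)) atTop (𝓝 (theta (P ^ 2) x)) := by
    refine (((multipliable_infPoch hp x).mul (multipliable_infPoch hp (P ^ 2 / x))).congr
      fun k => ?_).hasProd.tendsto_prod_nat
    rw [pow_succ (P ^ 2) k, mul_div_assoc]
  refine tendsto_nhds_unique hθ ?_
  simp_rw [← (hasSum_finite_jacobi hP hp hx _).tsum_eq]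
  rw [jacobiSeries, ← tsum_mul_left]
  refine tendsto_tsum_of_dominated_convergence
    (bound := fun j => K * K * K * ‖jacobiCoeff P j * x ^ j‖)
    ((summable_norm_jacobi hP hP1 hx).mul_left _) (fun j => ?_) (Eventually.of_forall fun n j => ?_)
  · have hcast : Tendsto (fun n : ℕ => (n : ℤ)) atTop atTop := tendsto_natCast_atTop_atTop
    refine Tendsto.mul_const _ (Tendsto.mul (Tendsto.mul ?_ ?_) ?_)
    · exact (tendsto_selfPoch hp).comp (tendsto_id.const_mul_atTop' two_pos)
    · exact (tendsto_invSelfPoch hp).comp (tendsto_atTop_add_const_right _ _ hcast)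
    · exact (tendsto_invSelfPoch hp).comp (tendsto_atTop_add_const_right _ _ hcast)
  · rw [norm_mul, norm_mul, norm_mul]
    gcongr
    · exact hK1 _
    · exact hK2 _
    · exact hK2 _

/-- Every integer point is of the form `(a + b, a - b)` or `(a + b + 1, a - b)`. -/
def parityEquiv : (ℤ × ℤ) ⊕ (ℤ × ℤ) ≃ ℤ × ℤ where
  toFun := Sum.elim (fun a => (a.1 + a.2, a.1 - a.2)) (fun a => (a.1 + a.2 + 1, a.1 - a.2))
  invFun m := if (m.1 + m.2) % 2 = 0 then Sum.inl ((m.1 + m.2) / 2, (m.1 - m.2) / 2)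
    else Sum.inr ((m.1 + m.2 - 1) / 2, (m.1 - m.2 - 1) / 2)
  left_inv := by
    rintro (⟨a, b⟩ | ⟨a, b⟩)
    · exact (if_pos (show (a + b + (a - b)) % 2 = 0 by omega)).trans
        (congrArg Sum.inl (Prod.ext (show (a + b + (a - b)) / 2 = a by omega)
          (show (a + b - (a - b)) / 2 = b by omega)))
    · exact (if_neg (show ¬(a + b + 1 + (a - b)) % 2 = 0 by omega)).trans
        (congrArg Sum.inr (Prod.ext (show (a + b + 1 + (a - b) - 1) / 2 = a by omega)
          (show (a + b + 1 - (a - b) - 1) / 2 = b by omega)))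
  right_inv := by
    rintro ⟨m, n⟩
    simp only
    split_ifs with h
    · simp only [Sum.elim_inl]
      congr 1 <;> omega
    · simp only [Sum.elim_inr]
      congr 1 <;> omega

lemma summable_norm_gaussian_term {P x : ℂ} (hP : P ≠ 0) (hP1 : ‖P‖ < 1) (hx : x ≠ 0) (ε δ : ℤ) :
    Summable fun j : ℤ => ‖P ^ (2 * (j * j + ε * j)) * x ^ (2 * j + δ)‖ := by
  have hr : ‖P‖ ^ 2 < 1 := pow_lt_one₀ (norm_nonneg _) hP1 two_ne_zero
  have hx' := norm_pos_iff.2 hx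
  have h := (summable_gaussian (pow_pos (norm_pos_iff.2 hP) 2) hr (pow_pos hx' 2) ε).mul_right
    (‖x‖ ^ δ)
  refine h.congr fun j => ?_
  rw [norm_mul, norm_zpow, norm_zpow, zpow_add₀ hx'.ne', zpow_mul, zpow_mul, mul_assoc]
  norm_cast

/-- The Jacobi theta kernel `ϑ(xy) ϑ(x/y)` has rank two. -/
lemma jacobiSeries_mul_eq {P x y : ℂ} (hP : P ≠ 0) (hP1 : ‖P‖ < 1) (hx : x ≠ 0) (hy : y ≠ 0) :
    jacobiSeries P (x * y) * jacobiSeries P (x / y) =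
      (∑' a : ℤ, P ^ (2 * (a * a + (-1) * a)) * x ^ (2 * a + 0)) *
          (∑' b : ℤ, P ^ (2 * (b * b + 0 * b)) * y ^ (2 * b + 0)) -
        (∑' a : ℤ, P ^ (2 * (a * a + 0 * a)) * x ^ (2 * a + 1)) *
          (∑' b : ℤ, P ^ (2 * (b * b + 1 * b)) * y ^ (2 * b + 1)) := by
  have s1 := summable_norm_jacobi hP hP1 (mul_ne_zero hx hy)
  have s2 := summable_norm_jacobi hP hP1 (div_ne_zero hx hy)
  rw [jacobiSeries, jacobiSeries, tsum_mul_tsum_of_summable_norm s1 s2,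
    tsum_mul_tsum_of_summable_norm (summable_norm_gaussian_term hP hP1 hx _ _)
      (summable_norm_gaussian_term hP hP1 hy _ _),
    tsum_mul_tsum_of_summable_norm (summable_norm_gaussian_term hP hP1 hx _ _)
      (summable_norm_gaussian_term hP hP1 hy _ _)]
  have h1 := (summable_mul_of_summable_norm (summable_norm_gaussian_term hP hP1 hx (-1) 0)
      (summable_norm_gaussian_term hP hP1 hy 0 0)).hasSum
  have h2 := (summable_mul_of_summable_norm (summable_norm_gaussian_term hP hP1 hx 0 1)
      (summable_norm_gaussian_term hP hP1 hy 1 1)).hasSum.neg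
  have hP2 : ∀ m : ℤ, (-1 : ℂ) ^ (2 * m) = 1 := fun m => by
    rw [zpow_mul]
    norm_num
  rw [sub_eq_add_neg]
  -- The double series is split by the parity of m + n. For (m, n) = (a+b, a-b) the exponent m² - m
  -- + n² - n equals 2(a² - a) + 2b², and for (a+b+1, a-b) it equals 2a² + 2(b² + b). The variables
  -- a and b separate, x collects the powers with a and y those with b, and the odd class has sign
  -- -1.
  refine ((parityEquiv.hasSum_iff (f := fun z : ℤ × ℤ => jacobiCoeff P z.1 * (x * y) ^ z.1 *
    (jacobiCoeff P z.2 * (x / y) ^ z.2))).1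
    (HasSum.sum (h1.congr_fun fun z => ?_) (h2.congr_fun fun z => ?_))).tsum_eq
  · obtain ⟨a, b⟩ := z
    simp only [Function.comp_apply, parityEquiv, Equiv.coe_fn_mk, Sum.elim_inl, jacobiCoeff]
    rw [show P ^ (2 * (a * a + -1 * a)) * x ^ (2 * a + 0) * (P ^ (2 * (b * b + 0 * b)) *
      y ^ (2 * b + 0)) = (-1) ^ (2 * a) * (P ^ (2 * (a * a + -1 * a)) * P ^ (2 * (b * b + 0 * b)))
      * x ^ (2 * a) * y ^ (2 * b) by rw [hP2, add_zero, add_zero]; ring, ← zpow_add₀ hP,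
      mul_zpow, div_zpow,
      show (-1) ^ (a + b) * P ^ ((a + b) * (a + b) - (a + b)) * (x ^ (a + b) * y ^ (a + b)) *
        ((-1) ^ (a - b) * P ^ ((a - b) * (a - b) - (a - b)) * (x ^ (a - b) / y ^ (a - b))) =
        (-1) ^ (a + b) * (-1) ^ (a - b) * (P ^ ((a + b) * (a + b) - (a + b)) *
        P ^ ((a - b) * (a - b) - (a - b))) * (x ^ (a + b) * x ^ (a - b)) *
        (y ^ (a + b) / y ^ (a - b)) by ring,
      ← zpow_add₀ hP, ← zpow_add₀ hx, ← zpow_sub₀ hy, ← zpow_add₀ (by norm_num : (-1 : ℂ) ≠ 0)]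
    ring_nf
  · obtain ⟨a, b⟩ := z
    simp only [Function.comp_apply, parityEquiv, Equiv.coe_fn_mk, Sum.elim_inr, jacobiCoeff]
    rw [show -(P ^ (2 * (a * a + 0 * a)) * x ^ (2 * a + 1) * (P ^ (2 * (b * b + 1 * b)) *
      y ^ (2 * b + 1))) = (-1) ^ (2 * a + 1) * (P ^ (2 * (a * a + 0 * a)) *
      P ^ (2 * (b * b + 1 * b))) * x ^ (2 * a + 1) * y ^ (2 * b + 1) by
        rw [zpow_add₀ (by norm_num : (-1 : ℂ) ≠ 0), hP2]; ring, ← zpow_add₀ hP,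
      mul_zpow, div_zpow,
      show (-1) ^ (a + b + 1) * P ^ ((a + b + 1) * (a + b + 1) - (a + b + 1)) *
        (x ^ (a + b + 1) * y ^ (a + b + 1)) *
        ((-1) ^ (a - b) * P ^ ((a - b) * (a - b) - (a - b)) * (x ^ (a - b) / y ^ (a - b))) =
        (-1) ^ (a + b + 1) * (-1) ^ (a - b) * (P ^ ((a + b + 1) * (a + b + 1) - (a + b + 1)) *
        P ^ ((a - b) * (a - b) - (a - b))) * (x ^ (a + b + 1) * x ^ (a - b)) *
        (y ^ (a + b + 1) / y ^ (a - b)) by ring,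
      ← zpow_add₀ hP, ← zpow_add₀ hx, ← zpow_sub₀ hy, ← zpow_add₀ (by norm_num : (-1 : ℂ) ≠ 0)]
    ring_nf

end TripleProduct

/-! ### The Weierstrass addition formula -/

/-- The antisymmetric theta kernel `S(x, y) = x⁻¹ θ(xy) θ(x/y)`. -/
def kernel (p x y : ℂ) : ℂ := x⁻¹ * (theta p (x * y) * theta p (x / y))

section Kernel

variable {p : ℂ}

lemma kernel_self (hp : ‖p‖ < 1) {x : ℂ} (hx : x ≠ 0) : kernel p x x = 0 := by
  rw [kernel, div_self hx, theta_one hp, mul_zero, mul_zero]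

lemma theta_div_comm (hp : ‖p‖ < 1) {x y : ℂ} (hx : x ≠ 0) (hy : y ≠ 0) :
    theta p (y / x) = -(y / x) * theta p (x / y) := by
  rw [← inv_div x y, theta_inv hp (div_ne_zero hx hy), inv_div]
  field_simp

lemma kernel_swap (hp : ‖p‖ < 1) {x y : ℂ} (hx : x ≠ 0) (hy : y ≠ 0) :
    kernel p y x = -kernel p x y := by
  rw [kernel, kernel, theta_div_comm hp hx hy, mul_comm y x]
  field_simp

/-- Both theta factors are inverted and exchanged. This symmetry brings the terms θ(t/z) of the
one-variable identity into the range of the addition formula. -/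
lemma kernel_inv_left (hp : ‖p‖ < 1) {x y : ℂ} (hx : x ≠ 0) (hy : y ≠ 0) :
    kernel p x⁻¹ y = kernel p x y := by
  rw [kernel, kernel, show x⁻¹ * y = y / x by ring, show x⁻¹ / y = (x * y)⁻¹ by field_simp,
    theta_div_comm hp hx hy, theta_inv hp (mul_ne_zero hx hy)]
  field_simp

/-- A 3×3 minor with rows a, b, c and columns a, b, d vanishes by the rank condition, and
antisymmetry turns it into s(a, b) times the Pfaffian. If the Pfaffian were nonzero, the three
entries pairing x with y, u, v would all vanish, and with them the Pfaffian itself. The argument is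
pointwise and needs no generic nonvanishing. -/
lemma pfaffian_eq_zero_of_rank_two {K ι : Type*} [Field K] (s : ι → ι → K) (e o E O : ι → K)
    (hs : ∀ i j, s i j = e i * E j + o i * O j) (h0 : ∀ i, s i i = 0) (h1 : ∀ i j, s j i = -s i j)
    (x y u v : ι) : s x y * s u v - s x u * s y v + s x v * s y u = 0 := by
  have minor : ∀ a b c d, s a b * (s a b * s c d - s a c * s b d + s a d * s b c) = 0 := by
    intro a b c d
    have det : s a a * (s b b * s c d - s b d * s c b) - s a b * (s b a * s c d - s b d * s c a) +
        s a d * (s b a * s c b - s b b * s c a) = 0 := by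
      simp only [hs]
      ring
    rw [h0, h0, h1 a b, h1 b c, h1 a c] at det
    linear_combination det
  have m1 := minor x y u v
  have m2 := minor x u y v
  have m3 := minor x v y u
  rw [h1 y u] at m2
  rw [h1 y v, h1 u v] at m3
  by_contra hne
  have z1 : s x y = 0 := (mul_eq_zero.1 m1).resolve_right hne
  have z2 : s x u = 0 := (mul_eq_zero.1 m2).resolve_right fun h => hne (by linear_combination -h)
  have z3 : s x v = 0 := (mul_eq_zero.1 m3).resolve_right fun h => hne (by linear_combination h)
  exact hne (by rw [z1, z2, z3]; ring)

/-- The Weierstrass addition formula. -/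
lemma kernel_plucker (hp : ‖p‖ < 1) {x y u v : ℂ} (hx : x ≠ 0) (hy : y ≠ 0) (hu : u ≠ 0)
    (hv : v ≠ 0) : kernel p x y * kernel p u v - kernel p x u * kernel p y v +
      kernel p x v * kernel p y u = 0 := by
  suffices ∃ e o E O : ℂ → ℂ, ∀ a ≠ 0, ∀ b ≠ 0, kernel p a b = e a * E b + o a * O b by
    obtain ⟨e, o, E, O, h⟩ := this
    exact pfaffian_eq_zero_of_rank_two (ι := {a : ℂ // a ≠ 0}) (fun a b => kernel p a b)
      (fun a => e a) (fun a => o a) (fun a => E a) (fun a => O a)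
      (fun a b => h a a.2 b b.2) (fun a => kernel_self hp a.2)
      (fun a b => kernel_swap hp a.2 b.2) ⟨x, hx⟩ ⟨y, hy⟩ ⟨u, hu⟩ ⟨v, hv⟩
  -- The theta series requires a nonzero square root of the nome. For p = 0 the theta function is 1
  -- - x and the kernel splits by hand.
  rcases eq_or_ne p 0 with rfl | hp0
  · have h0 : ∀ a : ℂ, theta 0 a = 1 - a := fun a => by
      rw [theta, tprod_eq_mulSingle 0]
      · simp
      · intro k hk
        simp [hk]
    refine ⟨fun a => a⁻¹ + a, fun _ => 1, fun _ => 1, fun b => -(b + b⁻¹), fun a ha b hb => ?_⟩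
    rw [kernel, h0, h0]
    field_simp
    ring
  · obtain ⟨P, rfl⟩ : ∃ P, p = P ^ 2 := by
      obtain ⟨P, hP⟩ := IsAlgClosed.exists_pow_nat_eq p two_pos
      exact ⟨P, hP.symm⟩
    have hP : P ≠ 0 := fun h => hp0 (by rw [h]; norm_num)
    have hP1 : ‖P‖ < 1 := by
      rw [norm_pow] at hp
      exact lt_of_pow_lt_pow_left₀ 2 zero_le_one (by rwa [one_pow])
    obtain ⟨C, hC⟩ := exists_theta_eq_jacobiSeries hP hP1
    refine ⟨fun x => x⁻¹ * C ^ 2 * ∑' a : ℤ, P ^ (2 * (a * a + (-1) * a)) * x ^ (2 * a + 0),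
      fun x => -(x⁻¹ * C ^ 2 * ∑' a : ℤ, P ^ (2 * (a * a + 0 * a)) * x ^ (2 * a + 1)),
      fun y => ∑' b : ℤ, P ^ (2 * (b * b + 0 * b)) * y ^ (2 * b + 0),
      fun y => ∑' b : ℤ, P ^ (2 * (b * b + 1 * b)) * y ^ (2 * b + 1), fun a ha b hb => ?_⟩
    have h := jacobiSeries_mul_eq hP hP1 ha hb
    rw [kernel, hC _ (mul_ne_zero ha hb), hC _ (div_ne_zero ha hb)]
    linear_combination a⁻¹ * C ^ 2 * h

end Kernel

end EllipticTheta

end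

noncomputable section

namespace EllipticTheta

open Filter Topology

/-! ### A multivariable theta identity -/

section Identity

variable {p : ℂ}

/-- The one-variable case of the theta identity. -/
lemma four_theta_identity (hp : ‖p‖ < 1) {z t₀ t₁ t₂ t₃ : ℂ} (hz : z ≠ 0) (h₀ : t₀ ≠ 0)
    (h₁ : t₁ ≠ 0) (h₂ : t₂ ≠ 0) (hprod : t₀ * t₁ * t₂ * t₃ = 1) :
    z⁻¹ * (theta p (t₀ * z) * theta p (t₁ * z) * theta p (t₂ * z) * theta p (t₃ * z)) +
        -z ^ 3 * (theta p (t₀ / z) * theta p (t₁ / z) * theta p (t₂ / z) * theta p (t₃ / z)) =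
      -t₃ * (theta p (t₀ * t₁) * theta p (t₀ * t₂) * theta p (t₁ * t₂)) * theta p (z ^ 2) := by
  -- With s² = t₀t₁, and hence t₂t₃ = s⁻², each product of two theta functions in the claim is a
  -- single kernel between two of the four points sz, z/s, t₀/s, t₂s. The claim is the addition
  -- formula for these points.
  obtain ⟨s, hs⟩ := IsAlgClosed.exists_pow_nat_eq (t₀ * t₁) two_pos
  have hs0 : s ≠ 0 := fun h => mul_ne_zero h₀ h₁ (by rw [← hs, h]; norm_num)
  obtain rfl : t₁ = s ^ 2 / t₀ := by rw [hs]; field_simp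
  have ht₃ : t₃ = (s ^ 2 * t₂)⁻¹ := by
    field_simp at hprod ⊢
    linear_combination hprod
  subst ht₃
  have key := kernel_plucker hp (mul_ne_zero hs0 hz) (div_ne_zero hz hs0) (div_ne_zero h₀ hs0)
    (mul_ne_zero h₂ hs0)
  have e1 : kernel p (s * z) (t₀ / s) * (s * z) = theta p (t₀ * z) * theta p (s ^ 2 / t₀ * z) := by
    rw [kernel, show s * z * (t₀ / s) = t₀ * z by field_simp,
      show s * z / (t₀ / s) = s ^ 2 / t₀ * z by field_simp]
    field_simp
  have e2 : kernel p (z / s) (t₂ * s) * (z / s) =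
      theta p (t₂ * z) * theta p ((s ^ 2 * t₂)⁻¹ * z) := by
    rw [kernel, show z / s * (t₂ * s) = t₂ * z by field_simp,
      show z / s / (t₂ * s) = (s ^ 2 * t₂)⁻¹ * z by field_simp]
    field_simp
  have e3 : kernel p (z / s) (t₀ / s) * (s / z) = theta p (t₀ / z) * theta p (s ^ 2 / t₀ / z) := by
    rw [← kernel_inv_left hp (div_ne_zero hz hs0) (div_ne_zero h₀ hs0), inv_div, kernel,
      show s / z * (t₀ / s) = t₀ / z by field_simp,
      show s / z / (t₀ / s) = s ^ 2 / t₀ / z by field_simp]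
    field_simp
  have e4 : kernel p (s * z) (t₂ * s) * (s * z)⁻¹ =
      theta p (t₂ / z) * theta p ((s ^ 2 * t₂)⁻¹ / z) := by
    rw [← kernel_inv_left hp (mul_ne_zero hs0 hz) (mul_ne_zero h₂ hs0), kernel,
      show (s * z)⁻¹ * (t₂ * s) = t₂ / z by field_simp,
      show (s * z)⁻¹ / (t₂ * s) = (s ^ 2 * t₂)⁻¹ / z by field_simp]
    field_simp
  have e5 : kernel p (s * z) (z / s) * (s * z) = theta p (z ^ 2) * theta p (s ^ 2) := by
    rw [kernel, show s * z * (z / s) = z ^ 2 by field_simp,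
      show s * z / (z / s) = s ^ 2 by field_simp]
    field_simp
  have e6 : kernel p (t₀ / s) (t₂ * s) * (t₀ / s) =
      -(theta p (t₀ * t₂) * theta p (s ^ 2 / t₀ * t₂)) / (s ^ 2 / t₀ * t₂) := by
    rw [kernel, show t₀ / s * (t₂ * s) = t₀ * t₂ by field_simp,
      show t₀ / s / (t₂ * s) = (s ^ 2 / t₀ * t₂)⁻¹ by field_simp, theta_inv hp (by positivity)]
    field_simp
  rw [show theta p (t₀ * z) * theta p (s ^ 2 / t₀ * z) * theta p (t₂ * z) *
      theta p ((s ^ 2 * t₂)⁻¹ * z) = (kernel p (s * z) (t₀ / s) * (s * z)) *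
      (kernel p (z / s) (t₂ * s) * (z / s)) by rw [e1, e2]; ring,
    show theta p (t₀ / z) * theta p (s ^ 2 / t₀ / z) * theta p (t₂ / z) *
      theta p ((s ^ 2 * t₂)⁻¹ / z) = (kernel p (z / s) (t₀ / s) * (s / z)) *
      (kernel p (s * z) (t₂ * s) * (s * z)⁻¹) by rw [e3, e4]; ring,
    show t₀ * (s ^ 2 / t₀) = s ^ 2 by field_simp]
  have e7 : -(s ^ 2 * t₂)⁻¹ * (theta p (s ^ 2) * theta p (t₀ * t₂) * theta p (s ^ 2 / t₀ * t₂)) *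
      theta p (z ^ 2) = (kernel p (s * z) (z / s) * (s * z)) *
      (kernel p (t₀ / s) (t₂ * s) * (t₀ / s)) / t₀ := by
    rw [e5, e6]
    field_simp
  rw [e7]
  clear e1 e2 e3 e4 e5 e6 e7
  generalize kernel p (s * z) (t₀ / s) = k₁ at key ⊢
  generalize kernel p (z / s) (t₂ * s) = k₂ at key ⊢
  generalize kernel p (z / s) (t₀ / s) = k₃ at key ⊢
  generalize kernel p (s * z) (t₂ * s) = k₄ at key ⊢
  generalize kernel p (s * z) (z / s) = k₅ at key ⊢
  generalize kernel p (t₀ / s) (t₂ * s) = k₆ at key ⊢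
  field_simp
  linear_combination -key

variable {h : ℂ}

/-- Multiplying both z and c by h does not change θ(z/c), and it turns θ(zc) into θ(ch²z). The extra
factor θ(cz) restores the unshifted kernel, so the only lasting effect is c ↦ ch² in the outer
theta. Along a geometric progression of ratio h² this telescopes. -/
lemma theta_mul_kernel_up {z c : ℂ} (hh : h ≠ 0) (hz : z ≠ 0) :
    theta p (c * z) * kernel p (h * z) (c * h) =
      h⁻¹ * theta p (c * h ^ 2 * z) * kernel p z c := by
  rw [kernel, kernel, show h * z * (c * h) = c * h ^ 2 * z by ring,
    show h * z / (c * h) = z / c by field_simp, mul_comm z c]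
  field_simp

lemma theta_mul_kernel_down (hp : ‖p‖ < 1) {z c : ℂ} (hh : h ≠ 0) (hz : z ≠ 0) (hc : c ≠ 0) :
    theta p (c / z) * kernel p (h⁻¹ * z) (c * h) =
      h⁻¹ * theta p (c * h ^ 2 / z) * kernel p z c := by
  rw [kernel, kernel, show h⁻¹ * z * (c * h) = z * c by field_simp,
    show h⁻¹ * z / (c * h) = z / (c * h ^ 2) by field_simp, theta_div_comm hp hz hc,
    theta_div_comm hp (mul_ne_zero hc (pow_ne_zero 2 hh)) hz]
  field_simp

lemma theta_mul_prod_kernel_up {z b : ℂ} (hh : h ≠ 0) (hz : z ≠ 0) (j : ℕ) :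
    theta p (b * z) * ∏ i ∈ Finset.range j, kernel p (h * z) (b * h * (h ^ 2) ^ i) =
      (h⁻¹) ^ j * theta p (b * (h ^ 2) ^ j * z) *
        ∏ i ∈ Finset.range j, kernel p z (b * (h ^ 2) ^ i) := by
  induction j with
  | zero => simp
  | succ j ih =>
    rw [Finset.prod_range_succ, Finset.prod_range_succ, ← mul_assoc, ih,
      show b * h * (h ^ 2) ^ j = b * (h ^ 2) ^ j * h by ring]
    have := theta_mul_kernel_up (p := p) (c := b * (h ^ 2) ^ j) hh hz
    rw [show b * (h ^ 2) ^ (j + 1) = b * (h ^ 2) ^ j * h ^ 2 by ring, pow_succ h⁻¹ j]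
    linear_combination (h⁻¹ ^ j * ∏ i ∈ Finset.range j, kernel p z (b * (h ^ 2) ^ i)) * this

lemma theta_mul_prod_kernel_down (hp : ‖p‖ < 1) {z b : ℂ} (hh : h ≠ 0) (hz : z ≠ 0) (hb : b ≠ 0)
    (j : ℕ) :
    theta p (b / z) * ∏ i ∈ Finset.range j, kernel p (h⁻¹ * z) (b * h * (h ^ 2) ^ i) =
      (h⁻¹) ^ j * theta p (b * (h ^ 2) ^ j / z) *
        ∏ i ∈ Finset.range j, kernel p z (b * (h ^ 2) ^ i) := by
  induction j with
  | zero => simp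
  | succ j ih =>
    rw [Finset.prod_range_succ, Finset.prod_range_succ, ← mul_assoc, ih,
      show b * h * (h ^ 2) ^ j = b * (h ^ 2) ^ j * h by ring]
    have := theta_mul_kernel_down hp hh hz
      (mul_ne_zero hb (pow_ne_zero j (pow_ne_zero 2 hh)))
    rw [show b * (h ^ 2) ^ (j + 1) = b * (h ^ 2) ^ j * h ^ 2 by ring, pow_succ h⁻¹ j]
    linear_combination (h⁻¹ ^ j * ∏ i ∈ Finset.range j, kernel p z (b * (h ^ 2) ^ i)) * this

/-- The product of `n` theta kernels with zeros along two geometric progressions. -/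
def kernelProd (p q α β : ℂ) (n j : ℕ) (z : ℂ) : ℂ :=
  (∏ i ∈ Finset.range j, kernel p z (α * q ^ i)) *
    ∏ i ∈ Finset.range (n - j), kernel p z (β * q ^ i)

/-- The coefficients of the difference operator: `z⁻¹ ∏ θ(t_r z)` and `-z³ ∏ θ(t_r / z)`. -/
def amplitude (p t₀ t₁ t₂ t₃ : ℂ) (b : Bool) (z : ℂ) : ℂ :=
  if b then z⁻¹ * (theta p (t₀ * z) * theta p (t₁ * z) * theta p (t₂ * z) * theta p (t₃ * z))
  else -z ^ 3 * (theta p (t₀ / z) * theta p (t₁ / z) * theta p (t₂ / z) * theta p (t₃ / z))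

/-- The step of the difference operator: `h` or `h⁻¹`. -/
def halfStep (h : ℂ) (b : Bool) : ℂ := if b then h else h⁻¹

lemma halfStep_ne_zero (hh : h ≠ 0) (b : Bool) : halfStep h b ≠ 0 := by
  unfold halfStep
  split_ifs
  exacts [hh, inv_ne_zero hh]

/-- The difference operator acts on the theta products by multiplication and a shift of the
parameters. -/
lemma sum_amplitude_mul_kernelProd (hp : ‖p‖ < 1) {z t₀ t₁ t₂ t₃ : ℂ} (hh : h ≠ 0) (hz : z ≠ 0)
    (h₀ : t₀ ≠ 0) (h₁ : t₁ ≠ 0) (h₂ : t₂ ≠ 0) {n j : ℕ} (hj : j ≤ n)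
    (hprod : (h ^ 2) ^ n * (t₀ * t₁ * t₂ * t₃) = 1) :
    ∑ b, amplitude p t₀ t₁ t₂ t₃ b z *
        kernelProd p (h ^ 2) (t₀ * h) (t₁ * h) n j (halfStep h b * z) =
      theta p (z ^ 2) * (kernelProd p (h ^ 2) t₀ t₁ n j z * ((h⁻¹) ^ n * (-t₃ *
        (theta p (t₀ * t₁ * (h ^ 2) ^ n) * theta p (t₀ * t₂ * (h ^ 2) ^ j) *
          theta p (t₁ * t₂ * (h ^ 2) ^ (n - j)))))) := by
  have hq : h ^ 2 ≠ 0 := pow_ne_zero 2 hh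
  rw [Fintype.sum_bool]
  simp only [amplitude, halfStep, if_true, kernelProd, Bool.false_eq_true, if_false]
  have u0 := theta_mul_prod_kernel_up (p := p) (b := t₀) hh hz j
  have u1 := theta_mul_prod_kernel_up (p := p) (b := t₁) hh hz (n - j)
  have d0 := theta_mul_prod_kernel_down hp hh hz h₀ j
  have d1 := theta_mul_prod_kernel_down hp hh hz h₁ (n - j)
  have hsplit : (h ^ 2) ^ j * (h ^ 2) ^ (n - j) = (h ^ 2) ^ n := by
    rw [← pow_add, Nat.add_sub_cancel' hj]
  have hsplit' : (h⁻¹) ^ j * (h⁻¹) ^ (n - j) = (h⁻¹) ^ n := by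
    rw [← pow_add, Nat.add_sub_cancel' hj]
  -- Telescoping has moved t₀ to t₀q^j and t₁ to t₁q^(n-j) with q = h², so the balancing condition
  -- of the one-variable identity absorbs the power q^n.
  have key := four_theta_identity hp (t₀ := t₀ * (h ^ 2) ^ j) (t₁ := t₁ * (h ^ 2) ^ (n - j))
    (t₂ := t₂) (t₃ := t₃) hz (mul_ne_zero h₀ (pow_ne_zero _ hq))
    (mul_ne_zero h₁ (pow_ne_zero _ hq)) h₂ (by
      rw [← hsplit] at hprod
      linear_combination hprod)
  rw [show t₀ * (h ^ 2) ^ j * (t₁ * (h ^ 2) ^ (n - j)) = t₀ * t₁ * (h ^ 2) ^ n by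
      rw [← hsplit]; ring, show t₀ * (h ^ 2) ^ j * t₂ = t₀ * t₂ * (h ^ 2) ^ j by ring,
    show t₁ * (h ^ 2) ^ (n - j) * t₂ = t₁ * t₂ * (h ^ 2) ^ (n - j) by ring] at key
  rw [← hsplit']
  set A := ∏ i ∈ Finset.range j, kernel p (h * z) (t₀ * h * (h ^ 2) ^ i)
  set A' := ∏ i ∈ Finset.range j, kernel p (h⁻¹ * z) (t₀ * h * (h ^ 2) ^ i)
  set B := ∏ i ∈ Finset.range (n - j), kernel p (h * z) (t₁ * h * (h ^ 2) ^ i)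
  set B' := ∏ i ∈ Finset.range (n - j), kernel p (h⁻¹ * z) (t₁ * h * (h ^ 2) ^ i)
  set A₀ := ∏ i ∈ Finset.range j, kernel p z (t₀ * (h ^ 2) ^ i)
  set B₀ := ∏ i ∈ Finset.range (n - j), kernel p z (t₁ * (h ^ 2) ^ i)
  rw [show z⁻¹ * (theta p (t₀ * z) * theta p (t₁ * z) * theta p (t₂ * z) * theta p (t₃ * z)) *
      (A * B) = z⁻¹ * ((theta p (t₀ * z) * A) * (theta p (t₁ * z) * B) * theta p (t₂ * z) *
        theta p (t₃ * z)) by ring, u0, u1,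
    show -z ^ 3 * (theta p (t₀ / z) * theta p (t₁ / z) * theta p (t₂ / z) * theta p (t₃ / z)) *
      (A' * B') = -z ^ 3 * ((theta p (t₀ / z) * A') * (theta p (t₁ / z) * B') *
        theta p (t₂ / z) * theta p (t₃ / z)) by ring, d0, d1]
  linear_combination (A₀ * B₀ * h⁻¹ ^ j * h⁻¹ ^ (n - j)) * key

/-! ### Determinants of theta products -/

/-- Nonvanishing of S(1, β) is what lets S(·, 1) and S(·, β) serve as homogeneous coordinates; ℂ is
uncountable, so β can avoid the zeros of θ. -/
lemma exists_kernel_one_ne_zero (hp : ‖p‖ < 1) : ∃ β : ℂ, β ≠ 0 ∧ kernel p 1 β ≠ 0 := by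
  obtain ⟨β, hβ⟩ : ∃ β : ℂ, β ∉ insert (0 : ℂ) {x : ℂ | x ≠ 0 ∧ theta p x = 0} := by
    by_contra! hall
    exact not_countable_complex (((countable_theta_zeros hp).insert 0).mono fun x _ => hall x)
  simp only [Set.mem_insert_iff, Set.mem_ofPred_eq, not_or, not_and] at hβ
  obtain ⟨hβ0, hβ1⟩ := hβ
  refine ⟨β, hβ0, ?_⟩
  rw [kernel, one_mul, one_div, theta_inv hp hβ0]
  simp [hβ0, hβ1 hβ0]

/-- Products of `n` theta kernels are homogeneous polynomials of degree `n` in two of them. -/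
lemma exists_coeff_of_prod_kernel (hp : ‖p‖ < 1) {β : ℂ} (hβ : β ≠ 0) (hk : kernel p 1 β ≠ 0)
    (w : ℕ → ℂ) (hw : ∀ i, w i ≠ 0) (n : ℕ) :
    ∃ c : ℕ → ℂ, ∀ z ≠ 0, ∏ i ∈ Finset.range n, kernel p z (w i) =
      ∑ m ∈ Finset.range (n + 1), c m * (kernel p z 1 ^ m * kernel p z β ^ (n - m)) := by
  induction n with
  | zero => exact ⟨fun _ => 1, fun z _ => by simp⟩
  | succ n ih =>
    obtain ⟨c, hc⟩ := ih
    set a := kernel p (w n) β / kernel p 1 β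
    set b := -(kernel p (w n) 1 / kernel p 1 β)
    -- The addition formula for z, w, 1, β puts every kernel S(·, w) in the span of S(·, 1) and S(·,
    -- β).
    have hlin : ∀ z ≠ 0, kernel p z (w n) = a * kernel p z 1 + b * kernel p z β := by
      intro z hz
      have := kernel_plucker hp hz (hw n) one_ne_zero hβ
      simp only [a, b]
      field_simp
      linear_combination this
    -- Coefficients of a homogeneous polynomial times a linear form. The two tests suppress the
    -- value of c at the truncated index 0 - 1 and at n + 1, which is outside the range of the sum
    -- for c.
    refine ⟨fun m => (if m = 0 then 0 else a * c (m - 1)) + (if m = n + 1 then 0 else b * c m),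
      fun z hz => ?_⟩
    rw [Finset.prod_range_succ, hc z hz, hlin z hz]
    simp only [add_mul, Finset.sum_add_distrib]
    rw [Finset.sum_range_succ' (fun m => (if m = 0 then 0 else a * c (m - 1)) * _),
      Finset.sum_range_succ (fun m => (if m = n + 1 then 0 else b * c m) * _)]
    simp only [if_true, zero_mul, add_zero, Nat.add_sub_cancel, Nat.add_eq_zero_iff, one_ne_zero,
      and_false, if_false, mul_add, Finset.sum_mul]
    congr 1
    · refine Finset.sum_congr rfl fun m _ => ?_
      rw [Nat.add_sub_add_right]
      ring
    · refine Finset.sum_congr rfl fun m hm => ?_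
      have hm' := Finset.mem_range.1 hm
      rw [if_neg (by omega), show n + 1 - m = n - m + 1 by omega]
      ring

lemma kernelProd_eq_prod_range (q α β : ℂ) {n j : ℕ} (hj : j ≤ n) (z : ℂ) :
    kernelProd p q α β n j z =
      ∏ i ∈ Finset.range n, kernel p z (if i < j then α * q ^ i else β * q ^ (i - j)) := by
  rw [kernelProd]
  conv_rhs => rw [← Nat.add_sub_cancel' hj, Finset.prod_range_add]
  congr 1
  · refine Finset.prod_congr rfl fun i hi => ?_
    rw [if_pos (Finset.mem_range.1 hi)]
  · refine Finset.prod_congr rfl fun i _ => ?_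
    rw [if_neg (by omega), Nat.add_sub_cancel_left]

/-- The elliptic Vandermonde product `∏_{k<l} S(z_k, z_l)`. -/
def vandermonde (p : ℂ) {N : ℕ} (z : Fin N → ℂ) : ℂ :=
  ∏ k, ∏ l ∈ Finset.Ioi k, kernel p (z k) (z l)

/-- Every column is a homogeneous polynomial of degree n in the coordinates S(z, 1), S(z, γ), so the
matrix is a projective Vandermonde matrix times a constant matrix. By the addition formula the 2×2
minors of these coordinates are S(z_k, z_l) up to the constant -S(1, γ). -/
lemma exists_det_kernelProd (hp : ‖p‖ < 1) {q α β : ℂ} (hq : q ≠ 0) (hα : α ≠ 0) (hβ : β ≠ 0)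
    (n : ℕ) : ∃ K : ℂ, ∀ z : Fin (n + 1) → ℂ, (∀ k, z k ≠ 0) →
      (Matrix.of fun k j : Fin (n + 1) => kernelProd p q α β n j (z k)).det =
        K * vandermonde p z := by
  obtain ⟨γ, hγ, hk⟩ := exists_kernel_one_ne_zero hp
  have hc : ∀ j : Fin (n + 1), ∃ c : ℕ → ℂ, ∀ z ≠ 0, kernelProd p q α β n j z =
      ∑ m ∈ Finset.range (n + 1), c m * (kernel p z 1 ^ m * kernel p z γ ^ (n - m)) := by
    intro j
    obtain ⟨c, hc⟩ := exists_coeff_of_prod_kernel hp hγ hk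
      (fun i => if i < (j : ℕ) then α * q ^ i else β * q ^ (i - j)) (fun i => by
        split_ifs
        exacts [mul_ne_zero hα (pow_ne_zero _ hq), mul_ne_zero hβ (pow_ne_zero _ hq)]) n
    exact ⟨c, fun z hz => by rw [kernelProd_eq_prod_range q α β (by omega), hc z hz]⟩
  choose c hc using hc
  refine ⟨(Matrix.of fun m j : Fin (n + 1) => c j m).det *
    ∏ k : Fin (n + 1), ∏ l ∈ Finset.Ioi k, -kernel p 1 γ, fun z hz => ?_⟩
  have hmat : (Matrix.of fun k j : Fin (n + 1) => kernelProd p q α β n j (z k)) =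
      Matrix.projVandermonde (fun k => kernel p (z k) 1) (fun k => kernel p (z k) γ) *
        Matrix.of fun m j : Fin (n + 1) => c j m := by
    ext k j
    rw [Matrix.mul_apply, Matrix.of_apply, hc j _ (hz k), Finset.sum_range]
    refine Finset.sum_congr rfl fun m _ => ?_
    rw [Matrix.projVandermonde_apply, Matrix.of_apply, Fin.val_rev, mul_comm,
      show n + 1 - ((m : ℕ) + 1) = n - m by omega]
  rw [hmat, Matrix.det_mul, Matrix.det_projVandermonde, mul_comm, mul_assoc, vandermonde,
    ← Finset.prod_mul_distrib]
  congr 1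
  refine Finset.prod_congr rfl fun k _ => ?_
  rw [← Finset.prod_mul_distrib]
  refine Finset.prod_congr rfl fun l _ => ?_
  have := kernel_plucker hp (hz k) (hz l) one_ne_zero hγ
  linear_combination this

end Identity

end EllipticTheta

end

/-! ### Evaluation of the determinant and the multivariable theta identity. -/

noncomputable section

namespace EllipticTheta

open Filter Topology

section Identity

variable {p h : ℂ}

lemma prod_Iio_val {M : Type*} [CommMonoid M] {N : ℕ} (l : Fin N) (g : ℕ → M) :
    ∏ k ∈ Finset.Iio l, g k = ∏ i ∈ Finset.range l, g i := by
  rw [← Nat.Iio_eq_range, ← Fin.map_valEmbedding_Iio, Finset.prod_map]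
  rfl

lemma prod_Ioi_comm {M : Type*} [CommMonoid M] {N : ℕ} (f : Fin N → Fin N → M) :
    ∏ k, ∏ l ∈ Finset.Ioi k, f k l = ∏ l, ∏ k ∈ Finset.Iio l, f k l :=
  Finset.prod_comm' (by simp)

/-- The sign of the reversal of all pairs. -/
def pairSign (N : ℕ) : ℂ := ∏ k : Fin N, ∏ _l ∈ Finset.Ioi k, (-1)

lemma prod_kernel_swap_eq (hp : ‖p‖ < 1) {q α : ℂ} (hq : q ≠ 0) (hα : α ≠ 0) (N : ℕ) :
    ∏ j : Fin N, ∏ i ∈ Finset.range j, kernel p (α * q ^ (j : ℕ)) (α * q ^ i) =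
      pairSign N * vandermonde p fun k : Fin N => α * q ^ (k : ℕ) := by
  rw [pairSign, vandermonde, ← Finset.prod_mul_distrib]
  simp_rw [← Finset.prod_mul_distrib]
  rw [prod_Ioi_comm]
  refine Finset.prod_congr rfl fun j _ => ?_
  rw [← prod_Iio_val]
  refine Finset.prod_congr rfl fun i _ => ?_
  rw [kernel_swap hp (mul_ne_zero hα (pow_ne_zero _ hq)) (mul_ne_zero hα (pow_ne_zero _ hq))]
  ring

/-- The double product of kernels by which the determinant of theta products differs from the
elliptic Vandermonde product. -/
def kernelResultant (p q α β : ℂ) (n : ℕ) : ℂ :=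
  ∏ j : Fin (n + 1), ∏ l ∈ Finset.range (n - j), kernel p (α * q ^ (j : ℕ)) (β * q ^ l)

/-- The constant is found at z_k = αq^k: there the entries with j > k contain S(αq^k, αq^k) = 0, so
the matrix is triangular. Reading off the constant requires the Vandermonde product at this point to
be nonzero, whence the hypothesis `hreg`. -/
lemma det_kernelProd (hp : ‖p‖ < 1) {q α β : ℂ} (hq : q ≠ 0) (hα : α ≠ 0) (hβ : β ≠ 0)
    {n : ℕ} (hreg : vandermonde p (fun k : Fin (n + 1) => α * q ^ (k : ℕ)) ≠ 0)
    {z : Fin (n + 1) → ℂ} (hz : ∀ k, z k ≠ 0) :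
    (Matrix.of fun k j : Fin (n + 1) => kernelProd p q α β n j (z k)).det =
      pairSign (n + 1) * kernelResultant p q α β n * vandermonde p z := by
  obtain ⟨K, hK⟩ := exists_det_kernelProd hp hq hα hβ n
  rw [hK z hz]
  congr 1
  have h1 := hK (fun k => α * q ^ (k : ℕ)) fun k => mul_ne_zero hα (pow_ne_zero _ hq)
  rw [Matrix.det_of_isLowerTriangular] at h1
  · simp only [Matrix.of_apply, kernelProd, Finset.prod_mul_distrib] at h1
    rw [prod_kernel_swap_eq hp hq hα] at h1
    refine mul_right_cancel₀ hreg ?_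
    rw [← h1, kernelResultant]
    ring
  · intro k j hkj
    have hkj' : (k : ℕ) < j := by simpa using hkj
    rw [Matrix.of_apply, kernelProd, Finset.prod_eq_zero (Finset.mem_range.2 hkj'), zero_mul]
    exact kernel_self hp (mul_ne_zero hα (pow_ne_zero _ hq))

/-- Simultaneous scaling of both arguments of a kernel by h fixes the quotient theta and moves the
product theta by h², so the ratio of the two products of kernels telescopes. -/
lemma theta_mul_prod_kernel_shift {α β : ℂ} (hh : h ≠ 0) (m : ℕ) :
    theta p (α * β * (h ^ 2) ^ m) * ∏ l ∈ Finset.range m, kernel p α (β * (h ^ 2) ^ l) =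
      h ^ m * theta p (α * β) *
        ∏ l ∈ Finset.range m, kernel p (α * h) (β * h * (h ^ 2) ^ l) := by
  have hstep : ∀ m : ℕ, theta p (α * β * (h ^ 2) ^ (m + 1)) * kernel p α (β * (h ^ 2) ^ m) =
      h * theta p (α * β * (h ^ 2) ^ m) * kernel p (α * h) (β * h * (h ^ 2) ^ m) := by
    intro m
    rw [kernel, kernel, show α * h * (β * h * (h ^ 2) ^ m) = α * β * (h ^ 2) ^ (m + 1) by ring,
      show α * h / (β * h * (h ^ 2) ^ m) = α / (β * (h ^ 2) ^ m) by
        rw [mul_right_comm β h, mul_div_mul_right _ _ hh], ← mul_assoc α β]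
    field_simp
  induction m with
  | zero => simp
  | succ m ih =>
    rw [Finset.prod_range_succ, Finset.prod_range_succ]
    linear_combination (∏ l ∈ Finset.range m, kernel p α (β * (h ^ 2) ^ l)) * hstep m +
      (h * kernel p (α * h) (β * h * (h ^ 2) ^ m)) * ih

lemma sum_sub_val (n : ℕ) : ∑ j : Fin (n + 1), (n - (j : ℕ)) = (n + 1).choose 2 := by
  rw [Nat.choose_two_right, ← Finset.sum_range_id, ← Finset.sum_range_reflect, Finset.sum_range fun j => n + 1 - 1 - j]
  rfl

/-- The operator relates determinants with parameters t₀h, t₁h to those with t₀, t₁. Comparing their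
constants converts the power of θ(t₀t₁q^n), one factor per column, into the product of θ(t₀t₁q^j).
-/
lemma kernelResultant_shift {α β : ℂ} (hh : h ≠ 0) (n : ℕ) :
    theta p (α * β * (h ^ 2) ^ n) ^ (n + 1) * kernelResultant p (h ^ 2) α β n =
      h ^ (n + 1).choose 2 * (∏ j : Fin (n + 1), theta p (α * β * (h ^ 2) ^ (j : ℕ))) *
        kernelResultant p (h ^ 2) (α * h) (β * h) n := by
  have hconst : theta p (α * β * (h ^ 2) ^ n) ^ (n + 1) =
      ∏ _j : Fin (n + 1), theta p (α * β * (h ^ 2) ^ n) := by simp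
  rw [hconst, kernelResultant, kernelResultant, ← sum_sub_val, ← Finset.prod_pow_eq_pow_sum,
    ← Finset.prod_mul_distrib, ← Finset.prod_mul_distrib, ← Finset.prod_mul_distrib]
  refine Finset.prod_congr rfl fun j _ => ?_
  have := theta_mul_prod_kernel_shift (p := p) (α := α * (h ^ 2) ^ (j : ℕ)) (β := β) hh (n - j)
  rw [mul_right_comm α _ β, mul_assoc (α * β), ← pow_add, Nat.add_sub_cancel' (by omega),
    mul_right_comm α _ h] at this
  exact this

/-- Multilinear expansion of a determinant whose rows are sums of two rows. -/
lemma det_sum_bool {N : ℕ} (A : Bool → Fin N → Fin N → ℂ) :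
    (Matrix.of fun k j => ∑ b, A b k j).det =
      ∑ σ : Fin N → Bool, (Matrix.of fun k j => A (σ k) k j).det := by
  have := (Matrix.detRowAlternating (R := ℂ) (n := Fin N)).toMultilinearMap.map_sum
    (fun k b => A b k)
  refine Eq.trans ?_ this
  congr 1

/-- The multivariable theta identity, for generic parameters. -/
lemma sum_amplitude_vandermonde_of_generic (hp : ‖p‖ < 1) (hh : h ≠ 0) {n : ℕ}
    {z : Fin (n + 1) → ℂ} (hz : ∀ k, z k ≠ 0) {t₀ t₁ t₂ t₃ : ℂ} (h₀ : t₀ ≠ 0) (h₁ : t₁ ≠ 0)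
    (h₂ : t₂ ≠ 0) (hprod : (h ^ 2) ^ n * (t₀ * t₁ * t₂ * t₃) = 1)
    (g0 : vandermonde p (fun k : Fin (n + 1) => t₀ * (h ^ 2) ^ (k : ℕ)) ≠ 0)
    (g1 : vandermonde p (fun k : Fin (n + 1) => t₀ * h * (h ^ 2) ^ (k : ℕ)) ≠ 0)
    (g2 : kernelResultant p (h ^ 2) (t₀ * h) (t₁ * h) n ≠ 0) :
    h ^ (n + 1).choose 2 * ∑ σ : Fin (n + 1) → Bool,
        (∏ k, amplitude p t₀ t₁ t₂ t₃ (σ k) (z k)) *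
          vandermonde p (fun k => halfStep h (σ k) * z k) =
      (-t₃) ^ (n + 1) * (∏ k : Fin (n + 1), theta p (t₀ * t₁ * (h ^ 2) ^ (k : ℕ)) *
        theta p (t₀ * t₂ * (h ^ 2) ^ (k : ℕ)) * theta p (t₁ * t₂ * (h ^ 2) ^ (k : ℕ))) *
        ((∏ k, theta p (z k ^ 2)) * vandermonde p z) := by
  have hq : h ^ 2 ≠ 0 := pow_ne_zero 2 hh
  set θ₁ := theta p (t₀ * t₁ * (h ^ 2) ^ n) with hθ₁
  set c : Fin (n + 1) → ℂ := fun j => (h⁻¹) ^ n * (-t₃ * (θ₁ *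
    theta p (t₀ * t₂ * (h ^ 2) ^ (j : ℕ)) * theta p (t₁ * t₂ * (h ^ 2) ^ (n - (j : ℕ))))) with hc
  set R := kernelResultant p (h ^ 2) (t₀ * h) (t₁ * h) n with hR
  set V := ∑ σ : Fin (n + 1) → Bool, (∏ k, amplitude p t₀ t₁ t₂ t₃ (σ k) (z k)) *
          vandermonde p (fun k => halfStep h (σ k) * z k) with hV
  -- One determinant is computed twice. First by expanding its rows: each choice of shifts σ gives a
  -- determinant of theta products at the shifted points.
  have hdet : (Matrix.of fun k j : Fin (n + 1) => ∑ b, amplitude p t₀ t₁ t₂ t₃ b (z k) *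
      kernelProd p (h ^ 2) (t₀ * h) (t₁ * h) n j (halfStep h b * z k)).det =
      pairSign (n + 1) * R * V := by
    rw [det_sum_bool fun b k j => amplitude p t₀ t₁ t₂ t₃ b (z k) *
      kernelProd p (h ^ 2) (t₀ * h) (t₁ * h) n j (halfStep h b * z k), hV, Finset.mul_sum]
    refine Finset.sum_congr rfl fun σ _ => ?_
    refine (Matrix.det_mul_column (fun k => amplitude p t₀ t₁ t₂ t₃ (σ k) (z k))
      (Matrix.of fun k j : Fin (n + 1) =>
        kernelProd p (h ^ 2) (t₀ * h) (t₁ * h) n j (halfStep h (σ k) * z k))).trans ?_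
    rw [det_kernelProd hp hq (mul_ne_zero h₀ hh) (mul_ne_zero h₁ hh) g1
        fun k => mul_ne_zero (halfStep_ne_zero hh _) (hz k)]
    ring
  -- Second by letting the one-variable operator act on the entries: θ(z_k²) leaves the rows, the
  -- constants c_j leave the columns.
  have hdet' : (Matrix.of fun k j : Fin (n + 1) => ∑ b, amplitude p t₀ t₁ t₂ t₃ b (z k) *
      kernelProd p (h ^ 2) (t₀ * h) (t₁ * h) n j (halfStep h b * z k)).det =
      (∏ k, theta p (z k ^ 2)) * ((∏ j, c j) *
        (pairSign (n + 1) * kernelResultant p (h ^ 2) t₀ t₁ n * vandermonde p z)) := by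
    rw [← det_kernelProd hp hq h₀ h₁ g0 hz, ← Matrix.det_mul_row, ← Matrix.det_mul_column]
    congr 1
    ext k j
    simp only [Matrix.of_apply]
    rw [sum_amplitude_mul_kernelProd hp hh (hz k) h₀ h₁ h₂ (by omega) hprod, hc]
    ring
  have hsign : pairSign (n + 1) ≠ 0 :=
    Finset.prod_ne_zero_iff.2 fun _ _ => Finset.prod_ne_zero_iff.2 fun _ _ => by norm_num
  have hres := kernelResultant_shift (p := p) (α := t₀) (β := t₁) hh n
  rw [← hθ₁, ← hR] at hres
  have hprodc : h ^ (n * (n + 1)) * ∏ j, c j = (-t₃) ^ (n + 1) * θ₁ ^ (n + 1) *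
      ((∏ j : Fin (n + 1), theta p (t₀ * t₂ * (h ^ 2) ^ (j : ℕ))) *
        ∏ j : Fin (n + 1), theta p (t₁ * t₂ * (h ^ 2) ^ (j : ℕ))) := by
    have hrev : ∏ j : Fin (n + 1), theta p (t₁ * t₂ * (h ^ 2) ^ (n - (j : ℕ))) =
        ∏ j : Fin (n + 1), theta p (t₁ * t₂ * (h ^ 2) ^ (j : ℕ)) := by
      refine Fintype.prod_equiv Fin.revPerm _ _ fun j => ?_
      rw [Fin.revPerm_apply, Fin.val_rev, Nat.add_sub_add_right]
    simp only [hc, Finset.prod_mul_distrib, hrev, Finset.prod_const, Finset.card_univ,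
      Fintype.card_fin]
    rw [← pow_mul, inv_pow]
    field_simp
  have hchoose : n * (n + 1) = (n + 1).choose 2 + (n + 1).choose 2 := by
    rw [Nat.choose_two_right, Nat.add_sub_cancel]
    have := Nat.div_mul_cancel (Nat.even_mul_succ_self n).two_dvd
    rw [mul_comm (n + 1) n]
    omega
  rw [hchoose, pow_add] at hprodc
  have htot : R * V = (∏ k, theta p (z k ^ 2)) * ((∏ j, c j) *
      (kernelResultant p (h ^ 2) t₀ t₁ n * vandermonde p z)) :=
    mul_left_cancel₀ hsign (by linear_combination hdet.symm.trans hdet')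
  have hH : h ^ (n + 1).choose 2 ≠ 0 := pow_ne_zero _ hh
  -- Division by the resultant; this is the reason for the genericity condition `g2`.
  refine mul_left_cancel₀ (mul_ne_zero g2 hH) ?_
  simp only [Finset.prod_mul_distrib]
  linear_combination (h ^ (n + 1).choose 2 * h ^ (n + 1).choose 2) * htot +
    (∏ k, theta p (z k ^ 2)) * (kernelResultant p (h ^ 2) t₀ t₁ n * vandermonde p z) * hprodc +
    (∏ k, theta p (z k ^ 2)) * vandermonde p z * (-t₃) ^ (n + 1) *
      ((∏ j : Fin (n + 1), theta p (t₀ * t₂ * (h ^ 2) ^ (j : ℕ))) *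
        ∏ j : Fin (n + 1), theta p (t₁ * t₂ * (h ^ 2) ^ (j : ℕ))) * hres

/-- For real ε and m ≠ 0 the map ε ↦ c e^(mε) is injective, so the countable zero set pulls back to
a countable set. Both genericity arguments move the parameters along such curves. -/
lemma countable_theta_exp_zeros (hp : ‖p‖ < 1) {c : ℂ} (hc : c ≠ 0) {m : ℤ} (hm : m ≠ 0) :
    {ε : ℝ | theta p (c * Complex.exp ε ^ m) = 0}.Countable := by
  have hinj : Function.Injective fun ε : ℝ => c * Complex.exp ε ^ m := by
    intro ε δ hεδ
    have h1 := mul_left_cancel₀ hc hεδ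
    rw [← Complex.ofReal_exp, ← Complex.ofReal_exp, ← Complex.ofReal_zpow, ← Complex.ofReal_zpow,
      Complex.ofReal_inj] at h1
    have h2 := congrArg Real.log h1
    rw [Real.log_zpow, Real.log_zpow, Real.log_exp, Real.log_exp] at h2
    exact mul_left_cancel₀ (Int.cast_ne_zero.2 hm) h2
  refine ((countable_theta_zeros hp).preimage hinj).mono fun ε hε => ?_
  exact ⟨mul_ne_zero hc (zpow_ne_zero _ (Complex.exp_ne_zero _)), hε⟩

lemma continuous_theta_comp (hp : ‖p‖ < 1) {X : Type*} [TopologicalSpace X] {f : X → ℂ}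
    (hf : Continuous f) (h0 : ∀ x, f x ≠ 0) : Continuous fun x => theta p (f x) :=
  continuous_iff_continuousAt.2 fun x =>
    (continuousAt_theta hp (h0 x)).comp (f := f) hf.continuousAt

lemma vandermonde_ne_zero {q α : ℂ} (hq : q ≠ 0) (hα : α ≠ 0) {N : ℕ}
    (h1 : ∀ m : ℕ, theta p (α ^ 2 * q ^ m) ≠ 0)
    (h2 : ∀ k l : ℕ, k < l → l < N → theta p (q ^ k / q ^ l) ≠ 0) :
    vandermonde p (fun k : Fin N => α * q ^ (k : ℕ)) ≠ 0 := by
  refine Finset.prod_ne_zero_iff.2 fun k _ => Finset.prod_ne_zero_iff.2 fun l hl => ?_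
  rw [kernel, show α * q ^ (k : ℕ) * (α * q ^ (l : ℕ)) = α ^ 2 * q ^ ((k : ℕ) + l) by ring,
    mul_div_mul_left _ _ hα]
  exact mul_ne_zero (inv_ne_zero (mul_ne_zero hα (pow_ne_zero _ hq)))
    (mul_ne_zero (h1 _) (h2 _ _ (Fin.lt_def.1 (Finset.mem_Ioi.1 hl)) l.2))

/-- The multivariable theta identity. -/
theorem sum_amplitude_vandermonde (hp : ‖p‖ < 1) (hh : h ≠ 0) {N : ℕ}
    (hθ : ∀ m : ℕ, 1 ≤ m → m < N → theta p ((h ^ 2) ^ m) ≠ 0)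
    {z : Fin N → ℂ} (hz : ∀ k, z k ≠ 0) {t₀ t₁ t₂ t₃ : ℂ} (h₀ : t₀ ≠ 0) (h₁ : t₁ ≠ 0)
    (h₂ : t₂ ≠ 0) (hprod : (h ^ 2) ^ ((N : ℤ) - 1) * (t₀ * t₁ * t₂ * t₃) = 1) :
    h ^ N.choose 2 * ∑ σ : Fin N → Bool,
        (∏ k, amplitude p t₀ t₁ t₂ t₃ (σ k) (z k)) *
          vandermonde p (fun k => halfStep h (σ k) * z k) =
      (-t₃) ^ N * (∏ k ∈ Finset.range N, theta p (t₀ * t₁ * (h ^ 2) ^ k) *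
        theta p (t₀ * t₂ * (h ^ 2) ^ k) * theta p (t₁ * t₂ * (h ^ 2) ^ k)) *
        ((∏ k, theta p (z k ^ 2)) * vandermonde p z) := by
  obtain _ | n := N
  · simp [vandermonde]
  have hq : h ^ 2 ≠ 0 := pow_ne_zero 2 hh
  rw [show ((n + 1 : ℕ) : ℤ) - 1 = n by push_cast; ring, zpow_natCast] at hprod
  have h₃ : t₃ ≠ 0 := by
    rintro rfl
    simp at hprod
  let e : ℝ → ℂ := fun ε => Complex.exp ε
  have he : ∀ ε, e ε ≠ 0 := fun ε => Complex.exp_ne_zero _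
  have hec : Continuous e := by fun_prop
  -- Only t₀ ↦ t₀e^ε and t₂ ↦ t₂e^(-ε) are moved, which keeps the product of the t's. The factors
  -- θ(q^k/q^l) do not depend on ε, so their nonvanishing has to be assumed in `hθ`.
  set bad : Set ℝ := (⋃ m : ℕ, {ε : ℝ | theta p (t₀ ^ 2 * (h ^ 2) ^ m * e ε ^ (2 : ℤ)) = 0}) ∪
    (⋃ m : ℕ, {ε : ℝ | theta p (t₀ * t₁ * (h ^ 2) ^ m * e ε ^ (1 : ℤ)) = 0}) ∪
    ⋃ j : ℕ, ⋃ l : ℕ, {ε : ℝ | theta p (t₀ * (h ^ 2) ^ j / (t₁ * (h ^ 2) ^ l) * e ε ^ (1 : ℤ)) = 0}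
  have hbad : bad.Countable := by
    have hqm : ∀ m : ℕ, (h ^ 2) ^ m ≠ 0 := fun m => pow_ne_zero _ hq
    refine ((Set.countable_iUnion fun m => ?_).union (Set.countable_iUnion fun m => ?_)).union
      (Set.countable_iUnion fun j => Set.countable_iUnion fun l => ?_)
    · exact countable_theta_exp_zeros hp (mul_ne_zero (pow_ne_zero 2 h₀) (hqm m)) two_ne_zero
    · exact countable_theta_exp_zeros hp (mul_ne_zero (mul_ne_zero h₀ h₁) (hqm m)) one_ne_zero
    · exact countable_theta_exp_zeros hp (div_ne_zero (mul_ne_zero h₀ (hqm j))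
        (mul_ne_zero h₁ (hqm l))) one_ne_zero
  have hpair : ∀ k l : ℕ, k < l → l < n + 1 → theta p ((h ^ 2) ^ k / (h ^ 2) ^ l) ≠ 0 := by
    intro k l hkl hl
    rw [show (h ^ 2) ^ k / (h ^ 2) ^ l = ((h ^ 2) ^ (l - k))⁻¹ by
      rw [eq_comm, inv_eq_iff_eq_inv, inv_div, pow_sub₀ _ hq hkl.le, div_eq_mul_inv],
      theta_inv hp (pow_ne_zero _ hq)]
    exact div_ne_zero (neg_ne_zero.2 (hθ _ (by omega) (by omega))) (pow_ne_zero _ hq)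
  -- Both sides are continuous in ε and agree off a countable set, whose complement is dense; ε = 0
  -- is the claim.
  have hext := Continuous.ext_on (hbad.dense_compl ℝ)
    (f := fun ε => h ^ (n + 1).choose 2 * ∑ σ : Fin (n + 1) → Bool,
        (∏ k, amplitude p (t₀ * e ε) t₁ (t₂ / e ε) t₃ (σ k) (z k)) *
          vandermonde p (fun k => halfStep h (σ k) * z k))
    (g := fun ε => (-t₃) ^ (n + 1) * (∏ k ∈ Finset.range (n + 1),
        theta p (t₀ * e ε * t₁ * (h ^ 2) ^ k) * theta p (t₀ * e ε * (t₂ / e ε) * (h ^ 2) ^ k) *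
        theta p (t₁ * (t₂ / e ε) * (h ^ 2) ^ k)) *
        ((∏ k, theta p (z k ^ 2)) * vandermonde p z)) ?_ ?_ ?_
  · simpa [e] using congrFun hext 0
  · have hc₀ : Continuous fun ε => t₀ * e ε := by fun_prop
    have hc₂ : Continuous fun ε => t₂ / e ε := continuous_const.div hec he
    have hn₀ : ∀ ε, t₀ * e ε ≠ 0 := fun ε => mul_ne_zero h₀ (he ε)
    have hn₂ : ∀ ε, t₂ / e ε ≠ 0 := fun ε => div_ne_zero h₂ (he ε)
    refine continuous_const.mul (continuous_finsetSum _ fun σ _ => Continuous.mul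
      (continuous_finsetProd _ fun k _ => ?_) continuous_const)
    unfold amplitude
    split_ifs
    · refine continuous_const.mul (((Continuous.mul ?_ ?_).mul ?_).mul ?_)
      · exact continuous_theta_comp hp (hc₀.mul_const _) fun ε => mul_ne_zero (hn₀ ε) (hz k)
      · exact continuous_const
      · exact continuous_theta_comp hp (hc₂.mul_const _) fun ε => mul_ne_zero (hn₂ ε) (hz k)
      · exact continuous_const
    · refine continuous_const.mul (((Continuous.mul ?_ ?_).mul ?_).mul ?_)
      · exact continuous_theta_comp hp (hc₀.div_const _) fun ε => div_ne_zero (hn₀ ε) (hz k)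
      · exact continuous_const
      · exact continuous_theta_comp hp (hc₂.div_const _) fun ε => div_ne_zero (hn₂ ε) (hz k)
      · exact continuous_const
  · have hc₀ : Continuous fun ε => t₀ * e ε := by fun_prop
    have hc₂ : Continuous fun ε => t₂ / e ε := continuous_const.div hec he
    have hn₀ : ∀ ε, t₀ * e ε ≠ 0 := fun ε => mul_ne_zero h₀ (he ε)
    have hn₂ : ∀ ε, t₂ / e ε ≠ 0 := fun ε => div_ne_zero h₂ (he ε)
    refine (continuous_const.mul (continuous_finsetProd _ fun k _ => ?_)).mul continuous_const
    have hqk := pow_ne_zero k hq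
    refine (Continuous.mul ?_ ?_).mul ?_
    · exact continuous_theta_comp hp ((hc₀.mul_const _).mul_const _) fun ε =>
        mul_ne_zero (mul_ne_zero (hn₀ ε) h₁) hqk
    · exact continuous_theta_comp hp ((hc₀.mul hc₂).mul_const _) fun ε =>
        mul_ne_zero (mul_ne_zero (hn₀ ε) (hn₂ ε)) hqk
    · exact continuous_theta_comp hp ((hc₂.const_mul _).mul_const _) fun ε =>
        mul_ne_zero (mul_ne_zero h₁ (hn₂ ε)) hqk
  · intro ε hε
    simp only [bad, Set.mem_compl_iff, Set.mem_union, Set.mem_iUnion, Set.mem_ofPred_eq, not_or,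
      not_exists] at hε
    obtain ⟨⟨b1, b2⟩, b3⟩ := hε
    have hn₀ : t₀ * e ε ≠ 0 := mul_ne_zero h₀ (he ε)
    simp only [Finset.prod_range]
    refine sum_amplitude_vandermonde_of_generic hp hh hz hn₀ h₁ (div_ne_zero h₂ (he ε)) ?_ ?_ ?_ ?_
    · have := he ε
      field_simp
      linear_combination hprod
    · refine vandermonde_ne_zero hq hn₀ (fun m => ?_) hpair
      have := b1 m
      rwa [show t₀ ^ 2 * (h ^ 2) ^ m * e ε ^ (2 : ℤ) = (t₀ * e ε) ^ 2 * (h ^ 2) ^ m by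
        norm_cast; ring] at this
    · refine vandermonde_ne_zero hq (mul_ne_zero hn₀ hh) (fun m => ?_) hpair
      have := b1 (m + 1)
      rwa [show t₀ ^ 2 * (h ^ 2) ^ (m + 1) * e ε ^ (2 : ℤ) = (t₀ * e ε * h) ^ 2 * (h ^ 2) ^ m by
        norm_cast; ring] at this
    · refine Finset.prod_ne_zero_iff.2 fun j _ => Finset.prod_ne_zero_iff.2 fun l _ => ?_
      have b2' := b2 (j + l + 1)
      have b3' := b3 j l
      rw [zpow_one] at b2' b3'
      rw [kernel, show t₀ * e ε * h * (h ^ 2) ^ (j : ℕ) * (t₁ * h * (h ^ 2) ^ l) =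
        t₀ * t₁ * (h ^ 2) ^ ((j : ℕ) + l + 1) * e ε by ring,
        show t₀ * e ε * h * (h ^ 2) ^ (j : ℕ) / (t₁ * h * (h ^ 2) ^ l) =
          t₀ * (h ^ 2) ^ (j : ℕ) / (t₁ * (h ^ 2) ^ l) * e ε by
            rw [mul_right_comm t₁, mul_right_comm (t₀ * e ε), mul_div_mul_right _ _ hh]; ring]
      exact mul_ne_zero (inv_ne_zero (mul_ne_zero (mul_ne_zero hn₀ hh) (pow_ne_zero _ hq)))
        (mul_ne_zero b2' b3')

end Identity

end EllipticTheta

end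

noncomputable section

namespace EllipticModel

open EllipticTheta Filter Topology

variable (M : EllipticModel)

/-! ### Reduction of the matrices to the theta identity -/

lemma q_ne_zero : M.q ≠ 0 := pow_ne_zero 2 M.sq_ne_zero

lemma F_ne_zero (S t : ℤ) : M.F S t ≠ 0 :=
  mul_ne_zero (zpow_ne_zero _ M.sq_ne_zero) (mul_ne_zero M.sv₁_ne_zero M.sv₂_ne_zero)

lemma z_ne_zero (S t x : ℤ) : M.z S t x ≠ 0 :=
  mul_ne_zero (M.F_ne_zero S t) (zpow_ne_zero _ M.q_ne_zero)

lemma theta_zpow_zero {n : ℤ} (hn : n = 0) : M.θ (M.q ^ n) = 0 := by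
  rw [hn, zpow_zero]
  exact theta_one M.norm_p_lt_one

lemma sq_zpow_two_mul (n : ℤ) : M.sq ^ (2 * n) = M.q ^ n := by
  rw [zpow_mul]
  rfl

lemma z_mul_z (S t x y : ℤ) :
    M.z S t x * M.z S t y = M.q ^ (x + y + 1 - t - S) * M.v₁ * M.v₂ := by
  rw [show x + y + 1 - t - S = (1 - t - S) + x + y by ring, zpow_add₀ M.q_ne_zero,
    zpow_add₀ M.q_ne_zero, ← M.sq_zpow_two_mul (1 - t - S),
    show 2 * (1 - t - S) = (-t - S + 1) + (-t - S + 1) by ring, zpow_add₀ M.sq_ne_zero]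
  unfold z F v₁ v₂
  ring

lemma z_sq (S t x : ℤ) : M.z S t x ^ 2 = M.q ^ (2 * x + 1 - t - S) * M.v₁ * M.v₂ := by
  rw [pow_two, z_mul_z, two_mul]

lemma z_div_z (S t x y : ℤ) : M.z S t x / M.z S t y = M.q ^ (x - y) := by
  rw [z, z, mul_div_mul_left _ _ (M.F_ne_zero S t), zpow_sub₀ M.q_ne_zero]

lemma phi_eq_kernel (S t x y : ℤ) :
    M.phi S t x y = M.F S t * kernel M.p (M.z S t x) (M.z S t y) := by
  have hF := M.F_ne_zero S t
  rw [kernel, z_mul_z, z_div_z, phi, θ, θ, zpow_neg, z]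
  field_simp

/-- Since F depends on S + t, changing the line already contributes a half power of q. Both kinds of
steps, v = 0 (stay or up) and v = -1 (stay or down), therefore act on z as the same symmetric pair
of factors h and 1/h. -/
lemma z_step {S t S' t' v : ℤ} (hst : S' + t' = S + t + 1 + 2 * v) (x : ℤ) (b : Bool) :
    M.z S' t' (x + v + if b then 1 else 0) = halfStep M.sq b * M.z S t x := by
  have hs := M.sq_ne_zero
  have h1 : ∀ (S t x : ℤ), M.z S t x = M.sq ^ (2 * x - t - S + 1) * (M.sv₁ * M.sv₂) := by
    intro S t x
    rw [z, F, ← sq_zpow_two_mul, mul_right_comm, ← zpow_add₀ hs]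
    ring_nf
  rw [h1, h1, ← mul_assoc (halfStep M.sq b)]
  congr 1
  cases b
  · simp only [halfStep, Bool.false_eq_true, if_false]
    rw [← zpow_neg_one, ← zpow_add₀ hs]
    congr 1
    linear_combination -hst
  · simp only [halfStep, if_true]
    rw [← zpow_one_add₀ hs]
    congr 1
    linear_combination -hst

/-- The numerator of `plusFactor`. -/
def plusNum (S t : ℤ) (a b c : ℂ) (x : ℤ) : ℂ :=
  -(M.q ^ (-x) * (M.θ (a * M.z S t x) * M.θ (b * M.z S t x) * M.θ (c * M.z S t x) *
    M.θ (M.q ^ (1 - (M.N : ℤ)) * M.z S t x / (a * b * c))))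

/-- The numerator of `minusFactor`. -/
def minusNum (S t : ℤ) (a b c : ℂ) (x : ℤ) : ℂ :=
  M.q ^ (-x - (M.N : ℤ) + 1) * (M.θ (M.z S t x / a) * M.θ (M.z S t x / b) *
    M.θ (M.z S t x / c) * M.θ (M.q ^ ((M.N : ℤ) - 1) * M.z S t x * (a * b * c)))

lemma plusFactor_eq (S t : ℤ) (a b c : ℂ) (x : ℤ) :
    M.plusFactor S t a b c x = M.plusNum S t a b c x / M.θ (M.z S t x ^ 2) :=
  (neg_div _ _).symm

lemma minusFactor_eq (S t : ℤ) (a b c : ℂ) (x : ℤ) :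
    M.minusFactor S t a b c x = M.minusNum S t a b c x / M.θ (M.z S t x ^ 2) := rfl

/-- The fourth parameter q^(1-N)/abc is the one forced by the balancing condition. For f⁻ the four
inversions θ(z/r) ↔ θ(r/z) cancel in sign and produce the power z³. -/
lemma num_eq_amplitude (S t : ℤ) {a b c : ℂ} (ha : a ≠ 0) (hb : b ≠ 0) (hc : c ≠ 0) (x : ℤ)
    (β : Bool) : (if β then M.plusNum S t a b c x else M.minusNum S t a b c x) =
      -M.F S t * amplitude M.p a b c (M.q ^ (1 - (M.N : ℤ)) / (a * b * c)) β (M.z S t x) := by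
  have hF := M.F_ne_zero S t
  have hz := M.z_ne_zero S t x
  have hq := M.q_ne_zero
  have hqx : M.q ^ (-x) = M.F S t / M.z S t x := by
    rw [zpow_neg, z]
    field_simp
  have hqN := zpow_ne_zero (1 - (M.N : ℤ)) hq
  cases β
  · simp only [amplitude, Bool.false_eq_true, if_false, minusNum, θ]
    have ht : M.q ^ ((M.N : ℤ) - 1) = (M.q ^ (1 - (M.N : ℤ)))⁻¹ := by
      rw [← zpow_neg, neg_sub]
    rw [show -x - (M.N : ℤ) + 1 = -x + (1 - M.N) by ring, zpow_add₀ hq, hqx, ht]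
    generalize M.q ^ (1 - (M.N : ℤ)) = Q at hqN ⊢
    have ht₃ : Q / (a * b * c) ≠ 0 := div_ne_zero hqN (mul_ne_zero (mul_ne_zero ha hb) hc)
    rw [show Q⁻¹ * M.z S t x * (a * b * c) = M.z S t x / (Q / (a * b * c)) by field_simp,
      theta_div_comm M.norm_p_lt_one ha hz, theta_div_comm M.norm_p_lt_one hb hz,
      theta_div_comm M.norm_p_lt_one hc hz, theta_div_comm M.norm_p_lt_one ht₃ hz]
    field_simp
  · simp only [amplitude, if_true, plusNum, θ]
    rw [hqx, mul_div_right_comm]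
    ring

/-- The Vandermonde product `∏_{k<l} φ_{t,S}(x_k, x_l)`. -/
def phiProd (S t : ℤ) (X : Fin M.N → ℤ) : ℂ :=
  ∏ k, ∏ l ∈ Finset.Ioi k, M.phi S t (X k) (X l)

lemma prod_pairs_const (N : ℕ) (c : ℂ) :
    ∏ k : Fin N, ∏ _l ∈ Finset.Ioi k, c = c ^ N.choose 2 := by
  simp only [Finset.prod_const, Fin.card_Ioi]
  rw [Finset.prod_pow_eq_pow_sum]
  congr 1
  obtain _ | n := N
  · simp
  · exact sum_sub_val n

lemma phiProd_eq_vandermonde (S t : ℤ) (X : Fin M.N → ℤ) :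
    M.phiProd S t X = M.F S t ^ M.N.choose 2 * vandermonde M.p fun k => M.z S t (X k) := by
  rw [phiProd, vandermonde, ← prod_pairs_const, ← Finset.prod_mul_distrib]
  refine Finset.prod_congr rfl fun k _ => ?_
  rw [← Finset.prod_mul_distrib]
  exact Finset.prod_congr rfl fun l _ => M.phi_eq_kernel S t _ _

lemma phiProd_eq_zero (S t : ℤ) {X : Fin M.N → ℤ} {k l : Fin M.N} (hkl : k < l)
    (hX : X k = X l) : M.phiProd S t X = 0 := by
  refine Finset.prod_eq_zero (Finset.mem_univ k) (Finset.prod_eq_zero (Finset.mem_Ioi.2 hkl) ?_)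
  rw [phi, M.theta_zpow_zero (sub_eq_zero.2 hX), mul_zero, zero_mul]

/-- The positions reached from `X` by adding `v` or `v + 1` to every coordinate. -/
def neighbor {N : ℕ} (v : ℤ) (X : Fin N → ℤ) (σ : Fin N → Bool) (k : Fin N) : ℤ :=
  X k + v + if σ k then 1 else 0

/-- The sum of the unnormalized transition weights from `X` to all of its neighbors. -/
lemma sum_neighbor (hθ : ∀ m : ℕ, 1 ≤ m → m < M.N → M.θ (M.q ^ m) ≠ 0) {S t S' t' v : ℤ}
    (hst : S' + t' = S + t + 1 + 2 * v) {a b c : ℂ} (ha : a ≠ 0) (hb : b ≠ 0) (hc : c ≠ 0)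
    (X : Fin M.N → ℤ) :
    M.q ^ ((1 + v) * (M.N.choose 2 : ℕ)) * ∑ σ, M.phiProd S' t' (neighbor v X σ) *
        ∏ k, (if σ k then M.plusNum S t a b c (X k) else M.minusNum S t a b c (X k)) =
      M.normDown S t a b c * ((∏ k, M.θ (M.z S t (X k) ^ 2)) * M.phiProd S t X) := by
  have hs := M.sq_ne_zero
  have hqN := zpow_ne_zero (1 - (M.N : ℤ)) M.q_ne_zero
  have key := sum_amplitude_vandermonde M.norm_p_lt_one hs hθ (z := fun k => M.z S t (X k))
    (fun k => M.z_ne_zero S t _) ha hb hc (t₃ := M.q ^ (1 - (M.N : ℤ)) / (a * b * c)) (by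
      have : (M.sq ^ 2) ^ ((M.N : ℤ) - 1) = (M.q ^ (1 - (M.N : ℤ)))⁻¹ := by
        rw [← zpow_neg, neg_sub]
        rfl
      rw [this]
      field_simp)
  have hF : M.F S t = M.F S' t' * M.sq ^ (1 + 2 * v) := by
    rw [F, F, mul_right_comm, ← zpow_add₀ hs]
    congr 2
    linear_combination hst
  set C := M.N.choose 2
  have hterm : ∀ σ : Fin M.N → Bool, M.phiProd S' t' (neighbor v X σ) *
      ∏ k, (if σ k then M.plusNum S t a b c (X k) else M.minusNum S t a b c (X k)) =
      M.F S' t' ^ C * (-M.F S t) ^ M.N * ((∏ k, amplitude M.p a b c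
        (M.q ^ (1 - (M.N : ℤ)) / (a * b * c)) (σ k) (M.z S t (X k))) *
          vandermonde M.p (fun k => halfStep M.sq (σ k) * M.z S t (X k))) := by
    intro σ
    rw [phiProd_eq_vandermonde]
    simp only [M.num_eq_amplitude S t ha hb hc, Finset.prod_mul_distrib, neighbor,
      M.z_step hst, Finset.prod_const, Finset.card_univ, Fintype.card_fin]
    ring
  simp only [hterm, ← Finset.mul_sum]
  rw [phiProd_eq_vandermonde, hF, mul_pow (M.F S' t') (M.sq ^ (1 + 2 * v)), ← hF]
  -- The powers of h come from F^C on the two lines and from the theta identity. They amount to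
  -- q^(N(N-1)/2) for v = 0 and to 1 for v = -1, which accounts for the different normalizations of
  -- the two kinds of matrices.
  have hpow : M.q ^ ((1 + v) * (C : ℤ)) = (M.sq ^ (1 + 2 * v)) ^ C * M.sq ^ C := by
    rw [← sq_zpow_two_mul, ← zpow_natCast, ← zpow_natCast M.sq, ← zpow_mul, ← zpow_add₀ hs]
    congr 1
    ring
  have hnorm : M.normDown S t a b c = (-M.F S t) ^ M.N *
      ((-(M.q ^ (1 - (M.N : ℤ)) / (a * b * c))) ^ M.N * ∏ k ∈ Finset.range M.N,
        theta M.p (a * b * (M.sq ^ 2) ^ k) * theta M.p (a * c * (M.sq ^ 2) ^ k) *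
          theta M.p (b * c * (M.sq ^ 2) ^ k)) := by
    rw [normDown, ← mul_assoc, ← mul_pow]
    congr 1
    · congr 1
      ring
    · refine Finset.prod_congr rfl fun k _ => ?_
      simp only [θ, q, mul_comm _ ((M.sq ^ 2) ^ k)]
  rw [hpow, hnorm]
  simp only [θ]
  linear_combination ((M.sq ^ (1 + 2 * v)) ^ C * (M.F S' t' ^ C * (-M.F S t) ^ M.N)) * key

/-! ### Sums over configurations -/

lemma mem_config {S t : ℤ} {X : Fin M.N → ℤ} :
    X ∈ M.config S t ↔ (∀ k, X k ∈ M.positions S t) ∧ StrictMono X := by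
  simp [config]

open Classical in
/-- A sum over the configurations that are neighbors of `X` is a sum over all subsets of
particles. -/
lemma sum_config_eq_sum_neighbor {S t : ℤ} {X : Fin M.N → ℤ} (hX : StrictMono X) (v : ℤ)
    (G : (Fin M.N → ℤ) → ℂ) (A B : Fin M.N → ℂ)
    (hG : ∀ Y k l, k < l → Y k = Y l → G Y = 0)
    (hA : ∀ k, X k + v + 1 ∉ M.positions S t → A k = 0)
    (hB : ∀ k, X k + v ∉ M.positions S t → B k = 0) :
    ∑ Y ∈ M.config S t, (if ∀ k, Y k = X k + v ∨ Y k = X k + v + 1 then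
        G Y * (∏ k with Y k = X k + v + 1, A k) * ∏ k with Y k = X k + v, B k else 0) =
      ∑ σ, G (neighbor v X σ) * ∏ k, if σ k then A k else B k := by
  set g : (Fin M.N → ℤ) → ℂ := fun Y => if ∀ k, Y k = X k + v ∨ Y k = X k + v + 1 then
        G Y * (∏ k with Y k = X k + v + 1, A k) * ∏ k with Y k = X k + v, B k else 0 with hg
  have hgσ : ∀ σ, g (neighbor v X σ) = G (neighbor v X σ) * ∏ k, if σ k then A k else B k := by
    intro σ
    rw [hg]
    simp only
    rw [if_pos, Finset.prod_ite, mul_assoc]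
    · congr 3
      · ext k
        by_cases h : σ k = true <;> simp [neighbor, h]
      · ext k
        by_cases h : σ k = true <;> simp [neighbor, h]
    · intro k
      unfold neighbor
      split_ifs
      · exact Or.inr rfl
      · exact Or.inl (add_zero _)
  -- Choices σ whose outcome is not a configuration drop out because their terms vanish; the
  -- remaining ones correspond bijectively to the configurations near X.
  rw [← Finset.sum_filter_of_ne (p := fun σ => neighbor v X σ ∈ M.config S t)]
  · symm
    refine Finset.sum_of_injOn (neighbor v X) ?_ ?_ ?_ ?_
    · intro σ _ τ _ hστ
      funext k
      have := congrFun hστ k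
      unfold neighbor at this
      cases h1 : σ k <;> cases h2 : τ k <;> simp_all
    · intro σ hσ
      exact (Finset.mem_filter.1 hσ).2
    · intro Y hY hne
      rw [if_neg]
      intro hcond
      refine hne ⟨fun k => decide (Y k = X k + v + 1), ?_, ?_⟩
      · rw [Finset.mem_coe, Finset.mem_filter]
        refine ⟨Finset.mem_univ _, ?_⟩
        convert hY using 1
        funext k
        rcases hcond k with h | h <;> simp [neighbor, h]
      · funext k
        rcases hcond k with h | h <;> simp [neighbor, h]
    · intro σ _
      exact (hgσ σ).symm
  · intro σ _ hne
    rw [mem_config]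
    have hmem : ∀ k, neighbor v X σ k ∈ M.positions S t := by
      intro k
      by_contra hk
      refine hne (mul_eq_zero_of_right _ (Finset.prod_eq_zero (Finset.mem_univ k) ?_))
      unfold neighbor at hk
      split_ifs with h
      · rw [if_pos h] at hk
        exact hA k hk
      · rw [if_neg h, add_zero] at hk
        exact hB k hk
    -- Relative displacements are at most one, so strict order can fail only through a collision,
    -- and `hG` kills collisions.
    refine ⟨hmem, fun k l hkl => ?_⟩
    have h1 := hX hkl
    have h2 : neighbor v X σ k ≠ neighbor v X σ l := fun h =>
      hne (mul_eq_zero_of_left (hG _ k l hkl h) _)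
    unfold neighbor at h2 ⊢
    split_ifs at h2 ⊢ <;> omega

end EllipticModel

end

noncomputable section

namespace EllipticModel

open EllipticTheta Filter Topology

variable (M : EllipticModel)

/-! ### Stochasticity and transport for a matrix of general type -/

open Classical in
/-- The common form of `matrixUp` (for `v = 0`) and `matrixDown` (for `v = -1`). -/
def matrixStep (v S t S' t' : ℤ) (a b c : ℂ) (X Y : Fin M.N → ℤ) : ℂ :=
  if ∀ k, Y k = X k + v ∨ Y k = X k + v + 1 then
    M.q ^ ((1 + v) * (M.N.choose 2 : ℕ)) * (M.normDown S t a b c)⁻¹ * M.phiRatio S t S' t' X Y *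
      (∏ k with Y k = X k + v + 1, M.plusFactor S t a b c (X k)) *
      ∏ k with Y k = X k + v, M.minusFactor S t a b c (X k)
  else 0

lemma matrixUp_eq_matrixStep (S t S' t' : ℤ) (a b c : ℂ) :
    M.matrixUp S t S' t' a b c = M.matrixStep 0 S t S' t' a b c := by
  funext X Y
  unfold matrixUp matrixStep
  refine if_congr (forall_congr' fun k => ?_) ?_ rfl
  · omega
  · simp only [add_zero, one_mul, zpow_natCast, normUp, inv_div]
    rw [div_eq_mul_inv]

lemma matrixDown_eq_matrixStep (S t S' t' : ℤ) (a b c : ℂ) :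
    M.matrixDown S t S' t' a b c = M.matrixStep (-1) S t S' t' a b c := by
  funext X Y
  unfold matrixDown matrixStep
  refine if_congr (forall_congr' fun k => ?_) ?_ rfl
  · omega
  · simp only [sub_add_cancel, add_neg_cancel, zero_mul, zpow_zero, one_mul, ← sub_eq_add_neg]
    ring

lemma phiRatio_eq (S t S' t' : ℤ) (X Y : Fin M.N → ℤ) :
    M.phiRatio S t S' t' X Y = M.phiProd S' t' Y / M.phiProd S t X := by
  simp only [phiRatio, phiProd, Finset.prod_div_distrib]

lemma normDown_ne_zero {S t : ℤ} {a b c : ℂ} (ha : a ≠ 0) (hb : b ≠ 0) (hc : c ≠ 0)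
    (h : M.NormRegular a b c) : M.normDown S t a b c ≠ 0 := by
  refine mul_ne_zero (pow_ne_zero _ (div_ne_zero (mul_ne_zero (zpow_ne_zero _ M.q_ne_zero)
    (M.F_ne_zero S t)) (mul_ne_zero (mul_ne_zero ha hb) hc))) ?_
  refine Finset.prod_ne_zero_iff.2 fun k hk => ?_
  obtain ⟨h1, h2, h3⟩ := h k (Finset.mem_range.1 hk)
  exact mul_ne_zero (mul_ne_zero h1 h2) h3

variable {M}

lemma LineRegular.phiProd_ne_zero {S t : ℤ} (h : M.LineRegular S t) {X : Fin M.N → ℤ}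
    (hX : X ∈ M.config S t) : M.phiProd S t X ≠ 0 :=
  Finset.prod_ne_zero_iff.2 fun k _ => Finset.prod_ne_zero_iff.2 fun l hl =>
    (h X hX).1 k l (Finset.mem_Ioi.1 hl)

/-- On a regular line the first powers of `q` are not zeros of the theta function. -/
lemma LineRegular.theta_pow_ne_zero {S t : ℤ} (hS₀ : 0 ≤ S) (hST : S ≤ M.T) (ht₀ : 0 ≤ t)
    (htT : t ≤ M.T) (h : M.LineRegular S t) (m : ℕ) (hm : 1 ≤ m) (hmN : m < M.N) :
    M.θ (M.q ^ m) ≠ 0 := by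
  -- The configuration packed against the lower end realizes every difference m < N. It fits on the
  -- line because 0 ≤ S, t ≤ T.
  set X : Fin M.N → ℤ := fun k => max 0 (t + S - M.T) + (k : ℕ) with hXdef
  have hX : X ∈ M.config S t := by
    refine M.mem_config.2 ⟨fun k => ?_, fun k l hkl => ?_⟩
    · have := k.2
      simp only [positions, Finset.mem_Icc, hXdef]
      omega
    · have : (k : ℕ) < l := hkl
      simp only [hXdef]
      omega
  have h1 := (h X hX).1 ⟨0, by omega⟩ ⟨m, hmN⟩ (Fin.lt_def.2 (show 0 < m from hm))
  have h2 : M.θ (M.q ^ (X ⟨0, by omega⟩ - X ⟨m, hmN⟩)) ≠ 0 := fun h0 => h1 (by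
    rw [phi, h0, mul_zero, zero_mul])
  rw [show X ⟨0, by omega⟩ - X ⟨m, hmN⟩ = -(m : ℤ) by simp [hXdef], zpow_neg, zpow_natCast, θ,
    theta_inv M.norm_p_lt_one (pow_ne_zero _ M.q_ne_zero)] at h2
  intro h0
  exact h2 (by rw [θ] at h0; rw [h0, neg_zero, zero_div])

/-- The row sums of a matrix are one if its entries vanish at the boundary of the line. -/
lemma rowSumsOne_matrixStep {v S t S' t' : ℤ} (hst : S' + t' = S + t + 1 + 2 * v)
    (hθ : ∀ m : ℕ, 1 ≤ m → m < M.N → M.θ (M.q ^ m) ≠ 0) (hline : M.LineRegular S t)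
    {a b c : ℂ} (ha : a ≠ 0) (hb : b ≠ 0) (hc : c ≠ 0) (hnorm : M.NormRegular a b c)
    (hplus : ∀ x ∈ M.positions S t, x + v + 1 ∉ M.positions S' t' → M.plusNum S t a b c x = 0)
    (hminus : ∀ x ∈ M.positions S t, x + v ∉ M.positions S' t' → M.minusNum S t a b c x = 0) :
    RowSumsOne (M.config S t) (M.config S' t') (M.matrixStep v S t S' t' a b c) := by
  intro X hX
  obtain ⟨hXpos, hXmono⟩ := M.mem_config.1 hX
  have hn := M.normDown_ne_zero (S := S) (t := t) ha hb hc hnorm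
  have hφ := hline.phiProd_ne_zero hX
  have hz : ∏ k, M.θ (M.z S t (X k) ^ 2) ≠ 0 :=
    Finset.prod_ne_zero_iff.2 fun k _ => (hline X hX).2 k
  have h1 := M.sum_config_eq_sum_neighbor (S := S') (t := t') hXmono v
    (M.phiProd S' t') (fun k => M.plusFactor S t a b c (X k))
    (fun k => M.minusFactor S t a b c (X k)) (fun Y k l hkl h => M.phiProd_eq_zero _ _ hkl h)
    (fun k hk => by rw [plusFactor_eq, hplus _ (hXpos k) hk, zero_div])
    (fun k hk => by rw [minusFactor_eq, hminus _ (hXpos k) hk, zero_div])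
  have h2 := M.sum_neighbor hθ hst ha hb hc X
  have h3 : ∀ σ : Fin M.N → Bool, (∏ k, if σ k then M.plusFactor S t a b c (X k) else
      M.minusFactor S t a b c (X k)) = (∏ k, M.θ (M.z S t (X k) ^ 2))⁻¹ *
        ∏ k, (if σ k then M.plusNum S t a b c (X k) else M.minusNum S t a b c (X k)) := by
    intro σ
    rw [← Finset.prod_inv_distrib, ← Finset.prod_mul_distrib]
    refine Finset.prod_congr rfl fun k _ => ?_
    rw [plusFactor_eq, minusFactor_eq]
    split_ifs <;> ring
  simp only [h3, mul_left_comm _ (∏ k, M.θ (M.z S t (X k) ^ 2))⁻¹] at h1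
  rw [← Finset.mul_sum] at h1
  have h4 : ∑ Y ∈ M.config S' t', M.matrixStep v S t S' t' a b c X Y =
      M.q ^ ((1 + v) * (M.N.choose 2 : ℕ)) * (M.normDown S t a b c)⁻¹ * (M.phiProd S t X)⁻¹ *
      ((∏ k, M.θ (M.z S t (X k) ^ 2))⁻¹ * ∑ σ, M.phiProd S' t' (neighbor v X σ) *
        ∏ k, (if σ k then M.plusNum S t a b c (X k) else M.minusNum S t a b c (X k))) := by
    rw [← h1, Finset.mul_sum]
    refine Finset.sum_congr rfl fun Y _ => ?_
    rw [matrixStep, mul_ite, mul_zero]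
    refine if_congr Iff.rfl ?_ rfl
    rw [phiRatio_eq]
    ring
  rw [h4]
  field_simp
  linear_combination h2

/-- A matrix carries a product-form density to a multiple of a product-form density, if the
univariate factors are compatible with the reversed transitions. -/
lemma exists_sum_matrixStep_mul {v v' S t S' t' : ℤ} (hv : v + v' = -1)
    (hst : S' + t' = S + t + 1 + 2 * v)
    (hθ : ∀ m : ℕ, 1 ≤ m → m < M.N → M.θ (M.q ^ m) ≠ 0) (hline : M.LineRegular S t)
    {a b c d e f : ℂ} (hd : d ≠ 0) (he : e ≠ 0) (hf : f ≠ 0) (w u' : ℤ → ℂ) (κ₀ : ℂ)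
    (hwplus : ∀ X ∈ M.config S t, ∀ Y ∈ M.config S' t', ∀ k, Y k = X k + v + 1 →
      M.plusFactor S t a b c (X k) * w (X k) = κ₀ * u' (Y k) * M.minusNum S' t' d e f (Y k))
    (hwminus : ∀ X ∈ M.config S t, ∀ Y ∈ M.config S' t', ∀ k, Y k = X k + v →
      M.minusFactor S t a b c (X k) * w (X k) = κ₀ * u' (Y k) * M.plusNum S' t' d e f (Y k))
    (hplus : ∀ y ∈ M.positions S' t', y - v ∉ M.positions S t → M.plusNum S' t' d e f y = 0)
    (hminus : ∀ y ∈ M.positions S' t', y - v - 1 ∉ M.positions S t →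
      M.minusNum S' t' d e f y = 0) :
    ∃ κ : ℂ, ∀ Y ∈ M.config S' t', ∑ X ∈ M.config S t, M.matrixStep v S t S' t' a b c X Y *
        (M.phiProd S t X ^ 2 * ∏ k, w (X k)) =
      κ * (M.phiProd S' t' Y ^ 2 * ∏ k, u' (Y k) * M.θ (M.z S' t' (Y k) ^ 2)) := by
  -- The constant collects the normalization of the matrix, one κ₀ per particle, and the value of
  -- the sum over reversed steps from Y.
  refine ⟨M.q ^ ((1 + v) * (M.N.choose 2 : ℕ)) * (M.normDown S t a b c)⁻¹ * κ₀ ^ M.N *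
    ((M.q ^ ((1 + v') * (M.N.choose 2 : ℕ)))⁻¹ * M.normDown S' t' d e f), fun Y hY => ?_⟩
  obtain ⟨hYpos, hYmono⟩ := M.mem_config.1 hY
  have h1 := M.sum_config_eq_sum_neighbor (S := S) (t := t) hYmono v'
    (M.phiProd S t) (fun k => κ₀ * u' (Y k) * M.plusNum S' t' d e f (Y k))
    (fun k => κ₀ * u' (Y k) * M.minusNum S' t' d e f (Y k))
    (fun Y k l hkl h => M.phiProd_eq_zero _ _ hkl h)
    (fun k hk => by
      rw [hplus _ (hYpos k) (by rwa [show Y k - v = Y k + v' + 1 by omega]), mul_zero])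
    (fun k hk => by
      rw [hminus _ (hYpos k) (by rwa [show Y k - v - 1 = Y k + v' by omega]), mul_zero])
  have h2 := M.sum_neighbor hθ (show S + t = S' + t' + 1 + 2 * v' by omega) hd he hf Y
  have h3 : ∀ σ : Fin M.N → Bool, (∏ k, if σ k then κ₀ * u' (Y k) * M.plusNum S' t' d e f (Y k)
      else κ₀ * u' (Y k) * M.minusNum S' t' d e f (Y k)) = (κ₀ ^ M.N * ∏ k, u' (Y k)) *
        ∏ k, (if σ k then M.plusNum S' t' d e f (Y k) else M.minusNum S' t' d e f (Y k)) := by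
    intro σ
    rw [show κ₀ ^ M.N = ∏ _k : Fin M.N, κ₀ by simp, ← Finset.prod_mul_distrib,
      ← Finset.prod_mul_distrib]
    refine Finset.prod_congr rfl fun k _ => ?_
    split_ifs <;> ring
  simp only [h3, mul_left_comm _ (κ₀ ^ M.N * ∏ k, u' (Y k))] at h1
  rw [← Finset.mul_sum] at h1
  have hqv : M.q ^ ((1 + v') * ((M.N.choose 2 : ℕ) : ℤ)) ≠ 0 := zpow_ne_zero _ M.q_ne_zero
  -- The ratio φ'(Y)/φ(X) times φ(X)² is φ'(Y)φ(X). With φ'(Y) taken out, the sum over X is the sum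
  -- over neighbors of Y for the reversed step: a particle with the larger displacement v + 1 has
  -- the smaller one, v' = -(v + 1), when read backwards.
  have h4 : ∑ X ∈ M.config S t, M.matrixStep v S t S' t' a b c X Y *
        (M.phiProd S t X ^ 2 * ∏ k, w (X k)) =
      M.q ^ ((1 + v) * (M.N.choose 2 : ℕ)) * (M.normDown S t a b c)⁻¹ * M.phiProd S' t' Y *
      (κ₀ ^ M.N * (∏ k, u' (Y k)) * ∑ σ, M.phiProd S t (neighbor v' Y σ) *
        ∏ k, (if σ k then M.plusNum S' t' d e f (Y k) else M.minusNum S' t' d e f (Y k))) := by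
    rw [← h1, Finset.mul_sum]
    refine Finset.sum_congr rfl fun X hX => ?_
    have hφ := hline.phiProd_ne_zero hX
    rw [matrixStep, ite_mul, zero_mul, mul_ite, mul_zero]
    refine if_ctx_congr (forall_congr' fun k => by omega) (fun hcond => ?_) (fun _ => rfl)
    have hplus' : Finset.univ.filter (fun k => Y k = X k + v) =
        Finset.univ.filter (fun k => X k = Y k + v' + 1) := by
      ext k
      simp only [Finset.mem_filter, Finset.mem_univ, true_and]
      omega
    have hminus' : Finset.univ.filter (fun k => Y k = X k + v + 1) =
        Finset.univ.filter (fun k => X k = Y k + v') := by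
      ext k
      simp only [Finset.mem_filter, Finset.mem_univ, true_and]
      omega
    have hw : ∏ k, w (X k) = (∏ k with Y k = X k + v + 1, w (X k)) *
        ∏ k with Y k = X k + v, w (X k) := by
      rw [← Finset.prod_filter_mul_prod_filter_not Finset.univ (fun k => Y k = X k + v + 1)]
      congr 2
      ext k
      have := hcond k
      simp only [Finset.mem_filter, Finset.mem_univ, true_and]
      omega
    have e1 : (∏ k with Y k = X k + v + 1, M.plusFactor S t a b c (X k)) *
        (∏ k with Y k = X k + v + 1, w (X k)) =
        ∏ k with X k = Y k + v', κ₀ * u' (Y k) * M.minusNum S' t' d e f (Y k) := by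
      rw [← Finset.prod_mul_distrib, ← hminus']
      refine Finset.prod_congr rfl fun k hk => ?_
      exact hwplus X hX Y hY k (Finset.mem_filter.1 hk).2
    have e2 : (∏ k with Y k = X k + v, M.minusFactor S t a b c (X k)) *
        (∏ k with Y k = X k + v, w (X k)) =
        ∏ k with X k = Y k + v' + 1, κ₀ * u' (Y k) * M.plusNum S' t' d e f (Y k) := by
      rw [← Finset.prod_mul_distrib, ← hplus']
      refine Finset.prod_congr rfl fun k hk => ?_
      exact hwminus X hX Y hY k (Finset.mem_filter.1 hk).2
    rw [← e1, ← e2, hw, phiRatio_eq]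
    field_simp
  rw [h4, Finset.prod_mul_distrib]
  have h5 : ∑ σ, M.phiProd S t (neighbor v' Y σ) *
        ∏ k, (if σ k then M.plusNum S' t' d e f (Y k) else M.minusNum S' t' d e f (Y k)) =
      (M.q ^ ((1 + v') * (M.N.choose 2 : ℕ)))⁻¹ * (M.normDown S' t' d e f *
        ((∏ k, M.θ (M.z S' t' (Y k) ^ 2)) * M.phiProd S' t' Y)) := by
    rw [← h2, inv_mul_cancel_left₀ hqv]
  rw [h5]
  ring

end EllipticModel

end

noncomputable section

namespace EllipticModel

open EllipticTheta Filter Topology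

/-! ### The univariate factors of the Selberg density on neighboring lines -/

/-- The behavior of the factors `n / d` of the density that belong to a parameter `r`, when the
parameter belongs to the matrix that leads from the lower line to the upper line. -/
structure LowerParam (M : EllipticModel) (S t : ℤ) (r : ℂ) (n d n' d' : ℤ → ℂ) (k : ℂ) : Prop where
  num_succ : ∀ x, 0 ≤ x → n' (x + 1) = n x * M.θ (r * M.z S t x)
  num : ∀ x, 0 ≤ x → n' x = n x
  den_succ : ∀ x, 0 ≤ x → d' (x + 1) = k * d x
  den : ∀ x, 0 ≤ x → t + S - M.T < x → d' x * M.θ (M.z S t x / r) = k * d x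

/-- The behavior of the factors `n / d` of the density that belong to a parameter `r`, when the
parameter belongs to the matrix that leads from the upper line to the lower line. -/
structure UpperParam (M : EllipticModel) (S t : ℤ) (r : ℂ) (n d n' d' : ℤ → ℂ) (k : ℂ) : Prop where
  num_succ : ∀ x, 0 ≤ x → n' (x + 1) = k * n x
  num : ∀ x, 0 ≤ x → n' x * M.θ (r * M.z S t x / M.q) = k * n x
  den_succ : ∀ x, 0 ≤ x → d' (x + 1) = d x * M.θ (M.q * M.z S t x / r)
  den : ∀ x, 0 ≤ x → d' x = d x

section Poch

variable (M : EllipticModel)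

lemma poch_succ (a : ℂ) {x : ℤ} (hx : 0 ≤ x) :
    M.poch a (x + 1) = M.poch a x * M.θ (M.q ^ x * a) := by
  obtain ⟨n, rfl⟩ := Int.eq_ofNat_of_zero_le hx
  rw [poch, poch, thetaPoch, thetaPoch, show ((n : ℤ) + 1).toNat = n + 1 by omega,
    Int.toNat_natCast, Finset.prod_range_succ, zpow_natCast]
  rfl

lemma poch_succ' (a : ℂ) {x : ℤ} (hx : 0 ≤ x) :
    M.poch a (x + 1) = M.θ a * M.poch (M.q * a) x := by
  obtain ⟨n, rfl⟩ := Int.eq_ofNat_of_zero_le hx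
  rw [poch, poch, thetaPoch, thetaPoch, show ((n : ℤ) + 1).toNat = n + 1 by omega,
    Int.toNat_natCast, Finset.prod_range_succ', pow_zero, one_mul, mul_comm]
  congr 1
  refine Finset.prod_congr rfl fun i _ => ?_
  rw [pow_succ, mul_assoc]

variable {M} {S t : ℤ}

/-- From the lower to the upper line the numerator argument rF is fixed and the denominator argument
passes from qF/r to F/r. All rules result from splitting off the first or the last factor of a
Pochhammer product. -/
lemma lowerParam_poch {r α β γ : ℂ} (hα : α = r * M.F S t) (hβ : β = M.F S t / r)
    (hγ : γ = M.q * β) :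
    M.LowerParam S t r (M.poch α) (M.poch γ) (M.poch α) (M.poch β) (M.θ β) where
  num_succ x hx := by
    rw [M.poch_succ _ hx, hα, z]
    congr 2
    ring
  num x _ := rfl
  den_succ x hx := by rw [M.poch_succ' _ hx, hγ]
  den x hx _ := by
    rw [hγ, ← M.poch_succ' _ hx, M.poch_succ _ hx, hβ, z]
    congr 2
    ring

/-- Here the denominator argument qF/r is fixed and the numerator argument passes from rF to rF/q.
-/
lemma upperParam_poch {r α β γ : ℂ} (hα : α = r * M.F S t / M.q) (hβ : β = M.q * M.F S t / r)
    (hγ : γ = M.q * α) :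
    M.UpperParam S t r (M.poch γ) (M.poch β) (M.poch α) (M.poch β) (M.θ α) where
  num_succ x hx := by rw [M.poch_succ' _ hx, hγ]
  num x hx := by
    rw [hγ, ← M.poch_succ' _ hx, M.poch_succ _ hx, hα, z]
    congr 2
    ring
  den_succ x hx := by
    rw [M.poch_succ _ hx, hβ, z]
    congr 2
    ring
  den x _ := rfl

/-- The regularized constant `θ(F / A)`. -/
def regConst (M : EllipticModel) (S t : ℤ) : ℂ :=
  if t + S - M.T = 0 then 1 else M.θ (M.q ^ (M.T - t - S))

/-- The omitted index moves by one together with the line, so the first-factor splitting survives,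
with the constant 1 when that first factor is the omitted one. Splitting off the last factor fails
exactly at x = t + S - T, where the last factor is omitted; such an x is not a position on the upper
line. -/
lemma lowerParam_pochReg {α : ℂ} {S' t' : ℤ} (hst : S' + t' = S + t + 1) {r : ℂ}
    (hα : α = r * M.F S t) (hr : M.F S t / r = M.q ^ (M.T - t - S)) :
    M.LowerParam S t r (M.poch α) (M.pochReg S t) (M.poch α) (M.pochReg S' t')
      (M.regConst S t) := by
  have hq := M.q_ne_zero
  have hsucc : ∀ x : ℤ, 0 ≤ x → t + S - M.T ≠ x →
      M.pochReg S' t' (x + 1) = M.pochReg S' t' x * M.θ (M.q ^ (x - (t + S - M.T))) := by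
    intro x hx hne
    obtain ⟨n, rfl⟩ := Int.eq_ofNat_of_zero_le hx
    rw [pochReg, pochReg, show ((n : ℤ) + 1).toNat = n + 1 by omega, Int.toNat_natCast,
      Finset.prod_filter, Finset.prod_filter, Finset.prod_range_succ, if_pos (by omega),
      ← zpow_natCast, ← zpow_add₀ hq]
    congr 3
    omega
  have hsucc' : ∀ x : ℤ, 0 ≤ x →
      M.pochReg S' t' (x + 1) = M.regConst S t * M.pochReg S t x := by
    intro x hx
    obtain ⟨n, rfl⟩ := Int.eq_ofNat_of_zero_le hx
    rw [pochReg, pochReg, show ((n : ℤ) + 1).toNat = n + 1 by omega, Int.toNat_natCast,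
      Finset.prod_filter, Finset.prod_filter, Finset.prod_range_succ', mul_comm]
    congr 1
    · rw [regConst]
      split_ifs with h1 h2 h2
      · omega
      · congr 1
        rw [pow_zero, one_mul]
        congr 1
        omega
      · rfl
      · omega
    · refine Finset.prod_congr rfl fun i _ => ?_
      refine if_congr (by omega) ?_ rfl
      rw [pow_succ, mul_assoc, ← zpow_one_add₀ hq]
      congr 3
      omega
  refine ⟨fun x hx => ?_, fun x _ => rfl, hsucc', fun x hx hlt => ?_⟩
  · rw [M.poch_succ _ hx, hα, z]
    congr 2
    ring
  · rw [← hsucc' x hx, hsucc x hx hlt.ne, z, mul_div_right_comm, hr, ← zpow_add₀ hq]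
    congr 3
    ring

end Poch

/-- The compatibility of two product-form weights on neighboring lines, where `a, b, c` are the
parameters of the matrix from the lower line `(S, t)` to the upper line `(S', t')`, and
`d', e', f'` are those of the reversed matrix. -/
structure LinePair (M : EllipticModel) (S t S' t' : ℤ) (a b c d' e' f' : ℂ)
    (D D' u u' : ℤ → ℂ) (K₁ K₂ : ℂ) : Prop where
  line : S' + t' = S + t + 1
  ha : a ≠ 0
  hb : b ≠ 0
  hc : c ≠ 0
  hd : d' ≠ 0
  he : e' ≠ 0
  hf : f' ≠ 0
  plus : ∀ x ∈ M.positions S t, D x ≠ 0 → D' (x + 1) ≠ 0 →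
    K₁ * (u x * M.plusNum S t a b c x) =
      -(K₂ * M.q ^ (1 - (M.N : ℤ))) * (u' (x + 1) * M.minusNum S' t' d' e' f' (x + 1))
  minus : ∀ x ∈ M.positions S t, x ∈ M.positions S' t' → D x ≠ 0 → D' x ≠ 0 →
    K₁ * (u x * M.minusNum S t a b c x) =
      -(K₂ * M.q ^ (1 - (M.N : ℤ))) * (u' x * M.plusNum S' t' d' e' f' x)
  plus_bdry : ∀ x ∈ M.positions S t, x + 1 ∉ M.positions S' t' → M.plusNum S t a b c x = 0
  minus_bdry : ∀ x ∈ M.positions S t, x ∉ M.positions S' t' → M.minusNum S t a b c x = 0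
  plus_bdry' : ∀ y ∈ M.positions S' t', y ∉ M.positions S t → M.plusNum S' t' d' e' f' y = 0
  minus_bdry' : ∀ y ∈ M.positions S' t', y - 1 ∉ M.positions S t →
    M.minusNum S' t' d' e' f' y = 0

/-! ### Detailed balance for a single particle. -/

section Pair

variable {M : EllipticModel} {S t S' t' : ℤ}

/-- Field algebra with independent letters for the theta values. The lower denominators occur on
both sides as a common factor and need not be nonzero; only the ratio of upper to lower denominators
must be invertible. -/
lemma weight_plus_aux {Q₁ Q₂ Q₃ Q₄ Q₅ ka kb kc kd ke kf na nb nc nd ne nf da db dc dd de df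
    α β γ δ ε ζ η : ℂ} (hQ : Q₁ * Q₂ * Q₃ = Q₄ * Q₅)
    (h : ka * kb * kc * (δ * ε * ζ) ≠ 0) :
    kd * ke * kf * ((Q₄ * (na * nb * nc * nd * ne * nf) / (da * db * dc * dd * de * df)) *
        -(Q₅ * (α * β * γ * η))) =
      -(ka * kb * kc * Q₁) * ((Q₂ * (na * α * (nb * β) * (nc * γ) * (kd * nd) * (ke * ne) *
        (kf * nf)) / (ka * da * (kb * db) * (kc * dc) * (dd * δ) * (de * ε) * (df * ζ))) *
        (Q₃ * (δ * ε * ζ * η))) := by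
  rw [show ka * da * (kb * db) * (kc * dc) * (dd * δ) * (de * ε) * (df * ζ) =
    da * db * dc * dd * de * df * (ka * kb * kc * (δ * ε * ζ)) by ring]
  generalize da * db * dc * dd * de * df = Δ
  generalize hP : na * α * (nb * β) * (nc * γ) * (kd * nd) * (ke * ne) * (kf * nf) = P
  generalize hK : ka * kb * kc = K at h ⊢
  generalize hH : δ * ε * ζ = H at h ⊢
  rw [← div_div, show -(K * Q₁) * (Q₂ * P / Δ / (K * H) * (Q₃ * (H * η))) =
    (-(Q₁ * Q₂ * Q₃) * (P / Δ) * η) / (K * H) * (K * H) by ring, div_mul_cancel₀ _ h, hQ, ← hP]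
  ring

/-- Detailed balance for a particle that moves from x to x + 1. Since z' = √q z, dividing d, e, f by
√q makes θ(z'/d') equal to θ(qz/d), the growth factor of the upper denominators; θ(az), θ(bz), θ(cz)
are the growth factors of the numerators. The fourth theta factors of the two matrices coincide
because of `hprod`. -/
lemma weight_plus {a b c d e f : ℂ} (ha : a ≠ 0) (hb : b ≠ 0) (hc : c ≠ 0) (hd : d ≠ 0)
    (he : e ≠ 0) (hf : f ≠ 0) (hline : S' + t' = S + t + 1)
    (hprod : a * b * c * (d * e * f) = M.q ^ (3 - 2 * (M.N : ℤ)))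
    {na da na' da' nb db nb' db' nc dc nc' dc' nd dd nd' dd' ne de ne' de' nf df nf' df' : ℤ → ℂ}
    {ka kb kc kd ke kf : ℂ}
    (Ha : M.LowerParam S t a na da na' da' ka) (Hb : M.LowerParam S t b nb db nb' db' kb)
    (Hc : M.LowerParam S t c nc dc nc' dc' kc) (Hd : M.UpperParam S t d nd dd nd' dd' kd)
    (He : M.UpperParam S t e ne de ne' de' ke) (Hf : M.UpperParam S t f nf df nf' df' kf)
    {x : ℤ} (hx : 0 ≤ x)
    (hD' : da' (x + 1) * db' (x + 1) * dc' (x + 1) * dd' (x + 1) * de' (x + 1) * df' (x + 1) ≠ 0) :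
    kd * ke * kf * ((M.q ^ ((2 * (M.N : ℤ) - 1) * x) *
        (na x * nb x * nc x * nd x * ne x * nf x) / (da x * db x * dc x * dd x * de x * df x)) *
        M.plusNum S t a b c x) =
      -(ka * kb * kc * M.q ^ (1 - (M.N : ℤ))) * ((M.q ^ ((2 * (M.N : ℤ) - 1) * (x + 1)) *
        (na' (x + 1) * nb' (x + 1) * nc' (x + 1) * nd' (x + 1) * ne' (x + 1) * nf' (x + 1)) /
        (da' (x + 1) * db' (x + 1) * dc' (x + 1) * dd' (x + 1) * de' (x + 1) * df' (x + 1))) *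
        M.minusNum S' t' (d / M.sq) (e / M.sq) (f / M.sq) (x + 1)) := by
  have hq := M.q_ne_zero
  have hs := M.sq_ne_zero
  have hz := M.z_ne_zero S t x
  have hz' : M.z S' t' (x + 1) = M.sq * M.z S t x := by
    simpa [halfStep] using M.z_step (v := 0) (by simpa using hline) x true
  have hs2 : M.sq * M.sq = M.q := (pow_two _).symm
  rw [Ha.num_succ x hx, Hb.num_succ x hx, Hc.num_succ x hx, Hd.num_succ x hx, He.num_succ x hx,
    Hf.num_succ x hx]
  rw [Ha.den_succ x hx, Hb.den_succ x hx, Hc.den_succ x hx, Hd.den_succ x hx, He.den_succ x hx,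
    Hf.den_succ x hx] at hD' ⊢
  rw [plusNum, minusNum, hz']
  have harg : ∀ r : ℂ, r ≠ 0 → M.sq * M.z S t x / (r / M.sq) = M.q * M.z S t x / r := by
    intro r hr
    rw [← hs2]
    field_simp
  have hfour : M.q ^ ((M.N : ℤ) - 1) * (M.sq * M.z S t x) * (d / M.sq * (e / M.sq) * (f / M.sq)) =
      M.q ^ (1 - (M.N : ℤ)) * M.z S t x / (a * b * c) := by
    have e1 : d * e * f = M.q ^ (3 - 2 * (M.N : ℤ)) / (a * b * c) := by
      rw [eq_div_iff (mul_ne_zero (mul_ne_zero ha hb) hc), mul_comm, hprod]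
    have e2 : M.q ^ (3 - 2 * (M.N : ℤ)) =
        M.q ^ (1 - (M.N : ℤ)) * M.q ^ (1 - (M.N : ℤ)) * M.q := by
      rw [← zpow_add₀ hq, ← zpow_add_one₀ hq]
      ring_nf
    have e3 : M.q ^ ((M.N : ℤ) - 1) = (M.q ^ (1 - (M.N : ℤ)))⁻¹ := by rw [← zpow_neg, neg_sub]
    have e4 := zpow_ne_zero (1 - (M.N : ℤ)) hq
    rw [show M.q ^ ((M.N : ℤ) - 1) * (M.sq * M.z S t x) * (d / M.sq * (e / M.sq) * (f / M.sq)) =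
      M.q ^ ((M.N : ℤ) - 1) * M.z S t x * (d * e * f) / (M.sq * M.sq) by field_simp, e1, e2, e3, hs2]
    field_simp
  rw [harg d hd, harg e he, harg f hf, hfour]
  have hpow : M.q ^ (1 - (M.N : ℤ)) * M.q ^ ((2 * (M.N : ℤ) - 1) * (x + 1)) *
      M.q ^ (-(x + 1) - (M.N : ℤ) + 1) = M.q ^ ((2 * (M.N : ℤ) - 1) * x) * M.q ^ (-x) := by
    rw [← zpow_add₀ hq, ← zpow_add₀ hq, ← zpow_add₀ hq]
    congr 1
    ring
  exact weight_plus_aux hpow fun h0 => hD' (by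
    linear_combination (da x * db x * dc x * dd x * de x * df x) * h0)

/-- Detailed balance for a particle that keeps its position. Now θ(z/a), θ(z/b), θ(z/c) compare the
denominators of the two lines, so both have to be nonzero; `hxT` avoids the omitted factor. -/
lemma weight_minus {a b c d e f : ℂ} (hline : S' + t' = S + t + 1)
    (hprod : a * b * c * (d * e * f) = M.q ^ (3 - 2 * (M.N : ℤ)))
    {na da na' da' nb db nb' db' nc dc nc' dc' nd dd nd' dd' ne de ne' de' nf df nf' df' : ℤ → ℂ}
    {ka kb kc kd ke kf : ℂ}
    (Ha : M.LowerParam S t a na da na' da' ka) (Hb : M.LowerParam S t b nb db nb' db' kb)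
    (Hc : M.LowerParam S t c nc dc nc' dc' kc) (Hd : M.UpperParam S t d nd dd nd' dd' kd)
    (He : M.UpperParam S t e ne de ne' de' ke) (Hf : M.UpperParam S t f nf df nf' df' kf)
    {x : ℤ} (hx : 0 ≤ x) (hxT : t + S - M.T < x)
    (hD : da x * db x * dc x * dd x * de x * df x ≠ 0)
    (hD' : da' x * db' x * dc' x * dd' x * de' x * df' x ≠ 0) :
    kd * ke * kf * ((M.q ^ ((2 * (M.N : ℤ) - 1) * x) *
        (na x * nb x * nc x * nd x * ne x * nf x) / (da x * db x * dc x * dd x * de x * df x)) *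
        M.minusNum S t a b c x) =
      -(ka * kb * kc * M.q ^ (1 - (M.N : ℤ))) * ((M.q ^ ((2 * (M.N : ℤ) - 1) * x) *
        (na' x * nb' x * nc' x * nd' x * ne' x * nf' x) /
        (da' x * db' x * dc' x * dd' x * de' x * df' x)) *
        M.plusNum S' t' (d / M.sq) (e / M.sq) (f / M.sq) x) := by
  have hq := M.q_ne_zero
  have hs := M.sq_ne_zero
  have hz := M.z_ne_zero S t x
  have hz' : M.z S' t' x = M.sq⁻¹ * M.z S t x := by
    simpa [halfStep] using M.z_step (v := 0) (by simpa using hline) x false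
  have hs2 : M.sq * M.sq = M.q := (pow_two _).symm
  have hqN := zpow_ne_zero (1 - (M.N : ℤ)) hq
  have hdef : d * e * f ≠ 0 := by
    intro h0
    rw [h0, mul_zero] at hprod
    exact zpow_ne_zero _ hq hprod.symm
  rw [Ha.num x hx, Hb.num x hx, Hc.num x hx]
  rw [Hd.den x hx, He.den x hx, Hf.den x hx] at hD' ⊢
  rw [plusNum, minusNum, hz']
  have harg : ∀ r : ℂ, r / M.sq * (M.sq⁻¹ * M.z S t x) = r * M.z S t x / M.q := by
    intro r
    rw [← hs2]
    field_simp
  have hfour : M.q ^ (1 - (M.N : ℤ)) * (M.sq⁻¹ * M.z S t x) /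
      (d / M.sq * (e / M.sq) * (f / M.sq)) =
      M.q ^ ((M.N : ℤ) - 1) * M.z S t x * (a * b * c) := by
    have e1 : a * b * c = M.q ^ (3 - 2 * (M.N : ℤ)) / (d * e * f) := by
      rw [eq_div_iff hdef, hprod]
    have e2 : M.q ^ (3 - 2 * (M.N : ℤ)) =
        M.q ^ (1 - (M.N : ℤ)) * M.q ^ (1 - (M.N : ℤ)) * M.q := by
      rw [← zpow_add₀ hq, ← zpow_add_one₀ hq]
      ring_nf
    have e3 : M.q ^ ((M.N : ℤ) - 1) = (M.q ^ (1 - (M.N : ℤ)))⁻¹ := by rw [← zpow_neg, neg_sub]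
    rw [show d / M.sq * (e / M.sq) * (f / M.sq) = d * e * f / (M.sq * M.q) by
      rw [← hs2]; field_simp, e1, e2, e3]
    field_simp
  rw [harg d, harg e, harg f, hfour]
  have a1 := Ha.den x hx hxT
  have a2 := Hb.den x hx hxT
  have a3 := Hc.den x hx hxT
  have b1 := Hd.num x hx
  have b2 := He.num x hx
  have b3 := Hf.num x hx
  have hpow : M.q ^ (-x - (M.N : ℤ) + 1) = M.q ^ (1 - (M.N : ℤ)) * M.q ^ (-x) := by
    rw [← zpow_add₀ hq]
    congr 1
    ring
  rw [hpow]
  generalize M.θ (M.q ^ ((M.N : ℤ) - 1) * M.z S t x * (a * b * c)) = θ₄ at *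
  generalize M.q ^ (1 - (M.N : ℤ)) = Q₁ at *
  generalize M.q ^ ((2 * (M.N : ℤ) - 1) * x) = Q₄ at *
  generalize M.q ^ (-x) = Q₅ at *
  rw [show kd * ke * kf * (Q₄ * (na x * nb x * nc x * nd x * ne x * nf x) /
      (da x * db x * dc x * dd x * de x * df x) * (Q₁ * Q₅ *
        (M.θ (M.z S t x / a) * M.θ (M.z S t x / b) * M.θ (M.z S t x / c) * θ₄))) =
    Q₄ * Q₁ * Q₅ * θ₄ * (na x * nb x * nc x) * ((kd * nd x) * (ke * ne x) * (kf * nf x)) *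
      ((M.θ (M.z S t x / a) * M.θ (M.z S t x / b) * M.θ (M.z S t x / c)) /
        (da x * db x * dc x * dd x * de x * df x)) by ring, ← b1, ← b2, ← b3]
  have hfrac : (M.θ (M.z S t x / a) * M.θ (M.z S t x / b) * M.θ (M.z S t x / c)) /
        (da x * db x * dc x * dd x * de x * df x) =
      ka * kb * kc / (da' x * db' x * dc' x * dd x * de x * df x) := by
    rw [div_eq_div_iff hD hD']
    calc _ = (da' x * M.θ (M.z S t x / a)) * (db' x * M.θ (M.z S t x / b)) *
          (dc' x * M.θ (M.z S t x / c)) * (dd x * de x * df x) := by ring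
      _ = _ := by rw [a1, a2, a3]; ring
  rw [hfrac]
  ring

end Pair

end EllipticModel

end

noncomputable section

namespace EllipticModel

open EllipticTheta Filter Topology

/-! ### The six parameters on a line -/

section Parameters

variable (M : EllipticModel) (S t : ℤ)

lemma A_ne_zero : M.A S t ≠ 0 :=
  mul_ne_zero (zpow_ne_zero _ M.sq_ne_zero) (mul_ne_zero M.sv₁_ne_zero M.sv₂_ne_zero)

lemma B_ne_zero : M.B S t ≠ 0 :=
  mul_ne_zero (zpow_ne_zero _ M.sq_ne_zero) (div_ne_zero M.sv₂_ne_zero M.sv₁_ne_zero)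

lemma C_ne_zero : M.C S t ≠ 0 :=
  div_ne_zero (zpow_ne_zero _ M.sq_ne_zero) (mul_ne_zero M.sv₁_ne_zero M.sv₂_ne_zero)

lemma D_ne_zero : M.D S t ≠ 0 :=
  div_ne_zero (zpow_ne_zero _ M.sq_ne_zero) (mul_ne_zero M.sv₁_ne_zero M.sv₂_ne_zero)

lemma E_ne_zero : M.E S t ≠ 0 :=
  mul_ne_zero (zpow_ne_zero _ M.sq_ne_zero) (div_ne_zero M.sv₁_ne_zero M.sv₂_ne_zero)

/-- The balancing condition behind detailed balance: it is symmetric in the six parameters, so any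
split into two triples satisfies it. -/
lemma param_prod : M.A S t * M.B S t * M.C S t * (M.D S t * M.E S t * M.F S t) =
    M.q ^ (3 - 2 * (M.N : ℤ)) := by
  have h1 := M.sv₁_ne_zero
  have h2 := M.sv₂_ne_zero
  rw [← sq_zpow_two_mul, show 2 * (3 - 2 * (M.N : ℤ)) = (t + S - 2 * M.T + 1) +
    (t + S + 2 * M.T + 1) + (t - S - 2 * M.N + 1) + (-t + S - 2 * M.N + 1) + (-t - S + 1) +
    (-t - S + 1) by ring, zpow_add₀ M.sq_ne_zero, zpow_add₀ M.sq_ne_zero, zpow_add₀ M.sq_ne_zero,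
    zpow_add₀ M.sq_ne_zero, zpow_add₀ M.sq_ne_zero]
  unfold A B C D E F
  generalize M.sq ^ (t + S - 2 * M.T + 1) = a₁
  generalize M.sq ^ (t + S + 2 * M.T + 1) = a₂
  generalize M.sq ^ (t - S - 2 * M.N + 1) = a₃
  generalize M.sq ^ (-t + S - 2 * M.N + 1) = a₄
  generalize M.sq ^ (-t - S + 1) = a₅
  field_simp

/-- Over the six parameters r, the products rF are the numerator arguments of the Selberg density
and the quotients qF/r its denominator arguments. This and the following formulas assign one
numerator and one denominator to each parameter. -/
lemma A_mul_F : M.A S t * M.F S t = M.q ^ (1 - (M.T : ℤ)) * M.v₁ * M.v₂ := by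
  rw [← sq_zpow_two_mul, show 2 * (1 - (M.T : ℤ)) = (t + S - 2 * M.T + 1) + (-t - S + 1) by ring,
    zpow_add₀ M.sq_ne_zero]
  unfold A F v₁ v₂
  ring

lemma B_mul_F : M.B S t * M.F S t = M.q ^ (1 + (M.T : ℤ)) * M.v₂ := by
  have h1 := M.sv₁_ne_zero
  rw [← sq_zpow_two_mul, show 2 * (1 + (M.T : ℤ)) = (t + S + 2 * M.T + 1) + (-t - S + 1) by ring,
    zpow_add₀ M.sq_ne_zero]
  unfold B F v₂
  field_simp

lemma C_mul_F : M.C S t * M.F S t = M.q ^ (1 - (M.N : ℤ) - S) := by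
  have h1 := M.sv₁_ne_zero
  have h2 := M.sv₂_ne_zero
  rw [← sq_zpow_two_mul, show 2 * (1 - (M.N : ℤ) - S) = (t - S - 2 * M.N + 1) + (-t - S + 1) by
    ring, zpow_add₀ M.sq_ne_zero]
  unfold C F
  field_simp

lemma D_mul_F : M.D S t * M.F S t = M.q ^ (1 - (M.N : ℤ) - t) := by
  have h1 := M.sv₁_ne_zero
  have h2 := M.sv₂_ne_zero
  rw [← sq_zpow_two_mul, show 2 * (1 - (M.N : ℤ) - t) = (-t + S - 2 * M.N + 1) + (-t - S + 1) by
    ring, zpow_add₀ M.sq_ne_zero]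
  unfold D F
  field_simp

lemma E_mul_F : M.E S t * M.F S t = M.q ^ (1 - t - S) * M.v₁ := by
  have h2 := M.sv₂_ne_zero
  rw [← sq_zpow_two_mul, show 2 * (1 - t - S) = (-t - S + 1) + (-t - S + 1) by
    ring, zpow_add₀ M.sq_ne_zero]
  unfold E F v₁
  field_simp

lemma F_mul_F : M.F S t * M.F S t = M.q ^ (1 - t - S) * M.v₁ * M.v₂ := by
  rw [← sq_zpow_two_mul, show 2 * (1 - t - S) = (-t - S + 1) + (-t - S + 1) by
    ring, zpow_add₀ M.sq_ne_zero]
  unfold F v₁ v₂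
  ring

lemma F_div_A : M.F S t / M.A S t = M.q ^ ((M.T : ℤ) - t - S) := by
  rw [div_eq_iff (M.A_ne_zero S t), ← sq_zpow_two_mul, A, ← mul_assoc, ← zpow_add₀ M.sq_ne_zero, F]
  ring_nf

lemma F_div_B : M.F S t / M.B S t = M.q ^ (-t - (M.T : ℤ) - S) * M.v₁ := by
  have h1 := M.sv₁_ne_zero
  have h : M.sq ^ (-t - S + 1) = M.sq ^ (2 * (-t - (M.T : ℤ) - S)) *
      M.sq ^ (t + S + 2 * M.T + 1) := by
    rw [← zpow_add₀ M.sq_ne_zero]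
    ring_nf
  rw [div_eq_iff (M.B_ne_zero S t), ← sq_zpow_two_mul, B, F, h, v₁]
  field_simp

lemma F_div_C : M.F S t / M.C S t = M.q ^ ((M.N : ℤ) - t) * M.v₁ * M.v₂ := by
  have h1 := M.sv₁_ne_zero
  have h2 := M.sv₂_ne_zero
  have h : M.sq ^ (-t - S + 1) = M.sq ^ (2 * ((M.N : ℤ) - t)) *
      M.sq ^ (t - S - 2 * M.N + 1) := by
    rw [← zpow_add₀ M.sq_ne_zero]
    ring_nf
  rw [div_eq_iff (M.C_ne_zero S t), ← sq_zpow_two_mul, C, F, h, v₁, v₂]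
  field_simp

lemma F_div_D : M.F S t / M.D S t = M.q ^ ((M.N : ℤ) - S) * M.v₁ * M.v₂ := by
  have h1 := M.sv₁_ne_zero
  have h2 := M.sv₂_ne_zero
  have h : M.sq ^ (-t - S + 1) = M.sq ^ (2 * ((M.N : ℤ) - S)) *
      M.sq ^ (-t + S - 2 * M.N + 1) := by
    rw [← zpow_add₀ M.sq_ne_zero]
    ring_nf
  rw [div_eq_iff (M.D_ne_zero S t), ← sq_zpow_two_mul, D, F, h, v₁, v₂]
  field_simp

lemma F_div_E : M.F S t / M.E S t = M.v₂ := by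
  have h1 := M.sv₁_ne_zero
  have h2 := M.sv₂_ne_zero
  rw [div_eq_iff (M.E_ne_zero S t), E, F, v₂]
  field_simp

/-- The quantities z/A, z/F, Cz, Dz are powers of q with exponent zero at x = t + S - T, 0, S + N -
1, t + N - 1, the bounds defining the interval of positions. The zeros of θ there forbid the moves
that would leave the target line. -/
lemma z_div_A (x : ℤ) : M.z S t x / M.A S t = M.q ^ (x - (t + S - M.T)) := by
  rw [z, mul_div_right_comm, F_div_A, ← zpow_add₀ M.q_ne_zero]
  ring_nf

lemma z_div_F (x : ℤ) : M.z S t x / M.F S t = M.q ^ x := by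
  rw [z, mul_div_cancel_left₀ _ (M.F_ne_zero S t)]

lemma C_mul_z (x : ℤ) : M.C S t * M.z S t x = M.q ^ (x - (S + M.N - 1)) := by
  rw [z, ← mul_assoc, C_mul_F, ← zpow_add₀ M.q_ne_zero]
  ring_nf

lemma D_mul_z (x : ℤ) : M.D S t * M.z S t x = M.q ^ (x - (t + M.N - 1)) := by
  rw [z, ← mul_assoc, D_mul_F, ← zpow_add₀ M.q_ne_zero]
  ring_nf

lemma C_succ_S : M.C (S + 1) t = M.C S t / M.sq := by
  rw [C, C, show t - (S + 1) - 2 * M.N + 1 = (t - S - 2 * M.N + 1) - 1 by ring,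
    zpow_sub_one₀ M.sq_ne_zero]
  ring

lemma D_succ_t : M.D S (t + 1) = M.D S t / M.sq := by
  rw [D, D, show -(t + 1) + S - 2 * M.N + 1 = (-t + S - 2 * M.N + 1) - 1 by ring,
    zpow_sub_one₀ M.sq_ne_zero]
  ring

lemma E_succ_S : M.E (S + 1) t = M.E S t / M.sq := by
  rw [E, E, show -t - (S + 1) + 1 = (-t - S + 1) - 1 by ring, zpow_sub_one₀ M.sq_ne_zero]
  ring

lemma E_succ_t : M.E S (t + 1) = M.E S t / M.sq := by
  rw [E, E, show -(t + 1) - S + 1 = (-t - S + 1) - 1 by ring, zpow_sub_one₀ M.sq_ne_zero]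
  ring

lemma F_succ_S : M.F (S + 1) t = M.F S t / M.sq := by
  rw [F, F, show -t - (S + 1) + 1 = (-t - S + 1) - 1 by ring, zpow_sub_one₀ M.sq_ne_zero]
  ring

lemma F_succ_t : M.F S (t + 1) = M.F S t / M.sq := by
  rw [F, F, show -(t + 1) - S + 1 = (-t - S + 1) - 1 by ring, zpow_sub_one₀ M.sq_ne_zero]
  ring

lemma plusNum_eq_zero {a b c : ℂ} {x : ℤ} (h : M.θ (a * M.z S t x) = 0 ∨
    M.θ (b * M.z S t x) = 0 ∨ M.θ (c * M.z S t x) = 0) : M.plusNum S t a b c x = 0 := by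
  rw [plusNum]
  rcases h with h | h | h <;> rw [h] <;> ring

lemma minusNum_eq_zero {a b c : ℂ} {x : ℤ} (h : M.θ (M.z S t x / a) = 0 ∨
    M.θ (M.z S t x / b) = 0 ∨ M.θ (M.z S t x / c) = 0) : M.minusNum S t a b c x = 0 := by
  rw [minusNum]
  rcases h with h | h | h <;> rw [h] <;> ring

end Parameters

/-! ### Shifted models -/

section Shift

variable (M : EllipticModel) (n S t : ℤ)

lemma shift_sv_mul : (M.shift n).sv₁ * (M.shift n).sv₂ = M.sv₁ * M.sv₂ := by
  change M.sq ^ n * M.sv₁ * (M.sq ^ (-n) * M.sv₂) = _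
  have := zpow_ne_zero n M.sq_ne_zero
  rw [zpow_neg]
  field_simp

lemma shift_v₁ : (M.shift n).v₁ = M.q ^ n * M.v₁ := by
  rw [← sq_zpow_two_mul, two_mul, zpow_add₀ M.sq_ne_zero]
  change (M.sq ^ n * M.sv₁) ^ 2 = _
  rw [v₁]
  ring

lemma shift_v₂ : (M.shift n).v₂ = M.q ^ (-n) * M.v₂ := by
  rw [← sq_zpow_two_mul, two_mul, zpow_add₀ M.sq_ne_zero]
  change (M.sq ^ (-n) * M.sv₂) ^ 2 = _
  rw [v₂]
  ring

lemma shift_v₁_mul_v₂ : (M.shift n).v₁ * (M.shift n).v₂ = M.v₁ * M.v₂ := by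
  have := congrArg (fun x => x ^ 2) (M.shift_sv_mul n)
  simp only [mul_pow] at this
  exact this

lemma shift_A : (M.shift n).A S t = M.A S t := by
  rw [A, shift_sv_mul]
  rfl

lemma shift_C : (M.shift n).C S t = M.C S t := by
  rw [C, shift_sv_mul]
  rfl

lemma shift_D : (M.shift n).D S t = M.D S t := by
  rw [D, shift_sv_mul]
  rfl

lemma shift_F : (M.shift n).F S t = M.F S t := by
  rw [F, shift_sv_mul]
  rfl

lemma shift_z (x : ℤ) : (M.shift n).z S t x = M.z S t x := by
  rw [z, shift_F]
  rfl

lemma shift_phi (x y : ℤ) : (M.shift n).phi S t x y = M.phi S t x y := by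
  rw [phi, mul_assoc _ (M.shift n).v₁, shift_v₁_mul_v₂, phi, mul_assoc _ M.v₁]
  rfl

lemma shift_plusNum (a b c : ℂ) (x : ℤ) :
    (M.shift n).plusNum S t a b c x = M.plusNum S t a b c x := by
  rw [plusNum, shift_z]
  rfl

lemma shift_minusNum (a b c : ℂ) (x : ℤ) :
    (M.shift n).minusNum S t a b c x = M.minusNum S t a b c x := by
  rw [minusNum, shift_z]
  rfl

/-- Passing to S + 1 multiplies B by √q, whereas a parameter of a reversed matrix must be divided by
√q. Replacing (v₁, v₂) by (qv₁, v₂/q) corrects this; it is why these two transports change the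
parameters of the measure. -/
lemma shift_B_succ_S : (M.shift 1).B (S + 1) t = M.B S t / M.sq := by
  have hs := M.sq_ne_zero
  have h1 := M.sv₁_ne_zero
  rw [B, B]
  change M.sq ^ (t + (S + 1) + 2 * M.T + 1) * (M.sq ^ (-1 : ℤ) * M.sv₂ / (M.sq ^ (1 : ℤ) * M.sv₁)) = _
  rw [show t + (S + 1) + 2 * M.T + 1 = (t + S + 2 * M.T + 1) + 1 by ring, zpow_add_one₀ hs,
    zpow_one, zpow_neg_one]
  field_simp

lemma shift_shift (m : ℤ) (h : m + n = 0) : (M.shift m).shift n = M := by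
  have hs := M.sq_ne_zero
  obtain ⟨p, sq, sv₁, sv₂, N, T, hp, h0, h1, h2⟩ := M
  simp only [shift, mk.injEq, true_and, and_true, ← mul_assoc]
  rw [← zpow_add₀ h0, ← zpow_add₀ h0, show n + m = 0 by omega, show -n + -m = 0 by omega]
  simp

lemma shift_zero : M.shift 0 = M := by
  obtain ⟨p, sq, sv₁, sv₂, N, T, hp, h0, h1, h2⟩ := M
  simp [shift]

end Shift

end EllipticModel

end

noncomputable section

namespace EllipticModel

open EllipticTheta Filter Topology

/-! ### The three pairs of mutually reversed matrices -/

/-- The univariate factor of the Selberg density without `θ(z²)`. -/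
def density (M : EllipticModel) (S t x : ℤ) : ℂ :=
  M.q ^ ((2 * (M.N : ℤ) - 1) * x) *
    (M.poch (M.q ^ (1 - (M.N : ℤ) - t)) x * M.poch (M.q ^ (1 - (M.N : ℤ) - S)) x *
      M.poch (M.q ^ (1 - t - S) * M.v₁) x * M.poch (M.q ^ (1 + (M.T : ℤ)) * M.v₂) x *
      M.poch (M.q ^ (1 - (M.T : ℤ)) * M.v₁ * M.v₂) x *
      M.poch (M.q ^ (1 - t - S) * M.v₁ * M.v₂) x) / M.uniDen S t x

lemma uniNum_div_uniDen (M : EllipticModel) (S t x : ℤ) :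
    M.uniNum S t x / M.uniDen S t x = M.density S t x * M.θ (M.z S t x ^ 2) := by
  rw [z_sq, density, uniNum]
  ring

section Pairs

variable {M : EllipticModel} {S t S' t' : ℤ}

/-- A split of the six parameters into a triple leading up and a triple which, divided by √q, leads
back gives a line pair, once the boundary zeros are known. -/
lemma linePair_of_params {a b c d e f d' e' f' : ℂ} (ha : a ≠ 0) (hb : b ≠ 0) (hc : c ≠ 0)
    (hd : d ≠ 0) (he : e ≠ 0) (hf : f ≠ 0) (hd' : d' = d / M.sq) (he' : e' = e / M.sq)
    (hf' : f' = f / M.sq) (hline : S' + t' = S + t + 1)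
    (hprod : a * b * c * (d * e * f) = M.q ^ (3 - 2 * (M.N : ℤ)))
    {na da na' da' nb db nb' db' nc dc nc' dc' nd dd nd' dd' ne de ne' de' nf df nf' df' : ℤ → ℂ}
    {ka kb kc kd ke kf : ℂ}
    (Ha : M.LowerParam S t a na da na' da' ka) (Hb : M.LowerParam S t b nb db nb' db' kb)
    (Hc : M.LowerParam S t c nc dc nc' dc' kc) (Hd : M.UpperParam S t d nd dd nd' dd' kd)
    (He : M.UpperParam S t e ne de ne' de' ke) (Hf : M.UpperParam S t f nf df nf' df' kf)
    {D D' u u' : ℤ → ℂ}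
    (hD : ∀ x, D x = da x * db x * dc x * dd x * de x * df x)
    (hD' : ∀ x, D' x = da' x * db' x * dc' x * dd' x * de' x * df' x)
    (hu : ∀ x, u x = M.q ^ ((2 * (M.N : ℤ) - 1) * x) *
      (na x * nb x * nc x * nd x * ne x * nf x) / D x)
    (hu' : ∀ x, u' x = M.q ^ ((2 * (M.N : ℤ) - 1) * x) *
      (na' x * nb' x * nc' x * nd' x * ne' x * nf' x) / D' x)
    (plus_bdry : ∀ x ∈ M.positions S t, x + 1 ∉ M.positions S' t' → M.plusNum S t a b c x = 0)
    (minus_bdry : ∀ x ∈ M.positions S t, x ∉ M.positions S' t' → M.minusNum S t a b c x = 0)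
    (plus_bdry' : ∀ y ∈ M.positions S' t', y ∉ M.positions S t →
      M.plusNum S' t' d' e' f' y = 0)
    (minus_bdry' : ∀ y ∈ M.positions S' t', y - 1 ∉ M.positions S t →
      M.minusNum S' t' d' e' f' y = 0) :
    LinePair M S t S' t' a b c d' e' f' D D' u u' (kd * ke * kf) (ka * kb * kc) where
  line := hline
  ha := ha
  hb := hb
  hc := hc
  hd := by rw [hd']; exact div_ne_zero hd M.sq_ne_zero
  he := by rw [he']; exact div_ne_zero he M.sq_ne_zero
  hf := by rw [hf']; exact div_ne_zero hf M.sq_ne_zero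
  plus x hx _ h' := by
    rw [hu, hu', hd', he', hf', hD, hD']
    rw [hD'] at h'
    rw [positions, Finset.mem_Icc] at hx
    exact weight_plus ha hb hc hd he hf hline hprod Ha Hb Hc Hd He Hf (by omega) h'
  minus x hx hx' h h' := by
    rw [hu, hu', hd', he', hf', hD, hD']
    rw [hD'] at h'
    rw [hD] at h
    rw [positions, Finset.mem_Icc] at hx hx'
    exact weight_minus hline hprod Ha Hb Hc Hd He Hf (by omega) (by omega) h h'
  plus_bdry := plus_bdry
  minus_bdry := minus_bdry
  plus_bdry' := plus_bdry'
  minus_bdry' := minus_bdry'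

variable {m : ℤ}

lemma q_zpow_eq (h : m + 1 = t) : M.q ^ t = M.q * M.q ^ m := by
  rw [← h, zpow_add_one₀ M.q_ne_zero, mul_comm]

lemma q_zpow_eq_div (h : m + 1 = t) : M.q ^ m = M.q ^ t / M.q := by
  rw [← h, zpow_add_one₀ M.q_ne_zero, mul_div_cancel_right₀ _ M.q_ne_zero]

lemma lowerParam_A (hst : S' + t' = S + t + 1) :
    M.LowerParam S t (M.A S t) (M.poch (M.q ^ (1 - (M.T : ℤ)) * M.v₁ * M.v₂)) (M.pochReg S t)
      (M.poch (M.q ^ (1 - (M.T : ℤ)) * M.v₁ * M.v₂)) (M.pochReg S' t') (M.regConst S t) :=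
  lowerParam_pochReg hst (M.A_mul_F S t).symm (M.F_div_A S t)

/-- In this lemma and those below with a hypothesis `hm`, m stands for the exponent on the
neighboring line, in whichever form it arises there. -/
lemma lowerParam_B (hm : m + 1 = 1 - t - M.T - S) :
    M.LowerParam S t (M.B S t) (M.poch (M.q ^ (1 + (M.T : ℤ)) * M.v₂))
      (M.poch (M.q ^ (1 - t - (M.T : ℤ) - S) * M.v₁)) (M.poch (M.q ^ (1 + (M.T : ℤ)) * M.v₂))
      (M.poch (M.q ^ m * M.v₁)) (M.θ (M.q ^ m * M.v₁)) :=
  lowerParam_poch (M.B_mul_F S t).symm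
    (by rw [F_div_B, show m = -t - M.T - S by omega]) (by rw [q_zpow_eq hm, mul_assoc])

lemma lowerParam_C (hm : m + 1 = 1 + M.N - t) :
    M.LowerParam S t (M.C S t) (M.poch (M.q ^ (1 - (M.N : ℤ) - S)))
      (M.poch (M.q ^ (1 + (M.N : ℤ) - t) * M.v₁ * M.v₂)) (M.poch (M.q ^ (1 - (M.N : ℤ) - S)))
      (M.poch (M.q ^ m * M.v₁ * M.v₂)) (M.θ (M.q ^ m * M.v₁ * M.v₂)) :=
  lowerParam_poch (M.C_mul_F S t).symm
    (by rw [F_div_C, show m = M.N - t by omega]) (by rw [q_zpow_eq hm, mul_assoc, mul_assoc,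
      mul_assoc])

lemma lowerParam_D (hm : m + 1 = 1 + M.N - S) :
    M.LowerParam S t (M.D S t) (M.poch (M.q ^ (1 - (M.N : ℤ) - t)))
      (M.poch (M.q ^ (1 + (M.N : ℤ) - S) * M.v₁ * M.v₂)) (M.poch (M.q ^ (1 - (M.N : ℤ) - t)))
      (M.poch (M.q ^ m * M.v₁ * M.v₂)) (M.θ (M.q ^ m * M.v₁ * M.v₂)) :=
  lowerParam_poch (M.D_mul_F S t).symm
    (by rw [F_div_D, show m = M.N - S by omega]) (by rw [q_zpow_eq hm, mul_assoc, mul_assoc,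
      mul_assoc])

lemma lowerParam_E :
    M.LowerParam S t (M.E S t) (M.poch (M.q ^ (1 - t - S) * M.v₁)) (M.poch (M.q * M.v₂))
      (M.poch (M.q ^ (1 - t - S) * M.v₁)) (M.poch M.v₂) (M.θ M.v₂) :=
  lowerParam_poch (M.E_mul_F S t).symm (M.F_div_E S t).symm rfl

lemma upperParam_B :
    M.UpperParam S t (M.B S t) (M.poch (M.q ^ (1 + (M.T : ℤ)) * M.v₂))
      (M.poch (M.q ^ (1 - t - (M.T : ℤ) - S) * M.v₁)) (M.poch (M.q ^ (M.T : ℤ) * M.v₂))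
      (M.poch (M.q ^ (1 - t - (M.T : ℤ) - S) * M.v₁)) (M.θ (M.q ^ (M.T : ℤ) * M.v₂)) :=
  upperParam_poch (by rw [B_mul_F, q_zpow_eq_div (add_comm _ _), div_mul_eq_mul_div])
    (by rw [mul_div_assoc, F_div_B, q_zpow_eq (m := -t - M.T - S) (by ring), mul_assoc])
    (by rw [q_zpow_eq (m := M.T) (add_comm _ _), mul_assoc])

lemma upperParam_C (hm : m + 1 = 1 - M.N - S) :
    M.UpperParam S t (M.C S t) (M.poch (M.q ^ (1 - (M.N : ℤ) - S)))
      (M.poch (M.q ^ (1 + (M.N : ℤ) - t) * M.v₁ * M.v₂)) (M.poch (M.q ^ m))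
      (M.poch (M.q ^ (1 + (M.N : ℤ) - t) * M.v₁ * M.v₂)) (M.θ (M.q ^ m)) :=
  upperParam_poch (by rw [C_mul_F, q_zpow_eq_div hm])
    (by rw [mul_div_assoc, F_div_C, q_zpow_eq (m := M.N - t) (by ring), mul_assoc, mul_assoc,
      mul_assoc])
    (by rw [q_zpow_eq hm])

lemma upperParam_D (hm : m + 1 = 1 - M.N - t) :
    M.UpperParam S t (M.D S t) (M.poch (M.q ^ (1 - (M.N : ℤ) - t)))
      (M.poch (M.q ^ (1 + (M.N : ℤ) - S) * M.v₁ * M.v₂)) (M.poch (M.q ^ m))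
      (M.poch (M.q ^ (1 + (M.N : ℤ) - S) * M.v₁ * M.v₂)) (M.θ (M.q ^ m)) :=
  upperParam_poch (by rw [D_mul_F, q_zpow_eq_div hm])
    (by rw [mul_div_assoc, F_div_D, q_zpow_eq (m := M.N - S) (by ring), mul_assoc, mul_assoc,
      mul_assoc])
    (by rw [q_zpow_eq hm])

lemma upperParam_E (hm : m + 1 = 1 - t - S) :
    M.UpperParam S t (M.E S t) (M.poch (M.q ^ (1 - t - S) * M.v₁)) (M.poch (M.q * M.v₂))
      (M.poch (M.q ^ m * M.v₁)) (M.poch (M.q * M.v₂)) (M.θ (M.q ^ m * M.v₁)) :=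
  upperParam_poch (by rw [E_mul_F, q_zpow_eq_div hm, div_mul_eq_mul_div])
    (by rw [mul_div_assoc, F_div_E]) (by rw [q_zpow_eq hm, mul_assoc])

lemma upperParam_F (hm : m + 1 = 1 - t - S) :
    M.UpperParam S t (M.F S t) (M.poch (M.q ^ (1 - t - S) * M.v₁ * M.v₂)) (M.poch M.q)
      (M.poch (M.q ^ m * M.v₁ * M.v₂)) (M.poch M.q) (M.θ (M.q ^ m * M.v₁ * M.v₂)) :=
  upperParam_poch (by rw [F_mul_F, q_zpow_eq_div hm, div_mul_eq_mul_div, div_mul_eq_mul_div])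
    (by rw [mul_div_assoc, div_self (M.F_ne_zero S t), mul_one])
    (by rw [q_zpow_eq hm, mul_assoc, mul_assoc, mul_assoc])

variable (M S t)

/-- The split ABC | DEF: moving from t to t + 1 divides D, E, F by √q. Upward moves are bounded by
the zeros of θ(Cz) and θ(z/A), the reversed ones by those of θ(Dz) and θ(z/F). -/
lemma linePair_t : LinePair M S t S (t + 1) (M.A S t) (M.B S t) (M.C S t)
    (M.D S (t + 1)) (M.E S (t + 1)) (M.F S (t + 1)) (M.uniDen S t) (M.uniDen S (t + 1))
    (M.density S t) (M.density S (t + 1))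
    (M.θ (M.q ^ (1 - (M.N : ℤ) - (t + 1))) * M.θ (M.q ^ (1 - (t + 1) - S) * M.v₁) *
      M.θ (M.q ^ (1 - (t + 1) - S) * M.v₁ * M.v₂))
    (M.regConst S t * M.θ (M.q ^ (1 - (t + 1) - (M.T : ℤ) - S) * M.v₁) *
      M.θ (M.q ^ (1 + (M.N : ℤ) - (t + 1)) * M.v₁ * M.v₂)) := by
  have hq := M.q_ne_zero
  have hF := M.F_ne_zero S t
  refine linePair_of_params (M.A_ne_zero S t) (M.B_ne_zero S t) (M.C_ne_zero S t)
    (M.D_ne_zero S t) (M.E_ne_zero S t) hF (M.D_succ_t S t) (M.E_succ_t S t) (M.F_succ_t S t)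
    (by ring) (M.param_prod S t) (lowerParam_A (S' := S) (t' := t + 1) (by ring)) (lowerParam_B (by ring))
    (lowerParam_C (by ring)) (upperParam_D (by ring)) (upperParam_E (by ring))
    (upperParam_F (by ring)) ?_ ?_ ?_ ?_ ?_ ?_ ?_ ?_
  · intro x
    rw [uniDen]
    ring
  · intro x
    rw [uniDen]
    ring
  · intro x
    rw [density]
    ring
  · intro x
    rw [density]
    ring
  · intro x hx hx'
    simp only [positions, Finset.mem_Icc] at hx hx'
    exact M.plusNum_eq_zero S t (.inr (.inr (by
      rw [C_mul_z]; exact M.theta_zpow_zero (by omega))))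
  · intro x hx hx'
    simp only [positions, Finset.mem_Icc] at hx hx'
    exact M.minusNum_eq_zero S t (.inl (by
      rw [z_div_A]; exact M.theta_zpow_zero (by omega)))
  · intro x hx hx'
    simp only [positions, Finset.mem_Icc] at hx hx'
    exact M.plusNum_eq_zero S (t + 1) (.inl (by
      rw [D_mul_z]; exact M.theta_zpow_zero (by omega)))
  · intro x hx hx'
    simp only [positions, Finset.mem_Icc] at hx hx'
    exact M.minusNum_eq_zero S (t + 1) (.inr (.inr (by
      rw [z_div_F]; exact M.theta_zpow_zero (by omega))))

/-- The split ABD | EFC. The roles of C and D, hence of the two upper bounds of the interval, are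
interchanged compared with a step in t. -/
lemma linePair_S : LinePair M S t (S + 1) t (M.A S t) (M.B S t) (M.D S t)
    (M.E (S + 1) t) (M.F (S + 1) t) (M.C (S + 1) t) (M.uniDen S t) (M.uniDen (S + 1) t)
    (M.density S t) (M.density (S + 1) t)
    (M.θ (M.q ^ (1 - t - (S + 1)) * M.v₁) * M.θ (M.q ^ (1 - t - (S + 1)) * M.v₁ * M.v₂) *
      M.θ (M.q ^ (1 - (M.N : ℤ) - (S + 1))))
    (M.regConst S t * M.θ (M.q ^ (1 - t - (M.T : ℤ) - (S + 1)) * M.v₁) *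
      M.θ (M.q ^ (1 + (M.N : ℤ) - (S + 1)) * M.v₁ * M.v₂)) := by
  have hq := M.q_ne_zero
  have hF := M.F_ne_zero S t
  refine linePair_of_params (M.A_ne_zero S t) (M.B_ne_zero S t) (M.D_ne_zero S t)
    (M.E_ne_zero S t) hF (M.C_ne_zero S t) (M.E_succ_S S t) (M.F_succ_S S t) (M.C_succ_S S t)
    (by ring) (by rw [← M.param_prod S t]; ring) (lowerParam_A (S' := S + 1) (t' := t) (by ring)) (lowerParam_B (by ring))
    (lowerParam_D (by ring)) (upperParam_E (by ring))
    (upperParam_F (by ring)) (upperParam_C (by ring)) ?_ ?_ ?_ ?_ ?_ ?_ ?_ ?_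
  · intro x
    rw [uniDen]
    ring
  · intro x
    rw [uniDen]
    ring
  · intro x
    rw [density]
    ring
  · intro x
    rw [density]
    ring
  · intro x hx hx'
    simp only [positions, Finset.mem_Icc] at hx hx'
    exact M.plusNum_eq_zero S t (.inr (.inr (by
      rw [D_mul_z]; exact M.theta_zpow_zero (by omega))))
  · intro x hx hx'
    simp only [positions, Finset.mem_Icc] at hx hx'
    exact M.minusNum_eq_zero S t (.inl (by
      rw [z_div_A]; exact M.theta_zpow_zero (by omega)))
  · intro x hx hx'
    simp only [positions, Finset.mem_Icc] at hx hx'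
    exact M.plusNum_eq_zero (S + 1) t (.inr (.inr (by
      rw [C_mul_z]; exact M.theta_zpow_zero (by omega))))
  · intro x hx hx'
    simp only [positions, Finset.mem_Icc] at hx hx'
    exact M.minusNum_eq_zero (S + 1) t (.inr (.inl (by
      rw [z_div_F]; exact M.theta_zpow_zero (by omega))))

/-- The split DEA | BCF, in which B and E have traded places. Only their factors feel this: v₂
becomes v₂/q in the factors of both, while v₁ ↦ qv₁ compensates the change of S in their other two
factors. The boundary zeros are those of the unshifted pair. -/
lemma linePair_S_shift : LinePair M S t (S + 1) t (M.D S t) (M.E S t) (M.A S t)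
    ((M.shift 1).B (S + 1) t) ((M.shift 1).C (S + 1) t) ((M.shift 1).F (S + 1) t)
    (M.uniDen S t) ((M.shift 1).uniDen (S + 1) t)
    (M.density S t) ((M.shift 1).density (S + 1) t)
    (M.θ (M.q ^ (M.T : ℤ) * M.v₂) * M.θ (M.q ^ (1 - (M.N : ℤ) - (S + 1))) *
      M.θ (M.q ^ (1 - t - (S + 1)) * M.v₁ * M.v₂))
    (M.θ (M.q ^ (1 + (M.N : ℤ) - (S + 1)) * M.v₁ * M.v₂) * M.θ M.v₂ * M.regConst S t) := by
  have hq := M.q_ne_zero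
  have hF := M.F_ne_zero S t
  have hv₁ : ∀ m n : ℤ, m + 1 = n → M.q ^ m * (M.shift 1).v₁ = M.q ^ n * M.v₁ := by
    intro m n h
    rw [shift_v₁, ← mul_assoc, ← zpow_add₀ hq, h]
  have hv₂ : ∀ m n : ℤ, n + 1 = m → M.q ^ m * (M.shift 1).v₂ = M.q ^ n * M.v₂ := by
    intro m n h
    rw [shift_v₂, ← mul_assoc, ← zpow_add₀ hq, ← h, add_neg_cancel_right]
  have hv : ∀ y : ℂ, y * (M.shift 1).v₁ * (M.shift 1).v₂ = y * M.v₁ * M.v₂ := by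
    intro y
    rw [mul_assoc, shift_v₁_mul_v₂, mul_assoc]
  have hden : ∀ x, (M.shift 1).uniDen (S + 1) t x =
      M.poch M.q x * M.pochReg (S + 1) t x * M.poch (M.q ^ (1 - t - (M.T : ℤ) - S) * M.v₁) x *
      M.poch M.v₂ x * M.poch (M.q ^ (1 + (M.N : ℤ) - (S + 1)) * M.v₁ * M.v₂) x *
      M.poch (M.q ^ (1 + (M.N : ℤ) - t) * M.v₁ * M.v₂) x := by
    intro x
    have h1 : M.q * (M.shift 1).v₂ = M.v₂ := by
      simpa using hv₂ 1 0 rfl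
    change M.poch M.q x * M.pochReg (S + 1) t x *
      M.poch (M.q ^ (1 - t - (M.T : ℤ) - (S + 1)) * (M.shift 1).v₁) x *
      M.poch (M.q * (M.shift 1).v₂) x *
      M.poch (M.q ^ (1 + (M.N : ℤ) - (S + 1)) * (M.shift 1).v₁ * (M.shift 1).v₂) x *
      M.poch (M.q ^ (1 + (M.N : ℤ) - t) * (M.shift 1).v₁ * (M.shift 1).v₂) x = _
    rw [hv, hv, h1, hv₁ _ (1 - t - M.T - S) (by ring)]
  refine linePair_of_params (M.D_ne_zero S t) (M.E_ne_zero S t) (M.A_ne_zero S t)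
    (M.B_ne_zero S t) (M.C_ne_zero S t) hF (M.shift_B_succ_S S t)
    (by rw [shift_C, C_succ_S]) (by rw [shift_F, F_succ_S])
    (by ring) (by rw [← M.param_prod S t]; ring) (lowerParam_D (by ring)) lowerParam_E
    (lowerParam_A (S' := S + 1) (t' := t) (by ring)) upperParam_B (upperParam_C (by ring)) (upperParam_F (by ring))
    ?_ ?_ ?_ ?_ ?_ ?_ ?_ ?_
  · intro x
    rw [uniDen]
    ring
  · intro x
    rw [hden]
    ring
  · intro x
    rw [density]
    ring
  · intro x
    rw [density]
    change M.q ^ ((2 * (M.N : ℤ) - 1) * x) * (M.poch (M.q ^ (1 - (M.N : ℤ) - t)) x *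
      M.poch (M.q ^ (1 - (M.N : ℤ) - (S + 1))) x *
      M.poch (M.q ^ (1 - t - (S + 1)) * (M.shift 1).v₁) x *
      M.poch (M.q ^ (1 + (M.T : ℤ)) * (M.shift 1).v₂) x *
      M.poch (M.q ^ (1 - (M.T : ℤ)) * (M.shift 1).v₁ * (M.shift 1).v₂) x *
      M.poch (M.q ^ (1 - t - (S + 1)) * (M.shift 1).v₁ * (M.shift 1).v₂) x) / _ = _
    rw [hv, hv, hv₁ _ (1 - t - S) (by ring), hv₂ _ M.T (by ring)]
    ring
  · intro x hx hx'
    simp only [positions, Finset.mem_Icc] at hx hx'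
    exact M.plusNum_eq_zero S t (.inl (by
      rw [D_mul_z]; exact M.theta_zpow_zero (by omega)))
  · intro x hx hx'
    simp only [positions, Finset.mem_Icc] at hx hx'
    exact M.minusNum_eq_zero S t (.inr (.inr (by
      rw [z_div_A]; exact M.theta_zpow_zero (by omega))))
  · intro x hx hx'
    simp only [positions, Finset.mem_Icc] at hx hx'
    exact M.plusNum_eq_zero (S + 1) t (.inr (.inl (by
      rw [shift_C, C_mul_z]; exact M.theta_zpow_zero (by omega))))
  · intro x hx hx'
    simp only [positions, Finset.mem_Icc] at hx hx'
    exact M.minusNum_eq_zero (S + 1) t (.inr (.inr (by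
      rw [shift_F, z_div_F]; exact M.theta_zpow_zero (by omega))))

/-- The previous pair for the model shifted by -1, so that the unshifted density lies on the upper
line. This is the form needed for the matrix that leads down from S + 1 to S. -/
lemma linePair_S_shift' : LinePair M S t (S + 1) t (M.D S t) ((M.shift (-1)).E S t) (M.A S t)
    (M.B (S + 1) t) (M.C (S + 1) t) (M.F (S + 1) t)
    ((M.shift (-1)).uniDen S t) (M.uniDen (S + 1) t)
    ((M.shift (-1)).density S t) (M.density (S + 1) t)
    (M.θ (M.q ^ (M.T + 1 : ℤ) * M.v₂) * M.θ (M.q ^ (1 - (M.N : ℤ) - (S + 1))) *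
      M.θ (M.q ^ (1 - t - (S + 1)) * M.v₁ * M.v₂))
    (M.θ (M.q ^ (1 + (M.N : ℤ) - (S + 1)) * M.v₁ * M.v₂) * M.θ (M.q * M.v₂) *
      M.regConst S t) := by
  have h := (M.shift (-1)).linePair_S_shift S t
  rw [M.shift_shift 1 (-1) rfl] at h
  have hv : ∀ y : ℂ, y * (M.shift (-1)).v₁ * (M.shift (-1)).v₂ = y * M.v₁ * M.v₂ := by
    intro y
    rw [mul_assoc, shift_v₁_mul_v₂, mul_assoc]
  have h2 : (M.shift (-1)).v₂ = M.q * M.v₂ := by rw [shift_v₂, neg_neg, zpow_one]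
  rw [shift_D, shift_A, hv, hv, h2] at h
  have h3 : (M.shift (-1)).q ^ ((M.shift (-1)).T : ℤ) * (M.q * M.v₂) =
      M.q ^ (M.T + 1 : ℤ) * M.v₂ := by
    rw [zpow_add_one₀ M.q_ne_zero, mul_assoc]
    rfl
  rw [h3] at h
  have hp := M.shift_plusNum (-1)
  have hm := M.shift_minusNum (-1)
  exact ⟨h.line, h.ha, h.hb, h.hc, h.hd, h.he, h.hf,
    fun x hx hD hD' => by rw [← hp, ← hm]; exact h.plus x hx hD hD',
    fun x hx hx' hD hD' => by rw [← hp, ← hm]; exact h.minus x hx hx' hD hD',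
    fun x hx hx' => by rw [← hp]; exact h.plus_bdry x hx hx',
    fun x hx hx' => by rw [← hm]; exact h.minus_bdry x hx hx',
    fun x hx hx' => by rw [← hp]; exact h.plus_bdry' x hx hx',
    fun x hx hx' => by rw [← hm]; exact h.minus_bdry' x hx hx'⟩

end Pairs

end EllipticModel

end

noncomputable section

namespace EllipticModel

open EllipticTheta Filter Topology

/-! ### Transport of the Selberg densities by the matrices -/

/-- The function `D` does not vanish at the coordinates of the configurations on `(S, t)`. -/
def NonvanishingOn (M : EllipticModel) (S t : ℤ) (D : ℤ → ℂ) : Prop :=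
  ∀ X ∈ M.config S t, ∀ k, D (X k) ≠ 0

/-- The unnormalized Selberg density of the model `M.shift n`. -/
def shiftWeight (M : EllipticModel) (n S t : ℤ) (X : Fin M.N → ℤ) : ℂ :=
  M.phiProd S t X ^ 2 * ∏ k, (M.shift n).density S t (X k) * M.θ (M.z S t (X k) ^ 2)

/-- The total mass of the unnormalized Selberg density of the model `M.shift n`. -/
def shiftMass (M : EllipticModel) (n S t : ℤ) : ℂ := ∑ X ∈ M.config S t, M.shiftWeight n S t X

lemma selbergWeight_eq (M : EllipticModel) (S t : ℤ) (X : Fin M.N → ℤ) :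
    M.selbergWeight S t X =
      M.phiProd S t X ^ 2 * ∏ k, M.density S t (X k) * M.θ (M.z S t (X k) ^ 2) := by
  simp only [selbergWeight, uniNum_div_uniDen, phiProd, ← Finset.prod_pow]

lemma selbergWeight_shift (M : EllipticModel) (n S t : ℤ) :
    (M.shift n).selbergWeight S t = M.shiftWeight n S t := by
  funext X
  refine (selbergWeight_eq (M.shift n) S t X).trans ?_
  refine congrArg₂ (· * ·) ?_ ?_
  · refine congrArg (fun x : ℂ => x ^ 2) (Finset.prod_congr rfl fun k _ => ?_)
    exact Finset.prod_congr rfl fun l _ => M.shift_phi n S t _ _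
  · refine Finset.prod_congr rfl fun k _ => ?_
    rw [shift_z]
    rfl

lemma selbergMass_shift (M : EllipticModel) (n S t : ℤ) :
    (M.shift n).selbergMass S t = M.shiftMass n S t := by
  rw [selbergMass, selbergWeight_shift]
  rfl

lemma rho_shift (M : EllipticModel) (n S t : ℤ) :
    (M.shift n).rho S t = fun X => M.shiftWeight n S t X / M.shiftMass n S t := by
  funext X
  rw [← selbergMass_shift, ← selbergWeight_shift]
  rfl

lemma shiftWeight_zero (M : EllipticModel) (S t : ℤ) :
    M.shiftWeight 0 S t = M.selbergWeight S t := by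
  funext X
  rw [shiftWeight, shift_zero, selbergWeight_eq]

lemma shiftMass_zero (M : EllipticModel) (S t : ℤ) :
    M.shiftMass 0 S t = M.selbergMass S t := by
  rw [shiftMass, shiftWeight_zero, selbergMass]

/-- The transport of the unnormalized Selberg densities, in a form without denominators. -/
def Intertwines (M : EllipticModel) (v n S t S' t' : ℤ) (a b c : ℂ) : Prop :=
  ∀ Y ∈ M.config S' t', M.shiftMass n S' t' *
    ∑ X ∈ M.config S t, M.matrixStep v S t S' t' a b c X Y * M.selbergWeight S t X =
      M.selbergMass S t * M.shiftWeight n S' t' Y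

/-- Summing over Y and using that the rows sum to one shows that the source mass is κ times the
target mass, which eliminates κ. -/
lemma intertwines_of_exists {M : EllipticModel} {v n S t S' t' : ℤ} {a b c : ℂ}
    (hrow : RowSumsOne (M.config S t) (M.config S' t') (M.matrixStep v S t S' t' a b c))
    (h : ∃ κ : ℂ, ∀ Y ∈ M.config S' t', ∑ X ∈ M.config S t,
      M.matrixStep v S t S' t' a b c X Y * M.selbergWeight S t X =
        κ * M.shiftWeight n S' t' Y) :
    M.Intertwines v n S t S' t' a b c := by
  obtain ⟨κ, hκ⟩ := h
  have hmass : M.selbergMass S t = κ * M.shiftMass n S' t' := by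
    calc M.selbergMass S t = ∑ X ∈ M.config S t, ∑ Y ∈ M.config S' t',
          M.matrixStep v S t S' t' a b c X Y * M.selbergWeight S t X := by
          rw [selbergMass]
          refine Finset.sum_congr rfl fun X hX => ?_
          rw [← Finset.sum_mul, hrow X hX, one_mul]
      _ = ∑ Y ∈ M.config S' t', κ * M.shiftWeight n S' t' Y := by
          rw [Finset.sum_comm]
          exact Finset.sum_congr rfl hκ
      _ = _ := by
          rw [← Finset.mul_sum]
          rfl
  intro Y hY
  rw [hκ Y hY, hmass]
  ring

lemma Intertwines.carries {M : EllipticModel} {v n S t S' t' : ℤ} {a b c : ℂ}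
    (h : M.Intertwines v n S t S' t' a b c) (h₁ : M.selbergMass S t ≠ 0)
    (h₂ : M.shiftMass n S' t' ≠ 0) :
    Carries (M.config S t) (M.config S' t') (M.matrixStep v S t S' t' a b c)
      (M.rho S t) ((M.shift n).rho S' t') := by
  rw [rho_shift]
  intro Y hY
  simp only [rho, ← mul_div_assoc, ← Finset.sum_div]
  rw [div_eq_div_iff h₂ h₁, mul_comm, ← h Y hY, mul_comm]

/-! ### Row sums and transport in both directions along a pair of lines. -/

namespace LinePair

variable {M : EllipticModel} {n S t S' t' : ℤ} {a b c d e f K₁ K₂ : ℂ}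
  {D D' u u' : ℤ → ℂ}

lemma transport_aux {P u τ L R V W : ℂ} (hτ : τ ≠ 0) (hL : L ≠ 0) (h : L * (u * P) = R * (V * W)) :
    P / τ * (u * τ) = R / L * V * W := by
  field_simp
  linear_combination h

lemma transport_aux' {P u τ L K Q V W : ℂ} (hτ : τ ≠ 0) (hK : K ≠ 0) (hQ : Q ≠ 0)
    (h : L * (V * W) = -(K * Q) * (u * P)) : P / τ * (u * τ) = -L / (K * Q) * V * W := by
  field_simp
  linear_combination h

lemma rowSumsOne_up (h : LinePair M S t S' t' a b c d e f D D' u u' K₁ K₂)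
    (hθ : ∀ m : ℕ, 1 ≤ m → m < M.N → M.θ (M.q ^ m) ≠ 0) (hline : M.LineRegular S t)
    (hnorm : M.NormRegular a b c) :
    RowSumsOne (M.config S t) (M.config S' t') (M.matrixStep 0 S t S' t' a b c) :=
  rowSumsOne_matrixStep (by rw [h.line, mul_zero, add_zero]) hθ hline h.ha h.hb h.hc hnorm
    (fun x hx hx' => h.plus_bdry x hx (by rwa [add_zero] at hx'))
    (fun x hx hx' => h.minus_bdry x hx (by rwa [add_zero] at hx'))

lemma rowSumsOne_down (h : LinePair M S t S' t' a b c d e f D D' u u' K₁ K₂)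
    (hθ : ∀ m : ℕ, 1 ≤ m → m < M.N → M.θ (M.q ^ m) ≠ 0) (hline : M.LineRegular S' t')
    (hnorm : M.NormRegular d e f) :
    RowSumsOne (M.config S' t') (M.config S t) (M.matrixStep (-1) S' t' S t d e f) :=
  rowSumsOne_matrixStep (by rw [h.line]; ring) hθ hline h.hd h.he h.hf hnorm
    (fun x hx hx' => h.plus_bdry' x hx (by rwa [neg_add_cancel_right] at hx'))
    (fun x hx hx' => h.minus_bdry' x hx hx')

/-- Detailed balance carries the constant K₁ on the side of the source, and it must be divided out.
It may vanish for parameters allowed in the theorem, so this lemma serves only generic parameters.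
-/
lemma intertwines_up
    (h : LinePair M S t S' t' a b c d e f (M.uniDen S t) ((M.shift n).uniDen S' t')
      (M.density S t) ((M.shift n).density S' t') K₁ K₂) (hK : K₁ ≠ 0)
    (hθ : ∀ m : ℕ, 1 ≤ m → m < M.N → M.θ (M.q ^ m) ≠ 0) (hline : M.LineRegular S t)
    (hnorm : M.NormRegular a b c) (hD : M.NonvanishingOn S t (M.uniDen S t))
    (hD' : M.NonvanishingOn S' t' ((M.shift n).uniDen S' t')) :
    M.Intertwines 0 n S t S' t' a b c := by
  refine intertwines_of_exists (h.rowSumsOne_up hθ hline hnorm) ?_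
  simp only [shiftWeight, selbergWeight_eq]
  refine exists_sum_matrixStep_mul (v := 0) (v' := -1) rfl (by rw [h.line, mul_zero, add_zero])
    hθ hline h.hd h.he h.hf (fun x => M.density S t x * M.θ (M.z S t x ^ 2))
    ((M.shift n).density S' t') (-(K₂ * M.q ^ (1 - (M.N : ℤ))) / K₁) ?_ ?_ ?_ ?_
  · intro X hX Y hY k hk
    have hz := (hline X hX).2 k
    have h1 := h.plus (X k) ((M.mem_config.1 hX).1 k) (hD X hX k)
    rw [add_zero] at hk
    rw [← hk] at h1
    have h2 := h1 (hD' Y hY k)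
    rw [plusFactor_eq]
    exact transport_aux hz hK h2
  · intro X hX Y hY k hk
    have hz := (hline X hX).2 k
    rw [add_zero] at hk
    have hY' := (M.mem_config.1 hY).1 k
    have h0 := hD' Y hY k
    rw [hk] at hY' h0 ⊢
    have h2 := h.minus (X k) ((M.mem_config.1 hX).1 k) hY' (hD X hX k) h0
    rw [minusFactor_eq]
    exact transport_aux hz hK h2
  · intro y hy hy'
    exact h.plus_bdry' y hy (by rwa [sub_zero] at hy')
  · intro y hy hy'
    exact h.minus_bdry' y hy (by rwa [sub_zero] at hy')

/-- The same line pair read from the upper to the lower line; now K₂ must be nonzero. -/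
lemma intertwines_down
    (h : LinePair M S' t' S t d e f a b c ((M.shift n).uniDen S' t') (M.uniDen S t)
      ((M.shift n).density S' t') (M.density S t) K₁ K₂) (hK : K₂ ≠ 0)
    (hθ : ∀ m : ℕ, 1 ≤ m → m < M.N → M.θ (M.q ^ m) ≠ 0) (hline : M.LineRegular S t)
    (hnorm : M.NormRegular a b c) (hD : M.NonvanishingOn S t (M.uniDen S t))
    (hD' : M.NonvanishingOn S' t' ((M.shift n).uniDen S' t')) :
    M.Intertwines (-1) n S t S' t' a b c := by
  refine intertwines_of_exists (h.rowSumsOne_down hθ hline hnorm) ?_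
  have hqN := zpow_ne_zero (1 - (M.N : ℤ)) M.q_ne_zero
  simp only [shiftWeight, selbergWeight_eq]
  refine exists_sum_matrixStep_mul (v := -1) (v' := 0) rfl (by rw [h.line]; ring)
    hθ hline h.ha h.hb h.hc (fun x => M.density S t x * M.θ (M.z S t x ^ 2))
    ((M.shift n).density S' t') (-K₁ / (K₂ * M.q ^ (1 - (M.N : ℤ)))) ?_ ?_ ?_ ?_
  · intro X hX Y hY k hk
    have hz := (hline X hX).2 k
    rw [neg_add_cancel_right] at hk
    have hX' := (M.mem_config.1 hX).1 k
    have h0 := hD X hX k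
    rw [← hk] at hX' h0 hz ⊢
    have h2 := h.minus (Y k) ((M.mem_config.1 hY).1 k) hX' (hD' Y hY k) h0
    rw [plusFactor_eq]
    exact transport_aux' hz hK hqN h2
  · intro X hX Y hY k hk
    have hz := (hline X hX).2 k
    have h1 := h.plus (Y k) ((M.mem_config.1 hY).1 k) (hD' Y hY k)
    rw [show Y k + 1 = X k by omega] at h1
    have h2 := h1 (hD X hX k)
    rw [minusFactor_eq]
    exact transport_aux' hz hK hqN h2
  · intro y hy hy'
    exact h.plus_bdry y hy (by rwa [sub_neg_eq_add] at hy')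
  · intro y hy hy'
    exact h.minus_bdry y hy (by rwa [sub_neg_eq_add, add_sub_cancel_right] at hy')

end LinePair

end EllipticModel

end

noncomputable section

namespace EllipticModel

open EllipticTheta Filter Topology

/-! ### Deformations of the parameters -/

/-- A continuous deformation of the parameters `q, v₁, v₂` of the model. -/
structure Deformation (M : EllipticModel) where
  sq : ℝ → ℂ
  sv₁ : ℝ → ℂ
  sv₂ : ℝ → ℂ
  sq_ne_zero : ∀ ε, sq ε ≠ 0
  sv₁_ne_zero : ∀ ε, sv₁ ε ≠ 0
  sv₂_ne_zero : ∀ ε, sv₂ ε ≠ 0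
  continuous_sq : Continuous sq
  continuous_sv₁ : Continuous sv₁
  continuous_sv₂ : Continuous sv₂

namespace Deformation

variable {M : EllipticModel} (γ : Deformation M)

/-- The deformed model. -/
abbrev model (ε : ℝ) : EllipticModel where
  p := M.p
  sq := γ.sq ε
  sv₁ := γ.sv₁ ε
  sv₂ := γ.sv₂ ε
  N := M.N
  T := M.T
  norm_p_lt_one := M.norm_p_lt_one
  sq_ne_zero := γ.sq_ne_zero ε
  sv₁_ne_zero := γ.sv₁_ne_zero ε
  sv₂_ne_zero := γ.sv₂_ne_zero ε

lemma continuous_sq_zpow (n : ℤ) : Continuous fun ε => γ.sq ε ^ n :=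
  γ.continuous_sq.zpow₀ n fun ε => .inl (γ.sq_ne_zero ε)

/-- The deformation of the shifted models. -/
def shift (n : ℤ) : Deformation M where
  sq := γ.sq
  sv₁ ε := γ.sq ε ^ n * γ.sv₁ ε
  sv₂ ε := γ.sq ε ^ (-n) * γ.sv₂ ε
  sq_ne_zero := γ.sq_ne_zero
  sv₁_ne_zero ε := mul_ne_zero (zpow_ne_zero _ (γ.sq_ne_zero ε)) (γ.sv₁_ne_zero ε)
  sv₂_ne_zero ε := mul_ne_zero (zpow_ne_zero _ (γ.sq_ne_zero ε)) (γ.sv₂_ne_zero ε)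
  continuous_sq := γ.continuous_sq
  continuous_sv₁ := (γ.continuous_sq_zpow n).fun_mul γ.continuous_sv₁
  continuous_sv₂ := (γ.continuous_sq_zpow (-n)).fun_mul γ.continuous_sv₂

lemma model_shift (n : ℤ) (ε : ℝ) : (γ.model ε).shift n = (γ.shift n).model ε := rfl

lemma continuous_q : Continuous fun ε => (γ.model ε).q := γ.continuous_sq.fun_pow 2

lemma continuous_v₁ : Continuous fun ε => (γ.model ε).v₁ := γ.continuous_sv₁.fun_pow 2

lemma continuous_v₂ : Continuous fun ε => (γ.model ε).v₂ := γ.continuous_sv₂.fun_pow 2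

lemma continuous_q_zpow (n : ℤ) : Continuous fun ε => (γ.model ε).q ^ n :=
  γ.continuous_q.zpow₀ n fun ε => .inl (γ.model ε).q_ne_zero

lemma v₁_ne_zero (ε : ℝ) : (γ.model ε).v₁ ≠ 0 := pow_ne_zero 2 (γ.sv₁_ne_zero ε)

lemma v₂_ne_zero (ε : ℝ) : (γ.model ε).v₂ ≠ 0 := pow_ne_zero 2 (γ.sv₂_ne_zero ε)

lemma continuous_fun_div {X : Type*} [TopologicalSpace X] {f g : X → ℂ} (hf : Continuous f)
    (hg : Continuous g) (h : ∀ x, g x ≠ 0) : Continuous fun x => f x / g x := hf.div hg h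

lemma continuousAt_fun_div {X : Type*} [TopologicalSpace X] {f g : X → ℂ} {x : X}
    (hf : ContinuousAt f x) (hg : ContinuousAt g x) (h : g x ≠ 0) :
    ContinuousAt (fun x => f x / g x) x := hf.div hg h

variable (S t : ℤ)

lemma continuous_A : Continuous fun ε => (γ.model ε).A S t := by
  unfold A
  dsimp only
  exact (γ.continuous_sq_zpow _).fun_mul (γ.continuous_sv₁.fun_mul γ.continuous_sv₂)

lemma continuous_B : Continuous fun ε => (γ.model ε).B S t := by
  unfold B
  dsimp only
  exact (γ.continuous_sq_zpow _).fun_mul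
    (continuous_fun_div γ.continuous_sv₂ γ.continuous_sv₁ γ.sv₁_ne_zero)

lemma continuous_C : Continuous fun ε => (γ.model ε).C S t := by
  unfold C
  dsimp only
  exact continuous_fun_div (γ.continuous_sq_zpow _) (γ.continuous_sv₁.fun_mul γ.continuous_sv₂)
    fun ε => mul_ne_zero (γ.sv₁_ne_zero ε) (γ.sv₂_ne_zero ε)

lemma continuous_D : Continuous fun ε => (γ.model ε).D S t := by
  unfold D
  dsimp only
  exact continuous_fun_div (γ.continuous_sq_zpow _) (γ.continuous_sv₁.fun_mul γ.continuous_sv₂)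
    fun ε => mul_ne_zero (γ.sv₁_ne_zero ε) (γ.sv₂_ne_zero ε)

lemma continuous_E : Continuous fun ε => (γ.model ε).E S t := by
  unfold E
  dsimp only
  exact (γ.continuous_sq_zpow _).fun_mul
    (continuous_fun_div γ.continuous_sv₁ γ.continuous_sv₂ γ.sv₂_ne_zero)

lemma continuous_F : Continuous fun ε => (γ.model ε).F S t := by
  unfold F
  dsimp only
  exact (γ.continuous_sq_zpow _).fun_mul (γ.continuous_sv₁.fun_mul γ.continuous_sv₂)

lemma continuous_z (x : ℤ) : Continuous fun ε => (γ.model ε).z S t x := by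
  unfold z
  exact (γ.continuous_F S t).fun_mul (γ.continuous_q_zpow x)

lemma continuous_theta {f : ℝ → ℂ} (hf : Continuous f) (h0 : ∀ ε, f ε ≠ 0) :
    Continuous fun ε => (γ.model ε).θ (f ε) :=
  continuous_theta_comp M.norm_p_lt_one hf h0

lemma continuous_poch {f : ℝ → ℂ} (hf : Continuous f) (h0 : ∀ ε, f ε ≠ 0) (x : ℤ) :
    Continuous fun ε => (γ.model ε).poch (f ε) x := by
  unfold poch thetaPoch
  exact continuous_finsetProd _ fun i _ => γ.continuous_theta
    ((γ.continuous_q.fun_pow i).fun_mul hf) fun ε =>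
      mul_ne_zero (pow_ne_zero _ (γ.model ε).q_ne_zero) (h0 ε)

lemma continuous_pochReg (x : ℤ) : Continuous fun ε => (γ.model ε).pochReg S t x := by
  change Continuous fun ε =>
    ∏ i ∈ (Finset.range x.toNat).filter (fun i : ℕ => (i : ℤ) ≠ t + S - M.T - 1),
      (γ.model ε).θ ((γ.model ε).q ^ i * (γ.model ε).q ^ (1 - S - t + (M.T : ℤ)))
  apply continuous_finsetProd
  intro i _
  exact γ.continuous_theta
    ((γ.continuous_q.fun_pow i).fun_mul (γ.continuous_q_zpow _)) fun ε =>
      mul_ne_zero (pow_ne_zero _ (γ.model ε).q_ne_zero) (zpow_ne_zero _ (γ.model ε).q_ne_zero)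

lemma continuous_v₁_v₂ (n : ℤ) :
    Continuous fun ε => (γ.model ε).q ^ n * (γ.model ε).v₁ * (γ.model ε).v₂ :=
  ((γ.continuous_q_zpow n).fun_mul γ.continuous_v₁).fun_mul γ.continuous_v₂

lemma v₁_v₂_ne_zero (n : ℤ) (ε : ℝ) :
    (γ.model ε).q ^ n * (γ.model ε).v₁ * (γ.model ε).v₂ ≠ 0 :=
  mul_ne_zero (mul_ne_zero (zpow_ne_zero _ (γ.model ε).q_ne_zero) (γ.v₁_ne_zero ε))
    (γ.v₂_ne_zero ε)

lemma continuous_phi (x y : ℤ) : Continuous fun ε => (γ.model ε).phi S t x y := by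
  unfold phi
  exact ((γ.continuous_q_zpow _).fun_mul (γ.continuous_theta (γ.continuous_q_zpow _) fun ε =>
    zpow_ne_zero _ (γ.model ε).q_ne_zero)).fun_mul (γ.continuous_theta
      (γ.continuous_v₁_v₂ _) (γ.v₁_v₂_ne_zero _))

lemma continuous_phiProd (X : Fin M.N → ℤ) : Continuous fun ε => (γ.model ε).phiProd S t X := by
  change Continuous fun ε => ∏ k : Fin M.N, ∏ l ∈ Finset.Ioi k, (γ.model ε).phi S t (X k) (X l)
  apply continuous_finsetProd
  intro k _
  apply continuous_finsetProd
  intro l _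
  exact γ.continuous_phi S t (X k) (X l)

lemma continuous_poch_q_zpow (n x : ℤ) :
    Continuous fun ε => (γ.model ε).poch ((γ.model ε).q ^ n) x :=
  γ.continuous_poch (γ.continuous_q_zpow n) (fun ε => zpow_ne_zero _ (γ.model ε).q_ne_zero) x

lemma continuous_poch_v₁ (n x : ℤ) :
    Continuous fun ε => (γ.model ε).poch ((γ.model ε).q ^ n * (γ.model ε).v₁) x :=
  γ.continuous_poch ((γ.continuous_q_zpow n).fun_mul γ.continuous_v₁)
    (fun ε => mul_ne_zero (zpow_ne_zero _ (γ.model ε).q_ne_zero) (γ.v₁_ne_zero ε)) x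

lemma continuous_poch_v₂ (n x : ℤ) :
    Continuous fun ε => (γ.model ε).poch ((γ.model ε).q ^ n * (γ.model ε).v₂) x :=
  γ.continuous_poch ((γ.continuous_q_zpow n).fun_mul γ.continuous_v₂)
    (fun ε => mul_ne_zero (zpow_ne_zero _ (γ.model ε).q_ne_zero) (γ.v₂_ne_zero ε)) x

lemma continuous_poch_v₁_v₂ (n x : ℤ) : Continuous fun ε =>
    (γ.model ε).poch ((γ.model ε).q ^ n * (γ.model ε).v₁ * (γ.model ε).v₂) x :=
  γ.continuous_poch (γ.continuous_v₁_v₂ n) (γ.v₁_v₂_ne_zero n) x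

lemma continuous_uniDen (x : ℤ) : Continuous fun ε => (γ.model ε).uniDen S t x := by
  have h1 : Continuous fun ε => (γ.model ε).poch (γ.model ε).q x := by
    simpa only [zpow_one] using γ.continuous_poch_q_zpow 1 x
  have h2 : Continuous fun ε => (γ.model ε).poch ((γ.model ε).q * (γ.model ε).v₂) x := by
    simpa only [zpow_one] using γ.continuous_poch_v₂ 1 x
  unfold uniDen
  dsimp only
  refine Continuous.fun_mul (Continuous.fun_mul (Continuous.fun_mul (Continuous.fun_mul
    (Continuous.fun_mul h1 (γ.continuous_pochReg S t x)) ?_) h2) ?_) ?_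
  · exact γ.continuous_poch_v₁ _ x
  · exact γ.continuous_poch_v₁_v₂ _ x
  · exact γ.continuous_poch_v₁_v₂ _ x

variable {S t}

lemma continuousAt_density {x : ℤ} {ε₀ : ℝ} (h : (γ.model ε₀).uniDen S t x ≠ 0) :
    ContinuousAt (fun ε => (γ.model ε).density S t x) ε₀ := by
  unfold density
  dsimp only
  refine continuousAt_fun_div (Continuous.continuousAt (Continuous.fun_mul
    (γ.continuous_q_zpow _) (Continuous.fun_mul (Continuous.fun_mul (Continuous.fun_mul
      (Continuous.fun_mul (Continuous.fun_mul ?_ ?_) ?_) ?_) ?_) ?_)))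
      (γ.continuous_uniDen S t x).continuousAt h
  · exact γ.continuous_poch_q_zpow _ x
  · exact γ.continuous_poch_q_zpow _ x
  · exact γ.continuous_poch_v₁ _ x
  · exact γ.continuous_poch_v₂ _ x
  · exact γ.continuous_poch_v₁_v₂ _ x
  · exact γ.continuous_poch_v₁_v₂ _ x

lemma continuous_theta_z_sq (S t x : ℤ) :
    Continuous fun ε => (γ.model ε).θ ((γ.model ε).z S t x ^ 2) :=
  γ.continuous_theta ((γ.continuous_z S t x).fun_pow 2) fun ε =>
    pow_ne_zero 2 ((γ.model ε).z_ne_zero S t x)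

lemma continuousAt_shiftWeight {n : ℤ} {X : Fin M.N → ℤ} {ε₀ : ℝ}
    (h : ∀ k, ((γ.model ε₀).shift n).uniDen S t (X k) ≠ 0) :
    ContinuousAt (fun ε => (γ.model ε).shiftWeight n S t X) ε₀ := by
  unfold shiftWeight
  dsimp only
  refine ((γ.continuous_phiProd S t X).fun_pow 2).continuousAt.fun_mul ?_
  refine tendsto_finsetProd _ fun k _ => ?_
  exact ContinuousAt.fun_mul ((γ.shift n).continuousAt_density (h k))
    (γ.continuous_theta_z_sq S t (X k)).continuousAt

lemma continuousAt_shiftMass {n : ℤ} {ε₀ : ℝ}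
    (h : (γ.model ε₀).NonvanishingOn S t (((γ.model ε₀).shift n).uniDen S t)) :
    ContinuousAt (fun ε => (γ.model ε).shiftMass n S t) ε₀ := by
  have hX : ∀ X ∈ M.config S t, ContinuousAt (fun ε => (γ.model ε).shiftWeight n S t X) ε₀ :=
    fun X hX => γ.continuousAt_shiftWeight (h X hX)
  change ContinuousAt (fun ε => ∑ X ∈ M.config S t, (γ.model ε).shiftWeight n S t X) ε₀
  exact tendsto_finsetSum (M.config S t) hX

/-! ### Continuity of the matrix entries along a deformation. -/

section Matrices

variable {a b c : ℝ → ℂ} (ha : Continuous a) (hb : Continuous b) (hc : Continuous c)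
  (ha₀ : ∀ ε, a ε ≠ 0) (hb₀ : ∀ ε, b ε ≠ 0) (hc₀ : ∀ ε, c ε ≠ 0)

lemma continuous_theta_pair {f g : ℝ → ℂ} (hf : Continuous f) (hg : Continuous g)
    (hf₀ : ∀ ε, f ε ≠ 0) (hg₀ : ∀ ε, g ε ≠ 0) (k : ℕ) :
    Continuous fun ε => (γ.model ε).θ ((γ.model ε).q ^ k * (f ε * g ε)) :=
  γ.continuous_theta ((γ.continuous_q.fun_pow k).fun_mul (hf.fun_mul hg)) fun ε =>
    mul_ne_zero (pow_ne_zero _ (γ.model ε).q_ne_zero) (mul_ne_zero (hf₀ ε) (hg₀ ε))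

include ha hb hc ha₀ hb₀ hc₀

lemma continuous_normDown (S t : ℤ) :
    Continuous fun ε => (γ.model ε).normDown S t (a ε) (b ε) (c ε) := by
  unfold normDown
  dsimp only
  refine Continuous.fun_mul (Continuous.fun_pow (continuous_fun_div
    ((γ.continuous_q_zpow _).fun_mul (γ.continuous_F S t)) ((ha.fun_mul hb).fun_mul hc) fun ε =>
      mul_ne_zero (mul_ne_zero (ha₀ ε) (hb₀ ε)) (hc₀ ε)) _) ?_
  refine continuous_finsetProd _ fun k _ => Continuous.fun_mul (Continuous.fun_mul ?_ ?_) ?_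
  · exact γ.continuous_theta_pair ha hb ha₀ hb₀ k
  · exact γ.continuous_theta_pair ha hc ha₀ hc₀ k
  · exact γ.continuous_theta_pair hb hc hb₀ hc₀ k

lemma continuous_plusNum (S t x : ℤ) :
    Continuous fun ε => (γ.model ε).plusNum S t (a ε) (b ε) (c ε) x := by
  have hq := fun ε => (γ.model ε).q_ne_zero
  have hz := fun ε => (γ.model ε).z_ne_zero S t x
  have hone : ∀ {f : ℝ → ℂ}, Continuous f → (∀ ε, f ε ≠ 0) →
      Continuous fun ε => (γ.model ε).θ (f ε * (γ.model ε).z S t x) :=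
    fun hf hf₀ => γ.continuous_theta (hf.fun_mul (γ.continuous_z S t x)) fun ε =>
      mul_ne_zero (hf₀ ε) (hz ε)
  have habc := fun ε => mul_ne_zero (mul_ne_zero (ha₀ ε) (hb₀ ε)) (hc₀ ε)
  unfold plusNum
  dsimp only
  refine Continuous.fun_neg (Continuous.fun_mul (γ.continuous_q_zpow _) (Continuous.fun_mul
    (((hone ha ha₀).fun_mul (hone hb hb₀)).fun_mul (hone hc hc₀)) ?_))
  exact γ.continuous_theta (continuous_fun_div
    ((γ.continuous_q_zpow _).fun_mul (γ.continuous_z S t x)) ((ha.fun_mul hb).fun_mul hc) habc)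
    fun ε => div_ne_zero (mul_ne_zero (zpow_ne_zero _ (hq ε)) (hz ε)) (habc ε)

lemma continuous_minusNum (S t x : ℤ) :
    Continuous fun ε => (γ.model ε).minusNum S t (a ε) (b ε) (c ε) x := by
  have hq := fun ε => (γ.model ε).q_ne_zero
  have hz := fun ε => (γ.model ε).z_ne_zero S t x
  have hone : ∀ {f : ℝ → ℂ}, Continuous f → (∀ ε, f ε ≠ 0) →
      Continuous fun ε => (γ.model ε).θ ((γ.model ε).z S t x / f ε) :=
    fun hf hf₀ => γ.continuous_theta (continuous_fun_div (γ.continuous_z S t x) hf hf₀) fun ε =>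
      div_ne_zero (hz ε) (hf₀ ε)
  have habc := fun ε => mul_ne_zero (mul_ne_zero (ha₀ ε) (hb₀ ε)) (hc₀ ε)
  unfold minusNum
  dsimp only
  refine Continuous.fun_mul (γ.continuous_q_zpow _) (Continuous.fun_mul
    (((hone ha ha₀).fun_mul (hone hb hb₀)).fun_mul (hone hc hc₀)) ?_)
  exact γ.continuous_theta
    (((γ.continuous_q_zpow _).fun_mul (γ.continuous_z S t x)).fun_mul
      ((ha.fun_mul hb).fun_mul hc))
    fun ε => mul_ne_zero (mul_ne_zero (zpow_ne_zero _ (hq ε)) (hz ε)) (habc ε)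

open Classical in
lemma continuousAt_matrixStep {v S' t' : ℤ} {ε₀ : ℝ} (hline : (γ.model ε₀).LineRegular S t)
    (hnorm : (γ.model ε₀).normDown S t (a ε₀) (b ε₀) (c ε₀) ≠ 0) {X : Fin M.N → ℤ}
    (hX : X ∈ M.config S t) (Y : Fin M.N → ℤ) :
    ContinuousAt (fun ε => (γ.model ε).matrixStep v S t S' t' (a ε) (b ε) (c ε) X Y) ε₀ := by
  by_cases h : ∀ k, Y k = X k + v ∨ Y k = X k + v + 1
  · have heq : (fun ε => (γ.model ε).matrixStep v S t S' t' (a ε) (b ε) (c ε) X Y) = fun ε =>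
        (γ.model ε).q ^ ((1 + v) * (M.N.choose 2 : ℕ)) *
        ((γ.model ε).normDown S t (a ε) (b ε) (c ε))⁻¹ *
        ((γ.model ε).phiProd S' t' Y / (γ.model ε).phiProd S t X) *
        (∏ k with Y k = X k + v + 1, (γ.model ε).plusNum S t (a ε) (b ε) (c ε) (X k) /
          (γ.model ε).θ ((γ.model ε).z S t (X k) ^ 2)) *
        ∏ k with Y k = X k + v, (γ.model ε).minusNum S t (a ε) (b ε) (c ε) (X k) /
          (γ.model ε).θ ((γ.model ε).z S t (X k) ^ 2) := by
      funext ε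
      refine (if_pos h).trans ?_
      rw [phiRatio_eq]
      simp only [plusFactor_eq, minusFactor_eq]
    rw [heq]
    refine ContinuousAt.fun_mul (ContinuousAt.fun_mul (ContinuousAt.fun_mul (ContinuousAt.fun_mul
      (γ.continuous_q_zpow _).continuousAt ?_) ?_) ?_) ?_
    · exact (γ.continuous_normDown ha hb hc ha₀ hb₀ hc₀ S t).continuousAt.fun_inv₀ hnorm
    · exact continuousAt_fun_div (γ.continuous_phiProd S' t' Y).continuousAt
        (γ.continuous_phiProd S t X).continuousAt (hline.phiProd_ne_zero hX)
    · exact tendsto_finsetProd _ fun k _ => continuousAt_fun_div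
        (γ.continuous_plusNum ha hb hc ha₀ hb₀ hc₀ S t (X k)).continuousAt
          (γ.continuous_theta_z_sq S t (X k)).continuousAt ((hline X hX).2 k)
    · exact tendsto_finsetProd _ fun k _ => continuousAt_fun_div
        (γ.continuous_minusNum ha hb hc ha₀ hb₀ hc₀ S t (X k)).continuousAt
          (γ.continuous_theta_z_sq S t (X k)).continuousAt ((hline X hX).2 k)
  · have heq : (fun ε => (γ.model ε).matrixStep v S t S' t' (a ε) (b ε) (c ε) X Y) =
        fun _ => 0 := by
      funext ε
      exact if_neg h
    rw [heq]
    exact continuousAt_const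

end Matrices

end Deformation

end EllipticModel

end

noncomputable section

namespace EllipticModel

open EllipticTheta Filter Topology

/-! ### Passage to generic parameters -/

namespace Deformation

variable {M : EllipticModel} (γ : Deformation M) {S t : ℤ}

lemma eventually_lineRegular (h : (γ.model 0).LineRegular S t) :
    ∀ᶠ ε in 𝓝 0, (γ.model ε).LineRegular S t := by
  have h1 : ∀ X ∈ M.config S t, ∀ᶠ ε in 𝓝 (0 : ℝ),
      (∀ k l, k < l → (γ.model ε).phi S t (X k) (X l) ≠ 0) ∧
        ∀ k, (γ.model ε).θ ((γ.model ε).z S t (X k) ^ 2) ≠ 0 := by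
    intro X hX
    refine Eventually.and (eventually_all.2 fun k => eventually_all.2 fun l =>
      eventually_imp_distrib_left.2 fun hkl => ?_) (eventually_all.2 fun k => ?_)
    · exact (γ.continuous_phi S t (X k) (X l)).continuousAt.eventually_ne ((h X hX).1 k l hkl)
    · exact (γ.continuous_theta_z_sq S t (X k)).continuousAt.eventually_ne ((h X hX).2 k)
  filter_upwards [(eventually_all_finset _).2 h1] with ε hε
  exact hε

lemma eventually_nonvanishingOn
    (h : (γ.model 0).NonvanishingOn S t ((γ.model 0).uniDen S t)) :
    ∀ᶠ ε in 𝓝 0, (γ.model ε).NonvanishingOn S t ((γ.model ε).uniDen S t) := by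
  have h1 : ∀ X ∈ M.config S t, ∀ᶠ ε in 𝓝 (0 : ℝ), ∀ k, (γ.model ε).uniDen S t (X k) ≠ 0 :=
    fun X hX => eventually_all.2 fun k =>
      (γ.continuous_uniDen S t (X k)).continuousAt.eventually_ne (h X hX k)
  filter_upwards [(eventually_all_finset _).2 h1] with ε hε
  exact hε

section Matrices

variable {a b c : ℝ → ℂ} (ha : Continuous a) (hb : Continuous b) (hc : Continuous c)
  (ha₀ : ∀ ε, a ε ≠ 0) (hb₀ : ∀ ε, b ε ≠ 0) (hc₀ : ∀ ε, c ε ≠ 0)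

include ha hb hc ha₀ hb₀ hc₀

lemma eventually_normRegular (h : (γ.model 0).NormRegular (a 0) (b 0) (c 0)) :
    ∀ᶠ ε in 𝓝 0, (γ.model ε).NormRegular (a ε) (b ε) (c ε) := by
  have h1 : ∀ k ∈ Finset.range M.N, ∀ᶠ ε in 𝓝 (0 : ℝ),
      (γ.model ε).θ ((γ.model ε).q ^ k * (a ε * b ε)) ≠ 0 ∧
      (γ.model ε).θ ((γ.model ε).q ^ k * (a ε * c ε)) ≠ 0 ∧
      (γ.model ε).θ ((γ.model ε).q ^ k * (b ε * c ε)) ≠ 0 := by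
    intro k hk
    obtain ⟨h1, h2, h3⟩ := h k (Finset.mem_range.1 hk)
    exact ((γ.continuous_theta_pair ha hb ha₀ hb₀ k).continuousAt.eventually_ne h1).and
      (((γ.continuous_theta_pair ha hc ha₀ hc₀ k).continuousAt.eventually_ne h2).and
        ((γ.continuous_theta_pair hb hc hb₀ hc₀ k).continuousAt.eventually_ne h3))
  filter_upwards [(eventually_all_finset _).2 h1] with ε hε k hk
  exact hε k (Finset.mem_range.2 hk)

/-- Both sides are continuous at 0, so a failure at 0 would persist nearby. Nonvanishing
denominators suffice for this; the total masses along the deformation need no control because the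
identity does not divide by them. -/
lemma intertwines_of_frequently {v n S' t' : ℤ} (hline : (γ.model 0).LineRegular S t)
    (hnorm : (γ.model 0).NormRegular (a 0) (b 0) (c 0))
    (hD : (γ.model 0).NonvanishingOn S t ((γ.model 0).uniDen S t))
    (hD' : (γ.model 0).NonvanishingOn S' t' (((γ.model 0).shift n).uniDen S' t'))
    (hfreq : ∃ᶠ ε in 𝓝 0, (γ.model ε).Intertwines v n S t S' t' (a ε) (b ε) (c ε)) :
    (γ.model 0).Intertwines v n S t S' t' (a 0) (b 0) (c 0) := by
  intro Y hY
  have hn := (γ.model 0).normDown_ne_zero (S := S) (t := t) (ha₀ 0) (hb₀ 0) (hc₀ 0) hnorm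
  have hw : ∀ X ∈ M.config S t,
      ContinuousAt (fun ε => (γ.model ε).selbergWeight S t X) 0 := by
    intro X hX
    have := γ.continuousAt_shiftWeight (S := S) (t := t) (n := 0) (X := X) (ε₀ := 0)
      (by rw [shift_zero]; exact hD X hX)
    simpa only [shiftWeight_zero] using this
  have hmass : ContinuousAt (fun ε => (γ.model ε).selbergMass S t) 0 := by
    change ContinuousAt (fun ε => ∑ X ∈ M.config S t, (γ.model ε).selbergWeight S t X) 0
    exact tendsto_finsetSum _ hw
  have hf : ContinuousAt (fun ε => (γ.model ε).shiftMass n S' t' * ∑ X ∈ M.config S t,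
      (γ.model ε).matrixStep v S t S' t' (a ε) (b ε) (c ε) X Y *
        (γ.model ε).selbergWeight S t X) 0 := by
    have hterm : ∀ X ∈ M.config S t, ContinuousAt (fun ε =>
        (γ.model ε).matrixStep v S t S' t' (a ε) (b ε) (c ε) X Y *
          (γ.model ε).selbergWeight S t X) 0 := fun X hX =>
      (γ.continuousAt_matrixStep ha hb hc ha₀ hb₀ hc₀ hline hn hX Y).fun_mul (hw X hX)
    exact (γ.continuousAt_shiftMass hD').fun_mul (tendsto_finsetSum _ hterm)
  have hg : ContinuousAt (fun ε => (γ.model ε).selbergMass S t *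
      (γ.model ε).shiftWeight n S' t' Y) 0 :=
    hmass.fun_mul (γ.continuousAt_shiftWeight (hD' Y hY))
  by_contra hne
  have hev := (hf.sub hg).eventually_ne (sub_ne_zero.2 hne)
  refine hfreq (hev.mono fun ε hε hε' => hε (sub_eq_zero.2 ?_))
  exact hε' Y hY

end Matrices

end Deformation

/-- The weight of `v₁` and `v₂` in the generic deformation. -/
def genericExponent (M : EllipticModel) : ℕ := 4 * M.T + M.N + 4

/-- A deformation that makes all relevant theta functions nonzero. -/
def generic (M : EllipticModel) : Deformation M where
  sq ε := M.sq * Complex.exp ε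
  sv₁ ε := M.sv₁ * Complex.exp ε ^ M.genericExponent
  sv₂ ε := M.sv₂ * Complex.exp ε ^ M.genericExponent
  sq_ne_zero ε := mul_ne_zero M.sq_ne_zero (Complex.exp_ne_zero _)
  sv₁_ne_zero ε := mul_ne_zero M.sv₁_ne_zero (pow_ne_zero _ (Complex.exp_ne_zero _))
  sv₂_ne_zero ε := mul_ne_zero M.sv₂_ne_zero (pow_ne_zero _ (Complex.exp_ne_zero _))
  continuous_sq := by fun_prop
  continuous_sv₁ := by fun_prop
  continuous_sv₂ := by fun_prop

/-! ### Nonvanishing of theta functions along the generic deformation. -/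

section Generic

variable (M : EllipticModel)

lemma generic_zero : M.generic.model 0 = M := by
  obtain ⟨p, sq, sv₁, sv₂, N, T, hp, h0, h1, h2⟩ := M
  simp [generic]

/-- Along the deformation, q^m v₁^i v₂^j is multiplied by e^(2ε(m + w(i+j))), where w is the generic
exponent. Whenever v₁ or v₂ occurs, w is large enough to outweigh the powers of q that are needed,
so the exponent does not vanish. -/
lemma generic_theta (m : ℤ) (i j : ℕ) (h : m + M.genericExponent * (i + j) ≠ 0) :
    ∀ᶠ ε in cocountable, (M.generic.model ε).θ ((M.generic.model ε).q ^ m *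
      (M.generic.model ε).v₁ ^ i * (M.generic.model ε).v₂ ^ j) ≠ 0 := by
  have hc : M.q ^ m * M.v₁ ^ i * M.v₂ ^ j ≠ 0 :=
    mul_ne_zero (mul_ne_zero (zpow_ne_zero _ M.q_ne_zero)
      (pow_ne_zero _ (pow_ne_zero 2 M.sv₁_ne_zero))) (pow_ne_zero _ (pow_ne_zero 2 M.sv₂_ne_zero))
  have h1 := countable_theta_exp_zeros M.norm_p_lt_one hc (mul_ne_zero two_ne_zero h)
  rw [Filter.Eventually, mem_cocountable]
  refine h1.mono fun ε hε => ?_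
  have h2 : (M.generic.model ε).θ ((M.generic.model ε).q ^ m *
      (M.generic.model ε).v₁ ^ i * (M.generic.model ε).v₂ ^ j) = 0 := not_not.1 hε
  have he : Complex.exp ε ≠ 0 := Complex.exp_ne_zero _
  have h3 : (M.generic.model ε).q ^ m * (M.generic.model ε).v₁ ^ i * (M.generic.model ε).v₂ ^ j =
      M.q ^ m * M.v₁ ^ i * M.v₂ ^ j *
        Complex.exp ε ^ (2 * (m + M.genericExponent * ((i : ℤ) + j))) := by
    have e1 : Complex.exp ε ^ (2 * (m + M.genericExponent * ((i : ℤ) + j))) =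
        (Complex.exp ε ^ 2) ^ m * ((Complex.exp ε ^ M.genericExponent) ^ 2) ^ i *
          ((Complex.exp ε ^ M.genericExponent) ^ 2) ^ j := by
      simp only [← zpow_natCast, ← zpow_mul, ← zpow_add₀ he]
      congr 1
      push_cast
      ring
    change ((M.sq * Complex.exp ε) ^ 2) ^ m *
      ((M.sv₁ * Complex.exp ε ^ M.genericExponent) ^ 2) ^ i *
      ((M.sv₂ * Complex.exp ε ^ M.genericExponent) ^ 2) ^ j = _
    rw [e1, mul_pow M.sq, mul_zpow, mul_pow M.sv₁, mul_pow M.sv₂, mul_pow (M.sv₁ ^ 2),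
      mul_pow (M.sv₂ ^ 2), q, v₁, v₂]
    ring
  rw [h3] at h2
  exact h2

lemma generic_theta_q (m : ℤ) (h : m ≠ 0) :
    ∀ᶠ ε in cocountable, (M.generic.model ε).θ ((M.generic.model ε).q ^ m) ≠ 0 := by
  simpa only [pow_zero, mul_one] using M.generic_theta m 0 0 (by simpa using h)

lemma generic_theta_v₁ (m : ℤ) (h : 0 < m + M.genericExponent) :
    ∀ᶠ ε in cocountable, (M.generic.model ε).θ ((M.generic.model ε).q ^ m *
      (M.generic.model ε).v₁) ≠ 0 := by
  simpa only [pow_zero, mul_one, pow_one] using M.generic_theta m 1 0 (by simpa using h.ne')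

lemma generic_theta_v₂ (m : ℤ) (h : 0 < m + M.genericExponent) :
    ∀ᶠ ε in cocountable, (M.generic.model ε).θ ((M.generic.model ε).q ^ m *
      (M.generic.model ε).v₂) ≠ 0 := by
  simpa only [pow_zero, mul_one, pow_one] using M.generic_theta m 0 1 (by simpa using h.ne')

lemma generic_theta_v₁_v₂ (m : ℤ) (h : 0 < m + M.genericExponent) :
    ∀ᶠ ε in cocountable, (M.generic.model ε).θ ((M.generic.model ε).q ^ m *
      (M.generic.model ε).v₁ * (M.generic.model ε).v₂) ≠ 0 := by
  simpa only [pow_one] using M.generic_theta m 1 1 (by push_cast; omega)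

lemma generic_regConst (S t : ℤ) :
    ∀ᶠ ε in cocountable, (M.generic.model ε).regConst S t ≠ 0 := by
  by_cases h : t + S - M.T = 0
  · refine Eventually.of_forall fun ε => ?_
    rw [regConst, if_pos h]
    exact one_ne_zero
  · filter_upwards [M.generic_theta_q (M.T - t - S) (by omega)] with ε hε
    rw [regConst, if_neg h]
    exact hε

end Generic

lemma frequently_of_cocountable {P : ℝ → Prop} (h : ∀ᶠ ε in cocountable, P ε) (x : ℝ) :
    ∃ᶠ ε in 𝓝 x, P ε := by
  have h1 : ({ε | P ε}ᶜ : Set ℝ).Countable := mem_cocountable.1 h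
  have h2 := h1.dense_compl ℝ x
  rw [compl_compl] at h2
  exact mem_closure_iff_frequently.1 h2

/-- There is a single, empty configuration. The case is separate because for N = 0 the constant of
detailed balance may contain θ(q^0), which vanishes for all parameters. -/
lemma intertwines_of_N_eq_zero {M : EllipticModel} (hN : M.N = 0) {v n S t S' t' : ℤ} {a b c : ℂ}
    (hrow : RowSumsOne (M.config S t) (M.config S' t') (M.matrixStep v S t S' t' a b c)) :
    M.Intertwines v n S t S' t' a b c := by
  have : IsEmpty (Fin M.N) := by
    rw [hN]
    infer_instance
  have hw : ∀ (n S t : ℤ) X, M.shiftWeight n S t X = 1 := by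
    intro n S t X
    simp [shiftWeight, phiProd]
  have hconf : ∀ S t : ℤ, M.config S t = {default} := by
    intro S t
    ext X
    rw [mem_config, Finset.mem_singleton]
    exact ⟨fun _ => Subsingleton.elim _ _, fun _ => ⟨isEmptyElim, fun k => isEmptyElim k⟩⟩
  have h1 := hrow default (by rw [hconf, Finset.mem_singleton])
  intro Y _
  rw [hconf, Finset.sum_singleton] at h1
  rw [shiftMass, ← shiftMass_zero, shiftMass, ← shiftWeight_zero, Subsingleton.elim Y default]
  simp only [hconf, Finset.sum_singleton, hw, h1, mul_one]

lemma rho_shift_zero (M : EllipticModel) (S t : ℤ) : (M.shift 0).rho S t = M.rho S t := by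
  rw [rho_shift, shiftWeight_zero, shiftMass_zero]
  rfl

/-- It suffices to prove the transport of the densities for generic parameters. -/
lemma carries_of_generic {M : EllipticModel} {v n S t S' t' : ℤ} {a b c : EllipticModel → ℂ}
    (ha₀ : ∀ M, a M ≠ 0) (hb₀ : ∀ M, b M ≠ 0) (hc₀ : ∀ M, c M ≠ 0)
    (ha : ∀ γ : Deformation M, Continuous fun ε => a (γ.model ε))
    (hb : ∀ γ : Deformation M, Continuous fun ε => b (γ.model ε))
    (hc : ∀ γ : Deformation M, Continuous fun ε => c (γ.model ε))
    (hline : M.LineRegular S t) (hnorm : M.NormRegular (a M) (b M) (c M))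
    (hrow : RowSumsOne (M.config S t) (M.config S' t')
      (M.matrixStep v S t S' t' (a M) (b M) (c M)))
    (hgen : 0 < M.N → ∀ᶠ ε in cocountable, ∀ M', M.generic.model ε = M' →
      M'.LineRegular S t → M'.NormRegular (a M') (b M') (c M') →
      M'.NonvanishingOn S t (M'.uniDen S t) →
      M'.NonvanishingOn S' t' ((M'.shift n).uniDen S' t') →
      M'.Intertwines v n S t S' t' (a M') (b M') (c M'))
    (hR : M.RhoRegular S t) (hR' : (M.shift n).RhoRegular S' t') :
    Carries (M.config S t) (M.config S' t') (M.matrixStep v S t S' t' (a M) (b M) (c M))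
      (M.rho S t) ((M.shift n).rho S' t') := by
  refine Intertwines.carries ?_ hR.2 (by rw [← selbergMass_shift]; exact hR'.2)
  obtain hN | hN := Nat.eq_zero_or_pos M.N
  · exact intertwines_of_N_eq_zero hN hrow
  have hD : M.NonvanishingOn S t (M.uniDen S t) := hR.1
  have hD' : M.NonvanishingOn S' t' ((M.shift n).uniDen S' t') := hR'.1
  have h0 := M.generic_zero
  have key := M.generic.intertwines_of_frequently (v := v) (n := n) (S := S) (t := t) (S' := S')
    (t' := t') (ha M.generic) (hb M.generic) (hc M.generic) (fun _ => ha₀ _) (fun _ => hb₀ _)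
    (fun _ => hc₀ _) (by rwa [h0]) (by rwa [h0]) (by rwa [h0]) (by rwa [h0]) ?_
  · rwa [h0] at key
  · have e1 := M.generic.eventually_lineRegular (S := S) (t := t) (by rwa [h0])
    have e2 := M.generic.eventually_normRegular (ha M.generic) (hb M.generic) (hc M.generic)
      (fun _ => ha₀ _) (fun _ => hb₀ _) (fun _ => hc₀ _) (by rwa [h0])
    have e3 := M.generic.eventually_nonvanishingOn (S := S) (t := t) (by rwa [h0])
    have e4 := (M.generic.shift n).eventually_nonvanishingOn (S := S') (t := t') (by
      rw [← Deformation.model_shift, h0]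
      exact hD')
    -- Regularity holds on a neighborhood of 0, generic parameters accumulate at 0, so both hold
    -- together arbitrarily close to 0.
    refine (frequently_of_cocountable (hgen hN) 0).mp ?_
    filter_upwards [e1, e2, e3, e4] with ε h1 h2 h3 h4 h
    exact h _ rfl h1 h2 h3 h4

end EllipticModel

end

noncomputable section

namespace EllipticModel

open EllipticTheta Filter Topology

/-! ### The six matrices -/

section Six

variable (M : EllipticModel) {S t : ℤ} (hS₀ : 0 ≤ S) (hST : S ≤ M.T) (ht₀ : 0 ≤ t) (htT : t ≤ M.T)
  (hline : M.LineRegular S t)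

include hS₀ hST ht₀ htT hline

/-- The constant K₁ of `linePair_t` is a product of thetas at q^(-N-t), q^(-t-S)v₁, q^(-t-S)v₁v₂.
Each is nonzero for all but countably many ε, the first because N > 0. The other five matrices are
handled alike, with their own pair and constant. -/
lemma Ptp_stochastic (hnorm : M.NormRegular (M.A S t) (M.B S t) (M.C S t)) :
    RowSumsOne (M.config S t) (M.config S (t + 1)) (M.Ptp S t) ∧
      (M.RhoRegular S t → M.RhoRegular S (t + 1) →
        Carries (M.config S t) (M.config S (t + 1)) (M.Ptp S t) (M.rho S t)
          (M.rho S (t + 1))) := by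
  have hrow := (M.linePair_t S t).rowSumsOne_up (hline.theta_pow_ne_zero hS₀ hST ht₀ htT) hline
    hnorm
  rw [Ptp, matrixUp_eq_matrixStep]
  refine ⟨hrow, fun hR hR' => ?_⟩
  rw [← M.rho_shift_zero S (t + 1)]
  refine carries_of_generic (a := fun M => M.A S t) (b := fun M => M.B S t)
    (c := fun M => M.C S t) (fun M => M.A_ne_zero S t) (fun M => M.B_ne_zero S t)
    (fun M => M.C_ne_zero S t) (fun γ => γ.continuous_A S t) (fun γ => γ.continuous_B S t)
    (fun γ => γ.continuous_C S t) hline hnorm hrow (fun hN => ?_) hR (by rwa [shift_zero])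
  filter_upwards [M.generic_theta_q (1 - M.N - (t + 1)) (by omega),
    M.generic_theta_v₁ (1 - (t + 1) - S) (by unfold genericExponent; omega),
    M.generic_theta_v₁_v₂ (1 - (t + 1) - S) (by unfold genericExponent; omega)] with ε k1 k2 k3
  rintro M' rfl h1 h2 h3 h4
  exact LinePair.intertwines_up (by rw [shift_zero]; exact linePair_t _ S t)
    (mul_ne_zero (mul_ne_zero k1 k2) k3) (h1.theta_pow_ne_zero hS₀ hST ht₀ htT) h1 h2 h3 h4

lemma PtpSp_stochastic (hnorm : M.NormRegular (M.A S t) (M.B S t) (M.D S t)) :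
    RowSumsOne (M.config S t) (M.config (S + 1) t) (M.PtpSp S t) ∧
      (M.RhoRegular S t → M.RhoRegular (S + 1) t →
        Carries (M.config S t) (M.config (S + 1) t) (M.PtpSp S t) (M.rho S t)
          (M.rho (S + 1) t)) := by
  have hrow := (M.linePair_S S t).rowSumsOne_up (hline.theta_pow_ne_zero hS₀ hST ht₀ htT) hline
    hnorm
  rw [PtpSp, matrixUp_eq_matrixStep]
  refine ⟨hrow, fun hR hR' => ?_⟩
  rw [← M.rho_shift_zero (S + 1) t]
  refine carries_of_generic (a := fun M => M.A S t) (b := fun M => M.B S t)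
    (c := fun M => M.D S t) (fun M => M.A_ne_zero S t) (fun M => M.B_ne_zero S t)
    (fun M => M.D_ne_zero S t) (fun γ => γ.continuous_A S t) (fun γ => γ.continuous_B S t)
    (fun γ => γ.continuous_D S t) hline hnorm hrow (fun hN => ?_) hR (by rwa [shift_zero])
  filter_upwards [M.generic_theta_q (1 - M.N - (S + 1)) (by omega),
    M.generic_theta_v₁ (1 - t - (S + 1)) (by unfold genericExponent; omega),
    M.generic_theta_v₁_v₂ (1 - t - (S + 1)) (by unfold genericExponent; omega)] with ε k1 k2 k3
  rintro M' rfl h1 h2 h3 h4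
  exact LinePair.intertwines_up (by rw [shift_zero]; exact linePair_S _ S t)
    (mul_ne_zero (mul_ne_zero k2 k3) k1) (h1.theta_pow_ne_zero hS₀ hST ht₀ htT) h1 h2 h3 h4

lemma PtmSp_stochastic (hnorm : M.NormRegular (M.D S t) (M.E S t) (M.A S t)) :
    RowSumsOne (M.config S t) (M.config (S + 1) t) (M.PtmSp S t) ∧
      (M.RhoRegular S t → (M.shift 1).RhoRegular (S + 1) t →
        Carries (M.config S t) (M.config (S + 1) t) (M.PtmSp S t) (M.rho S t)
          ((M.shift 1).rho (S + 1) t)) := by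
  have hrow := (M.linePair_S_shift S t).rowSumsOne_up (hline.theta_pow_ne_zero hS₀ hST ht₀ htT)
    hline hnorm
  rw [PtmSp, matrixUp_eq_matrixStep]
  refine ⟨hrow, fun hR hR' => ?_⟩
  refine carries_of_generic (a := fun M => M.D S t) (b := fun M => M.E S t)
    (c := fun M => M.A S t) (fun M => M.D_ne_zero S t) (fun M => M.E_ne_zero S t)
    (fun M => M.A_ne_zero S t) (fun γ => γ.continuous_D S t) (fun γ => γ.continuous_E S t)
    (fun γ => γ.continuous_A S t) hline hnorm hrow (fun hN => ?_) hR hR'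
  filter_upwards [M.generic_theta_q (1 - M.N - (S + 1)) (by omega),
    M.generic_theta_v₂ M.T (by unfold genericExponent; omega),
    M.generic_theta_v₁_v₂ (1 - t - (S + 1)) (by unfold genericExponent; omega)] with ε k1 k2 k3
  rintro M' rfl h1 h2 h3 h4
  exact LinePair.intertwines_up (linePair_S_shift _ S t)
    (mul_ne_zero (mul_ne_zero k2 k1) k3) (h1.theta_pow_ne_zero hS₀ hST ht₀ htT) h1 h2 h3 h4

lemma Ptm_stochastic (hnorm : M.NormRegular (M.D S t) (M.E S t) (M.F S t)) :
    RowSumsOne (M.config S t) (M.config S (t - 1)) (M.Ptm S t) ∧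
      (M.RhoRegular S t → M.RhoRegular S (t - 1) →
        Carries (M.config S t) (M.config S (t - 1)) (M.Ptm S t) (M.rho S t)
          (M.rho S (t - 1))) := by
  -- Line pairs are indexed by their lower line, which is the target here.
  obtain ⟨s, rfl⟩ : ∃ s, t = s + 1 := ⟨t - 1, by ring⟩
  rw [add_sub_cancel_right, Ptm, matrixDown_eq_matrixStep, add_sub_cancel_right]
  have hrow := (M.linePair_t S s).rowSumsOne_down (hline.theta_pow_ne_zero hS₀ hST ht₀ htT) hline
    hnorm
  refine ⟨hrow, fun hR hR' => ?_⟩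
  rw [← M.rho_shift_zero S s]
  refine carries_of_generic (a := fun M => M.D S (s + 1)) (b := fun M => M.E S (s + 1))
    (c := fun M => M.F S (s + 1)) (fun M => M.D_ne_zero _ _) (fun M => M.E_ne_zero _ _)
    (fun M => M.F_ne_zero _ _) (fun γ => γ.continuous_D _ _) (fun γ => γ.continuous_E _ _)
    (fun γ => γ.continuous_F _ _) hline hnorm hrow (fun hN => ?_) hR (by rwa [shift_zero])
  filter_upwards [M.generic_regConst S s,
    M.generic_theta_v₁ (1 - (s + 1) - M.T - S) (by unfold genericExponent; omega),
    M.generic_theta_v₁_v₂ (1 + M.N - (s + 1)) (by unfold genericExponent; omega)] with ε k1 k2 k3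
  rintro M' rfl h1 h2 h3 h4
  exact LinePair.intertwines_down (by rw [shift_zero]; exact linePair_t _ S s)
    (mul_ne_zero (mul_ne_zero k1 k2) k3) (h1.theta_pow_ne_zero hS₀ hST ht₀ htT) h1 h2 h3 h4

lemma PtmSm_stochastic (hnorm : M.NormRegular (M.E S t) (M.F S t) (M.C S t)) :
    RowSumsOne (M.config S t) (M.config (S - 1) t) (M.PtmSm S t) ∧
      (M.RhoRegular S t → M.RhoRegular (S - 1) t →
        Carries (M.config S t) (M.config (S - 1) t) (M.PtmSm S t) (M.rho S t)
          (M.rho (S - 1) t)) := by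
  obtain ⟨R, rfl⟩ : ∃ R, S = R + 1 := ⟨S - 1, by ring⟩
  rw [add_sub_cancel_right, PtmSm, matrixDown_eq_matrixStep, add_sub_cancel_right]
  have hrow := (M.linePair_S R t).rowSumsOne_down (hline.theta_pow_ne_zero hS₀ hST ht₀ htT) hline
    hnorm
  refine ⟨hrow, fun hR hR' => ?_⟩
  rw [← M.rho_shift_zero R t]
  refine carries_of_generic (a := fun M => M.E (R + 1) t) (b := fun M => M.F (R + 1) t)
    (c := fun M => M.C (R + 1) t) (fun M => M.E_ne_zero _ _) (fun M => M.F_ne_zero _ _)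
    (fun M => M.C_ne_zero _ _) (fun γ => γ.continuous_E _ _) (fun γ => γ.continuous_F _ _)
    (fun γ => γ.continuous_C _ _) hline hnorm hrow (fun hN => ?_) hR (by rwa [shift_zero])
  filter_upwards [M.generic_regConst R t,
    M.generic_theta_v₁ (1 - t - M.T - (R + 1)) (by unfold genericExponent; omega),
    M.generic_theta_v₁_v₂ (1 + M.N - (R + 1)) (by unfold genericExponent; omega)] with ε k1 k2 k3
  rintro M' rfl h1 h2 h3 h4
  exact LinePair.intertwines_down (by rw [shift_zero]; exact linePair_S _ R t)
    (mul_ne_zero (mul_ne_zero k1 k2) k3) (h1.theta_pow_ne_zero hS₀ hST ht₀ htT) h1 h2 h3 h4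

lemma PtpSm_stochastic (hnorm : M.NormRegular (M.B S t) (M.C S t) (M.F S t)) :
    RowSumsOne (M.config S t) (M.config (S - 1) t) (M.PtpSm S t) ∧
      (M.RhoRegular S t → (M.shift (-1)).RhoRegular (S - 1) t →
        Carries (M.config S t) (M.config (S - 1) t) (M.PtpSm S t) (M.rho S t)
          ((M.shift (-1)).rho (S - 1) t)) := by
  obtain ⟨R, rfl⟩ : ∃ R, S = R + 1 := ⟨S - 1, by ring⟩
  rw [add_sub_cancel_right, PtpSm, matrixDown_eq_matrixStep, add_sub_cancel_right]
  have hrow := (M.linePair_S_shift' R t).rowSumsOne_down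
    (hline.theta_pow_ne_zero hS₀ hST ht₀ htT) hline hnorm
  refine ⟨hrow, fun hR hR' => ?_⟩
  refine carries_of_generic (a := fun M => M.B (R + 1) t) (b := fun M => M.C (R + 1) t)
    (c := fun M => M.F (R + 1) t) (fun M => M.B_ne_zero _ _) (fun M => M.C_ne_zero _ _)
    (fun M => M.F_ne_zero _ _) (fun γ => γ.continuous_B _ _) (fun γ => γ.continuous_C _ _)
    (fun γ => γ.continuous_F _ _) hline hnorm hrow (fun hN => ?_) hR hR'
  filter_upwards [M.generic_regConst R t,
    M.generic_theta_v₂ 1 (by unfold genericExponent; omega),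
    M.generic_theta_v₁_v₂ (1 + M.N - (R + 1)) (by unfold genericExponent; omega)] with ε k1 k2 k3
  rintro M' rfl h1 h2 h3 h4
  rw [zpow_one] at k2
  exact LinePair.intertwines_down (linePair_S_shift' _ R t)
    (mul_ne_zero (mul_ne_zero k3 k2) k1) (h1.theta_pow_ne_zero hS₀ hST ht₀ htT) h1 h2 h3 h4

end Six

end EllipticModel

end

theorem theorem4p6 (M : EllipticModel) (S t : ℤ) (hS₀ : 0 ≤ S) (hST : S ≤ M.T)
    (ht₀ : 0 ≤ t) (htT : t ≤ M.T) (hline : M.LineRegular S t) :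
    -- t → t + 1
    (t + 1 ≤ M.T → M.NormRegular (M.A S t) (M.B S t) (M.C S t) →
      EllipticModel.RowSumsOne (M.config S t) (M.config S (t + 1)) (M.Ptp S t) ∧
      (M.RhoRegular S t → M.RhoRegular S (t + 1) →
        EllipticModel.Carries (M.config S t) (M.config S (t + 1)) (M.Ptp S t)
          (M.rho S t) (M.rho S (t + 1)))) ∧
    -- t → t - 1
    (0 ≤ t - 1 → M.NormRegular (M.D S t) (M.E S t) (M.F S t) →
      EllipticModel.RowSumsOne (M.config S t) (M.config S (t - 1)) (M.Ptm S t) ∧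
      (M.RhoRegular S t → M.RhoRegular S (t - 1) →
        EllipticModel.Carries (M.config S t) (M.config S (t - 1)) (M.Ptm S t)
          (M.rho S t) (M.rho S (t - 1)))) ∧
    -- S → S + 1, first matrix
    (S + 1 ≤ M.T → M.NormRegular (M.A S t) (M.B S t) (M.D S t) →
      EllipticModel.RowSumsOne (M.config S t) (M.config (S + 1) t) (M.PtpSp S t) ∧
      (M.RhoRegular S t → M.RhoRegular (S + 1) t →
        EllipticModel.Carries (M.config S t) (M.config (S + 1) t) (M.PtpSp S t)
          (M.rho S t) (M.rho (S + 1) t))) ∧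
    -- S → S - 1, first matrix: the target measure has parameters (v₁ / q, q v₂)
    (0 ≤ S - 1 → M.NormRegular (M.B S t) (M.C S t) (M.F S t) →
      EllipticModel.RowSumsOne (M.config S t) (M.config (S - 1) t) (M.PtpSm S t) ∧
      (M.RhoRegular S t → (M.shift (-1)).RhoRegular (S - 1) t →
        EllipticModel.Carries (M.config S t) (M.config (S - 1) t) (M.PtpSm S t)
          (M.rho S t) ((M.shift (-1)).rho (S - 1) t))) ∧
    -- S → S + 1, second matrix: the target measure has parameters (q v₁, v₂ / q)
    (S + 1 ≤ M.T → M.NormRegular (M.D S t) (M.E S t) (M.A S t) →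
      EllipticModel.RowSumsOne (M.config S t) (M.config (S + 1) t) (M.PtmSp S t) ∧
      (M.RhoRegular S t → (M.shift 1).RhoRegular (S + 1) t →
        EllipticModel.Carries (M.config S t) (M.config (S + 1) t) (M.PtmSp S t)
          (M.rho S t) ((M.shift 1).rho (S + 1) t))) ∧
    -- S → S - 1, second matrix
    (0 ≤ S - 1 → M.NormRegular (M.E S t) (M.F S t) (M.C S t) →
      EllipticModel.RowSumsOne (M.config S t) (M.config (S - 1) t) (M.PtmSm S t) ∧
      (M.RhoRegular S t → M.RhoRegular (S - 1) t →
        EllipticModel.Carries (M.config S t) (M.config (S - 1) t) (M.PtmSm S t)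
          (M.rho S t) (M.rho (S - 1) t))) := by
  exact ⟨fun _ hn => M.Ptp_stochastic hS₀ hST ht₀ htT hline hn,
    fun _ hn => M.Ptm_stochastic hS₀ hST ht₀ htT hline hn,
    fun _ hn => M.PtpSp_stochastic hS₀ hST ht₀ htT hline hn,
    fun _ hn => M.PtpSm_stochastic hS₀ hST ht₀ htT hline hn,
    fun _ hn => M.PtmSp_stochastic hS₀ hST ht₀ htT hline hn,
    fun _ hn => M.PtmSm_stochastic hS₀ hST ht₀ htT hline hn⟩
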